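/- Let $k\ge 0$ and let $X$ be a connected CW-complex with finitely many cells in each dimension $\le \max(k,1)$. Let $x_0\in X$ and $G=\pi_1(X,x_0)$. For a character $\rho\in \mathrm{Hom}(G,\mathbb{C}^\times)$ let $\mathbb{C}_\rho$ be the associated rank one local system, and for $i\ge 0$ put $$\mathcal{V}^i_1(X,\mathbb{C})=\{\rho\in \mathrm{Hom}(G,\mathbb{C}^\times)\mid \dim_{\mathbb{C}} H_i(X,\mathbb{C}_\rho)\ge 1\}.$$ For $W\subseteq \mathrm{Hom}(G,\mathbb{C}^\times)$ let $\tau_1(W)=\{z\in \mathrm{Hom}(G,\mathbb{C})\mid \exp(tz)\in W \text{ for all } t\in\mathbb{C}\}$ be its exponential tangent cone, where $\exp(z)(g)=e^{z(g)}$, and let $TC_1(W)\subseteq \mathrm{Hom}(G,\mathbb{C})$ be its tangent cone at the trivial character $1$, that is, the common zero set of the initial forms of the germs at $1$ of analytic functions vanishing on $W$ near $1$. Identify $\mathrm{Hom}(G,\mathbb{C})$ with $H^1(X,\mathbb{C})$. Let $A=H^*(X,\mathbb{C})$ be the cohomology algebra of $X$ and put $$\mathcal{R}^i_1(X,\mathbb{C})=\{a\in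 H^1(X,\mathbb{C})\mid \dim_{\mathbb{C}} H^i(A,\cdot a)\ge 1\},$$ where $(A,\cdot a)$ is the complex $A^0\to A^1\to A^2\to\cdots$ whose differential is right multiplication by $a$. Say that $X$ satisfies condition $(*)_k$ if, for each $i\le k$, the part of $\mathcal{V}^i_1(X,\mathbb{C})$ contained in the connected component of $1$ in $\mathrm{Hom}(G,\mathbb{C}^\times)$ is a union of subtori passing through $1$, and $TC_1(\mathcal{V}^i_1(X,\mathbb{C}))=\mathcal{R}^i_1(X,\mathbb{C})$. For an epimorphism $\nu$ from $G$ to a free abelian group, let $X^\nu\to X$ be the connected Galois cover with $\pi_1(X^\nu)=\ker\nu$. 1. Let $\nu\colon G\twoheadrightarrow\mathbb{Z}$ be an epimorphism, and let $\nu_{\mathbb{C}}\in \mathrm{Hom}(G,\mathbb{C})$ be the composite of $\nu$ with the inclusion $\mathbb{Z}\subset\mathbb{C}$. Then $\bigoplus_{i\le k}H_i(X^\nu,\mathbb{C})$ is finite-dimensional over $\mathbb{C}$ if and only if $$\nu_{\mathbb{C}}\notin\bigcup_{i\le k}\tau_1\big(\mathcal{V}^i_1(X,\mathbb{C})\big).$$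 2. Suppose that $X$ satisfies $(*)_k$, and let $\nu\colon G\twoheadrightarrow\mathbb{Z}^r$ be an epimorphism, $r\ge 0$. Let $\nu^*\colon \mathrm{Hom}(\mathbb{Z}^r,\mathbb{C})\to \mathrm{Hom}(G,\mathbb{C})=H^1(X,\mathbb{C})$ be the induced map. Then $\bigoplus_{i\le k}H_i(X^\nu,\mathbb{C})$ is finite-dimensional over $\mathbb{C}$ if and only if $$\mathrm{im}(\nu^*)\cap\Big(\bigcup_{i\le k}\mathcal{R}^i_1(X,\mathbb{C})\Big)=\{0\}.$$ -/

import Mathlib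

open CategoryTheory

universe u

noncomputable section

namespace AbelCovers

/-! ### Simplices and fundamental-groupoid transport -/

section Transport

variable {X : Type u} [TopologicalSpace X]

/-- The type of singular `n`-simplices of `X`. -/
abbrev Simp (X : Type u) [TopologicalSpace X] (n : ℕ) : Type u :=
  C(stdSimplex ℝ (Fin (n + 1)), X)

/-- Restriction of a singular `n`-simplex along the affine map of standard simplices induced by a
map of vertices. -/
def pull {m n : ℕ} (θ : Fin (m + 1) → Fin (n + 1)) (σ : Simp X n) : Simp X m :=
  σ.comp ⟨stdSimplex.map θ, stdSimplex.continuous_map θ⟩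

theorem pull_pull {l m n : ℕ} (η : Fin (l + 1) → Fin (m + 1)) (θ : Fin (m + 1) → Fin (n + 1))
    (σ : Simp X n) : pull η (pull θ σ) = pull (θ ∘ η) σ := by
  ext x
  exact congrArg σ (stdSimplex.map_comp_apply η θ x)

theorem pull_id {n : ℕ} (σ : Simp X n) : pull id σ = σ := by
  ext x
  exact congrArg σ (stdSimplex.map_id_apply x)

/-- A connected CW complex is path connected. -/
instance (priority := 50) pathConnectedSpace_of_cwComplex [T2Space X]
    [Topology.CWComplex (Set.univ : Set X)] [ConnectedSpace X] : PathConnectedSpace X := by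
  have hcell : ∀ (n : ℕ) (j : Topology.RelCWComplex.cell (Set.univ : Set X) n),
      IsPathConnected (Topology.RelCWComplex.closedCell (C := (Set.univ : Set X)) n j) := by
    intro n j
    refine IsPathConnected.image' ?_ (Topology.RelCWComplex.continuousOn n j)
    exact (convex_closedBall (0 : Fin n → ℝ) 1).isPathConnected ⟨0, by simp⟩
  have key : ∀ A : Set X, (∀ x y, Joined x y → x ∈ A → y ∈ A) → IsClosed A := by
    intro A hA
    rw [Topology.CWComplex.closed (Set.univ : Set X) A (Set.subset_univ _)]
    intro n j
    by_cases h : (A ∩ Topology.RelCWComplex.closedCell (C := (Set.univ : Set X)) n j).Nonempty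
    · obtain ⟨x, hxA, hxc⟩ := h
      have : A ∩ Topology.RelCWComplex.closedCell (C := (Set.univ : Set X)) n j
          = Topology.RelCWComplex.closedCell (C := (Set.univ : Set X)) n j := by
        refine Set.inter_eq_right.mpr fun y hy => hA x y ?_ hxA
        exact ((hcell n j).joinedIn x hxc y hy).joined
      rw [this]
      exact Topology.RelCWComplex.isClosed_closedCell
    · rw [Set.not_nonempty_iff_eq_empty.mp h]
      exact isClosed_empty
  refine ⟨inferInstance, fun x y => ?_⟩
  have h1 : IsClosed (pathComponent x) := key _ fun a b hab ha => Joined.trans ha hab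
  have h2 : IsClosed (pathComponent x)ᶜ :=
    key _ fun a b hab ha hb => ha (Joined.trans hb hab.symm)
  have h3 : pathComponent x = Set.univ :=
    IsClopen.eq_univ ⟨h1, isClosed_compl_iff.mp h2⟩ ⟨x, mem_pathComponent_self x⟩
  have : y ∈ pathComponent x := h3 ▸ Set.mem_univ y
  exact this

variable [PathConnectedSpace X] {A : Type*} [CommGroup A]

/-- The homotopy class of a chosen path from the base point `x₀` to `x`. -/
def basePath (x₀ x : X) : Path.Homotopic.Quotient x₀ x :=
  Path.Homotopic.Quotient.mk (PathConnectedSpace.somePath x₀ x)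

/-- A homomorphism `φ : π₁(X, x₀) → A` to an abelian group, extended to the fundamental groupoid
by means of the chosen paths: the class of `γ` from `x` to `y` is sent to `φ (c_x · γ · c_y⁻¹)`. -/
def transport {x₀ : X} (φ : FundamentalGroup X x₀ →* A) {x y : X}
    (γ : Path.Homotopic.Quotient x y) : A :=
  φ (FundamentalGroup.fromPath (((basePath x₀ x).trans γ).trans (basePath x₀ y).symm))

theorem transport_trans {x₀ : X} (φ : FundamentalGroup X x₀ →* A) {x y z : X}
    (γ : Path.Homotopic.Quotient x y) (δ : Path.Homotopic.Quotient y z) :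
    transport φ (γ.trans δ) = transport φ γ * transport φ δ := by
  unfold transport
  rw [mul_comm, ← map_mul, FundamentalGroup.mul_def]
  congr 1
  change Path.Homotopic.Quotient.trans _ _ = Path.Homotopic.Quotient.trans
    (Path.Homotopic.Quotient.trans _ _) (Path.Homotopic.Quotient.trans _ _)
  simp only [Path.Homotopic.Quotient.trans_assoc]
  congr 2
  rw [← Path.Homotopic.Quotient.trans_assoc (basePath x₀ y).symm]
  simp

/-- The standard simplex is contractible. -/
instance contractible_stdSimplex (n : ℕ) : ContractibleSpace (stdSimplex ℝ (Fin (n + 1))) :=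
  (convex_stdSimplex ℝ (Fin (n + 1))).contractibleSpace ⟨_, single_mem_stdSimplex ℝ 0⟩

/-- The value of `transport φ` on the image under `σ` of the (unique up to homotopy) path from
`a` to `b` in the standard simplex. -/
def weight {x₀ : X} (φ : FundamentalGroup X x₀ →* A) {n : ℕ} (σ : Simp X n)
    (a b : stdSimplex ℝ (Fin (n + 1))) : A :=
  transport φ
    ((Path.Homotopic.Quotient.mk (PathConnectedSpace.somePath a b)).map σ)

theorem weight_eq {x₀ : X} (φ : FundamentalGroup X x₀ →* A) {n : ℕ} (σ : Simp X n)
    {a b : stdSimplex ℝ (Fin (n + 1))} (p : Path.Homotopic.Quotient a b) :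
    weight φ σ a b = transport φ (p.map σ) := by
  unfold weight
  rw [Subsingleton.elim p (Path.Homotopic.Quotient.mk (PathConnectedSpace.somePath a b))]

theorem weight_mul {x₀ : X} (φ : FundamentalGroup X x₀ →* A) {n : ℕ} (σ : Simp X n)
    (a b c : stdSimplex ℝ (Fin (n + 1))) :
    weight φ σ a b * weight φ σ b c = weight φ σ a c := by
  rw [weight, weight, ← transport_trans,
    weight_eq φ σ ((Path.Homotopic.Quotient.mk (PathConnectedSpace.somePath a b)).trans
      (Path.Homotopic.Quotient.mk (PathConnectedSpace.somePath b c)))]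
  congr 1
  exact (congrArg Path.Homotopic.Quotient.mk
    (Path.map_trans (PathConnectedSpace.somePath a b) (PathConnectedSpace.somePath b c)
      σ.continuous)).symm

theorem weight_self {x₀ : X} (φ : FundamentalGroup X x₀ →* A) {n : ℕ} (σ : Simp X n)
    (a : stdSimplex ℝ (Fin (n + 1))) : weight φ σ a a = 1 := by
  have h := weight_mul φ σ a a a
  exact mul_eq_left.mp h

theorem weight_pull {x₀ : X} (φ : FundamentalGroup X x₀ →* A) {m n : ℕ}
    (θ : Fin (m + 1) → Fin (n + 1)) (σ : Simp X n) (a b : stdSimplex ℝ (Fin (m + 1))) :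
    weight φ (pull θ σ) a b = weight φ σ (stdSimplex.map θ a) (stdSimplex.map θ b) := by
  exact (weight_eq φ σ ((Path.Homotopic.Quotient.mk (PathConnectedSpace.somePath a b)).map
    ⟨stdSimplex.map θ, stdSimplex.continuous_map θ⟩)).symm

/-- `weight` along the edge joining the `i`-th vertex to the `j`-th vertex of `σ`. -/
def edgeWeight {x₀ : X} (φ : FundamentalGroup X x₀ →* A) {n : ℕ} (σ : Simp X n)
    (i j : Fin (n + 1)) : A :=
  weight φ σ (stdSimplex.vertex i) (stdSimplex.vertex j)

theorem edgeWeight_mul {x₀ : X} (φ : FundamentalGroup X x₀ →* A) {n : ℕ} (σ : Simp X n)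
    (i j k : Fin (n + 1)) : edgeWeight φ σ i j * edgeWeight φ σ j k = edgeWeight φ σ i k :=
  weight_mul φ σ _ _ _

theorem edgeWeight_self {x₀ : X} (φ : FundamentalGroup X x₀ →* A) {n : ℕ} (σ : Simp X n)
    (i : Fin (n + 1)) : edgeWeight φ σ i i = 1 :=
  weight_self φ σ _

theorem edgeWeight_pull {x₀ : X} (φ : FundamentalGroup X x₀ →* A) {m n : ℕ}
    (θ : Fin (m + 1) → Fin (n + 1)) (σ : Simp X n) (i j : Fin (m + 1)) :
    edgeWeight φ (pull θ σ) i j = edgeWeight φ σ (θ i) (θ j) := by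
  unfold edgeWeight
  rw [weight_pull, stdSimplex.map_vertex, stdSimplex.map_vertex]

end Transport

/-! ### Homology with coefficients in a rank one local system; characteristic varieties -/

section Twisted

variable {X : Type u} [TopologicalSpace X] [PathConnectedSpace X]

/-- The simplicial vector space of singular chains of `X` with coefficients in the rank one local
system `ℂ_ρ`. The fibre of the local system at the initial vertex of every simplex is identified
with `ℂ`; restricting a simplex `σ` along `θ` moves the coefficient along the edge from the vertex
`0` to the vertex `θ 0` of `σ`. -/
def twistedSimplicial {x₀ : X} (ρ : FundamentalGroup X x₀ →* ℂˣ) :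
    SimplicialObject (ModuleCat.{u} ℂ) where
  obj n := ModuleCat.of ℂ (Simp X n.unop.len →₀ ℂ)
  map {n m} f := ModuleCat.ofHom
    (Finsupp.linearCombination ℂ fun σ : Simp X n.unop.len =>
      Finsupp.single (pull f.unop.toOrderHom σ)
        ((edgeWeight ρ σ 0 (f.unop.toOrderHom 0) : ℂˣ) : ℂ))
  map_id n := by
    ext σ : 2
    refine LinearMap.ext_ring ?_
    simp only [ModuleCat.hom_ofHom, LinearMap.comp_apply, Finsupp.lsingle_apply,
      Finsupp.linearCombination_single, one_smul, ModuleCat.hom_id, LinearMap.id_apply]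
    have h1 : pull (⇑(SimplexCategory.Hom.toOrderHom (𝟙 n : n ⟶ n).unop)) σ = σ := pull_id σ
    have h2 : edgeWeight ρ σ 0 (SimplexCategory.Hom.toOrderHom (𝟙 n : n ⟶ n).unop 0) = 1 :=
      edgeWeight_self ρ σ 0
    rw [h1, h2, Units.val_one]
  map_comp {n m l} f g := by
    ext σ : 2
    refine LinearMap.ext_ring ?_
    simp only [ModuleCat.hom_ofHom, LinearMap.comp_apply, Finsupp.lsingle_apply,
      Finsupp.linearCombination_single, one_smul, ModuleCat.hom_comp, Finsupp.smul_single,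
      smul_eq_mul]
    have h1 : pull (⇑(SimplexCategory.Hom.toOrderHom (f ≫ g).unop)) σ
        = pull (⇑(SimplexCategory.Hom.toOrderHom g.unop))
          (pull (⇑(SimplexCategory.Hom.toOrderHom f.unop)) σ) :=
      (pull_pull (SimplexCategory.Hom.toOrderHom g.unop) (SimplexCategory.Hom.toOrderHom f.unop)
        σ).symm
    rw [h1, edgeWeight_pull, ← Units.val_mul, edgeWeight_mul]
    rfl

/-- `H_i(X, ℂ_ρ)`: singular homology of `X` with coefficients in the rank one local system given
by the character `ρ` of the fundamental group. -/
def twistedHomology {x₀ : X} (ρ : FundamentalGroup X x₀ →* ℂˣ) (i : ℕ) : ModuleCat.{u} ℂ :=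
  ((AlgebraicTopology.alternatingFaceMapComplex (ModuleCat.{u} ℂ)).obj
    (twistedSimplicial ρ)).homology i

/-- The characteristic variety `V^i_d(X, ℂ)` in `Hom(π₁(X), ℂˣ)`. -/
def charVariety (x₀ : X) (i d : ℕ) : Set (FundamentalGroup X x₀ →* ℂˣ) :=
  {ρ | (d : Cardinal) ≤ Module.rank ℂ (twistedHomology ρ i)}

end Twisted

/-! ### The singular cohomology algebra and resonance varieties -/

section Cohomology

variable (X : Type u) [TopologicalSpace X]

/-- Singular `n`-cochains with complex coefficients. -/
abbrev Cochain (n : ℕ) : Type u := Simp X n → ℂ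

/-- The coboundary `(δ f)(σ) = ∑ (-1)^i f(d_i σ)`. -/
def coboundary (n : ℕ) : Cochain X n →ₗ[ℂ] Cochain X (n + 1) where
  toFun f σ := ∑ i : Fin (n + 2), (-1 : ℂ) ^ (i : ℕ) * f (pull i.succAbove σ)
  map_add' f g := by
    ext σ
    simp [mul_add, Finset.sum_add_distrib]
  map_smul' c f := by
    ext σ
    simp only [Pi.smul_apply, smul_eq_mul, RingHom.id_apply, Finset.mul_sum]
    exact Finset.sum_congr rfl fun i _ => by ring

/-- The space of `n`-cocycles. -/
abbrev cocycles (n : ℕ) : Submodule ℂ (Cochain X n) := LinearMap.ker (coboundary X n)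

/-- The space of `n`-coboundaries. -/
def coboundaries : (n : ℕ) → Submodule ℂ (Cochain X n)
  | 0 => ⊥
  | n + 1 => LinearMap.range (coboundary X n)

/-- The singular cohomology space `H^n(X, ℂ)`. -/
abbrev Cohomology (n : ℕ) : Type u :=
  cocycles X n ⧸ (coboundaries X n).submoduleOf (cocycles X n)

variable {X}

/-- The cup product of cochains: front face times back face. -/
def cup {p q : ℕ} (f : Cochain X p) (g : Cochain X q) : Cochain X (p + q) := fun σ =>
  f (pull (Fin.castLE (by omega) : Fin (p + 1) → Fin (p + q + 1)) σ) *
    g (pull (Fin.natAdd p : Fin (q + 1) → Fin (p + q + 1)) σ)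

theorem cochain_congr {m n : ℕ} (b : Cochain X m) {θ η : Fin (m + 1) → Fin (n + 1)}
    (h : ∀ j, (θ j : ℕ) = η j) (τ : Simp X n) : b (pull θ τ) = b (pull η τ) := by
  rw [show θ = η from funext fun j => Fin.ext (h j)]

theorem succAbove_val {n : ℕ} (i : Fin (n + 1)) (j : Fin n) :
    (i.succAbove j : ℕ) = if (j : ℕ) < i then (j : ℕ) else j + 1 := by
  simp only [Fin.succAbove, Fin.lt_def, Fin.val_castSucc]
  split_ifs <;> simp

theorem coboundary_cup_one {p : ℕ} (f : Cochain X p) (a : Cochain X 1) :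
    coboundary X (p + 1) (cup f a) =
      cup (coboundary X p f) a + (-1 : ℂ) ^ p • cup f (coboundary X 1 a) := by
  funext σ
  simp only [coboundary, cup, LinearMap.coe_mk, AddHom.coe_mk, Pi.add_apply, Pi.smul_apply,
    smul_eq_mul, pull_pull]
  rw [Fin.sum_univ_castSucc, Fin.sum_univ_castSucc, Fin.sum_univ_three,
    Fin.sum_univ_castSucc (n := p + 1), add_mul, Finset.sum_mul, add_assoc (G := ℂ) _ _ _,
    add_assoc (G := ℂ) _ _ _]
  refine congrArg₂ (· + ·) (Finset.sum_congr rfl fun i _ => ?_) ?_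
  · rw [← mul_assoc]
    refine congrArg₂ (· * ·) (congrArg₂ (· * ·) (by simp) ?_) ?_
    · refine cochain_congr f (fun j => ?_) σ
      simp [succAbove_val]
    · refine cochain_congr a (fun j => ?_) σ
      have := i.2
      simp only [Function.comp, succAbove_val, Fin.val_natAdd, Fin.val_castSucc]
      rw [if_neg (by omega)]
      omega
  · have f1 : f (pull ((Fin.last (p + 1)).castSucc.succAbove ∘
        (Fin.castLE (by omega) : Fin (p + 1) → Fin (p + 1 + 1))) σ) =
        f (pull (Fin.castLE (by omega) : Fin (p + 1) → Fin (p + 2 + 1)) σ) := by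
      refine cochain_congr f (fun j => ?_) σ
      simp [succAbove_val]
      omega
    have f2 : f (pull ((Fin.last (p + 2)).succAbove ∘
        (Fin.castLE (by omega) : Fin (p + 1) → Fin (p + 1 + 1))) σ) =
        f (pull (Fin.castLE (by omega) : Fin (p + 1) → Fin (p + 2 + 1)) σ) := by
      refine cochain_congr f (fun j => ?_) σ
      have := j.2
      simp only [Function.comp, succAbove_val, Fin.val_castLE, Fin.val_last]
      rw [if_pos (by omega)]
    have f3 : f (pull ((Fin.castLE (by omega) : Fin (p + 1 + 1) → Fin (p + 1 + 1 + 1)) ∘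
        (Fin.last (p + 1)).succAbove) σ) =
        f (pull (Fin.castLE (by omega) : Fin (p + 1) → Fin (p + 2 + 1)) σ) := by
      refine cochain_congr f (fun j => ?_) σ
      simp
    have a1 : a (pull ((Fin.last (p + 1)).castSucc.succAbove ∘
        (Fin.natAdd p : Fin 2 → Fin (p + 2))) σ) =
        a (pull ((Fin.natAdd p : Fin 3 → Fin (p + 3)) ∘ Fin.succAbove 1) σ) := by
      refine cochain_congr a (fun j => ?_) σ
      fin_cases j <;> simp [succAbove_val]
    have a2 : a (pull ((Fin.last (p + 2)).succAbove ∘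
        (Fin.natAdd p : Fin 2 → Fin (p + 2))) σ) =
        a (pull ((Fin.natAdd p : Fin 3 → Fin (p + 3)) ∘ Fin.succAbove 2) σ) := by
      refine cochain_congr a (fun j => ?_) σ
      fin_cases j <;> simp [succAbove_val]
    have a0 : a (pull (Fin.natAdd (p + 1) : Fin 2 → Fin (p + 3)) σ) =
        a (pull ((Fin.natAdd p : Fin 3 → Fin (p + 3)) ∘ Fin.succAbove 0) σ) := by
      refine cochain_congr a (fun j => ?_) σ
      simp
      omega
    rw [f1, f2, f3, a1, a2, a0]
    simp only [Fin.val_castSucc, Fin.val_last, Fin.val_zero, Fin.val_one, Fin.val_two, pow_succ]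
    ring

theorem coboundary_cup_zero {p : ℕ} (f : Cochain X p) (g : Cochain X 0) :
    coboundary X p (cup f g) =
      cup (coboundary X p f) g + (-1 : ℂ) ^ p • cup f (coboundary X 0 g) := by
  funext σ
  simp only [coboundary, cup, LinearMap.coe_mk, AddHom.coe_mk, Pi.add_apply, Pi.smul_apply,
    smul_eq_mul, pull_pull]
  rw [Fin.sum_univ_castSucc, Fin.sum_univ_two,
    Fin.sum_univ_castSucc (n := p + 1), add_mul, Finset.sum_mul, add_assoc (G := ℂ) _ _ _]
  refine congrArg₂ (· + ·) (Finset.sum_congr rfl fun i _ => ?_) ?_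
  · rw [← mul_assoc]
    refine congrArg₂ (· * ·) (congrArg₂ (· * ·) (by simp) ?_) ?_
    · refine cochain_congr f (fun j => ?_) σ
      simp [succAbove_val]
    · refine cochain_congr g (fun j => ?_) σ
      have := i.2
      simp only [Function.comp, succAbove_val, Fin.val_natAdd, Fin.val_castSucc]
      rw [if_neg (by omega)]
      omega
  · have f1 : f (pull ((Fin.last (p + 1)).succAbove ∘
        (Fin.castLE (by omega) : Fin (p + 1) → Fin (p + 0 + 1))) σ) =
        f (pull (Fin.castLE (by omega) : Fin (p + 1) → Fin (p + 1 + 1)) σ) := by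
      refine cochain_congr f (fun j => ?_) σ
      simp
    have f3 : f (pull ((Fin.castLE (by omega) : Fin (p + 1 + 1) → Fin (p + 1 + 0 + 1)) ∘
        (Fin.last (p + 1)).succAbove) σ) =
        f (pull (Fin.castLE (by omega) : Fin (p + 1) → Fin (p + 1 + 1)) σ) := by
      refine cochain_congr f (fun j => ?_) σ
      simp
    have a1 : g (pull ((Fin.last (p + 1)).succAbove ∘
        (Fin.natAdd p : Fin 1 → Fin (p + 1))) σ) =
        g (pull ((Fin.natAdd p : Fin 2 → Fin (p + 2)) ∘ Fin.succAbove 1) σ) := by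
      refine cochain_congr g (fun j => ?_) σ
      fin_cases j; simp
    have a0 : g (pull (Fin.natAdd (p + 1) : Fin 1 → Fin (p + 2)) σ) =
        g (pull ((Fin.natAdd p : Fin 2 → Fin (p + 2)) ∘ Fin.succAbove 0) σ) := by
      refine cochain_congr g (fun j => ?_) σ
      simp
    rw [f1, f3, a1, a0]
    simp only [Fin.val_last, Fin.val_zero, Fin.val_one, pow_succ]
    ring

/-- Right multiplication of cohomology classes by the class of a `1`-cocycle. -/
def cupCocycle (p : ℕ) (a : cocycles X 1) : Cohomology X p →ₗ[ℂ] Cohomology X (p + 1) :=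
  Submodule.mapQ _ _
    { toFun := fun f => ⟨cup f.1 a.1, by
        rw [LinearMap.mem_ker, coboundary_cup_one, LinearMap.mem_ker.mp f.2,
          LinearMap.mem_ker.mp a.2]
        funext σ
        simp [cup]⟩
      map_add' := fun f g => by
        ext σ
        simp [cup, add_mul]
      map_smul' := fun c f => by
        ext σ
        simp [cup, mul_assoc] }
    (by
      rintro ⟨f, hf⟩ hfb
      change f ∈ coboundaries X p at hfb
      change cup f a.1 ∈ coboundaries X (p + 1)
      cases p with
      | zero =>
        have h0 : f = 0 := hfb
        have h1 : cup f a.1 = 0 := by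
          funext σ
          simp [cup, h0]
        rw [h1]
        exact zero_mem _
      | succ p =>
        obtain ⟨g, hg⟩ := hfb
        have hg' : coboundary X p g = f := hg
        refine ⟨cup g a.1, ?_⟩
        rw [coboundary_cup_one, LinearMap.mem_ker.mp a.2, hg']
        funext σ
        simp [cup])

/-- The cup product `H^p(X, ℂ) × H^1(X, ℂ) → H^{p+1}(X, ℂ)`, as the linear map sending `a` to right
multiplication by `a`. -/
def cupRight (p : ℕ) : Cohomology X 1 →ₗ[ℂ] Cohomology X p →ₗ[ℂ] Cohomology X (p + 1) :=
  Submodule.liftQ _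
    { toFun := cupCocycle p
      map_add' := fun a b => by
        refine Submodule.linearMap_qext _ (LinearMap.ext fun f => ?_)
        refine congrArg (Submodule.Quotient.mk (p := (coboundaries X (p + 1)).submoduleOf
          (cocycles X (p + 1)))) (Subtype.ext (funext fun σ => ?_))
        simp [cup, mul_add]
      map_smul' := fun c a => by
        refine Submodule.linearMap_qext _ (LinearMap.ext fun f => ?_)
        refine congrArg (Submodule.Quotient.mk (p := (coboundaries X (p + 1)).submoduleOf
          (cocycles X (p + 1)))) (Subtype.ext (funext fun σ => ?_))
        simp [cup]
        ring }
    (by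
      rintro ⟨a, ha⟩ hab
      change a ∈ coboundaries X 1 at hab
      obtain ⟨g, hg⟩ := hab
      have hg' : coboundary X 0 g = a := hg
      rw [LinearMap.mem_ker]
      refine Submodule.linearMap_qext _ (LinearMap.ext fun f => ?_)
      refine (Submodule.Quotient.mk_eq_zero _).mpr ?_
      change cup f.1 a ∈ coboundaries X (p + 1)
      refine ⟨(-1 : ℂ) ^ p • cup f.1 g, ?_⟩
      have hz : cup (coboundary X p f.1) g = 0 := by
        rw [LinearMap.mem_ker.mp f.2]
        funext σ
        simp [cup]
      rw [map_smul]
      refine (congrArg ((-1 : ℂ) ^ p • ·) (coboundary_cup_zero f.1 g)).trans ?_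
      rw [hz, hg', zero_add, smul_smul, ← mul_pow]
      simp)

/-- The image of right multiplication by `a` in `H^i(X, ℂ)`. -/
def aomotoBoundaries (a : Cohomology X 1) : (i : ℕ) → Submodule ℂ (Cohomology X i)
  | 0 => ⊥
  | i + 1 => LinearMap.range (cupRight i a)

/-- The cohomology `H^i(A, ·a)` of the Aomoto complex of `A = H^*(X, ℂ)`. -/
abbrev AomotoCohomology (a : Cohomology X 1) (i : ℕ) : Type u :=
  LinearMap.ker (cupRight i a) ⧸ (aomotoBoundaries a i).submoduleOf (LinearMap.ker (cupRight i a))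

/-- The resonance variety `R^i_d(X, ℂ)` in `H^1(X, ℂ)`. -/
def resonanceVariety (X : Type u) [TopologicalSpace X] (i d : ℕ) : Set (Cohomology X 1) :=
  {a | (d : Cardinal) ≤ Module.rank ℂ (AomotoCohomology a i)}

end Cohomology

section HomToCohomology

variable {X : Type u} [TopologicalSpace X] [PathConnectedSpace X]

/-- The `1`-cochain of an additive character `z` of the fundamental group: its value on a
`1`-simplex is the value of `z` on the loop obtained by joining the ends to the base point. -/
def charCochain {x₀ : X} (z : Additive (FundamentalGroup X x₀) →+ ℂ) : Cochain X 1 := fun σ =>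
  Multiplicative.toAdd (edgeWeight (AddMonoidHom.toMultiplicativeRight z) σ 0 1)

theorem charCochain_mem {x₀ : X} (z : Additive (FundamentalGroup X x₀) →+ ℂ) :
    charCochain z ∈ cocycles X 1 := by
  rw [LinearMap.mem_ker]
  funext σ
  simp only [coboundary, charCochain, LinearMap.coe_mk, AddHom.coe_mk,
    edgeWeight_pull, Pi.zero_apply]
  refine (Fin.sum_univ_three _).trans ?_
  have h := congrArg Multiplicative.toAdd
    (edgeWeight_mul (AddMonoidHom.toMultiplicativeRight z) σ 0 1 2)
  rw [toAdd_mul] at h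
  have e0 : Fin.succAbove (0 : Fin 3) (0 : Fin 2) = 1 := rfl
  have e1 : Fin.succAbove (0 : Fin 3) (1 : Fin 2) = 2 := rfl
  have e2 : Fin.succAbove (1 : Fin 3) (0 : Fin 2) = 0 := rfl
  have e3 : Fin.succAbove (1 : Fin 3) (1 : Fin 2) = 2 := rfl
  have e4 : Fin.succAbove (2 : Fin 3) (0 : Fin 2) = 0 := rfl
  have e5 : Fin.succAbove (2 : Fin 3) (1 : Fin 2) = 1 := rfl
  rw [e0, e1, e2, e3, e4, e5]
  simp only [Fin.val_zero, Fin.val_one, Fin.val_two]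
  linear_combination h

/-- The canonical identification `Hom(π₁(X), ℂ) ≅ H^1(X, ℂ)`, on elements. -/
def homToH1 {x₀ : X} (z : Additive (FundamentalGroup X x₀) →+ ℂ) : Cohomology X 1 :=
  Submodule.Quotient.mk ⟨charCochain z, charCochain_mem z⟩

end HomToCohomology

/-! ### Characters, tangent cones and subtori -/

section Characters

variable {G : Type*} [Group G]

/-- The exponential map `Hom(G, ℂ) → Hom(G, ℂˣ)`. -/
def expChar (z : Additive G →+ ℂ) : G →* ℂˣ where
  toFun g := Units.mk0 (Complex.exp (z (Additive.ofMul g))) (Complex.exp_ne_zero _)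
  map_one' := by
    ext
    simp
  map_mul' g h := by
    ext
    simp [Complex.exp_add]

/-- The exponential tangent cone `τ₁(W)`. -/
def expTangentCone (W : Set (G →* ℂˣ)) : Set (Additive G →+ ℂ) :=
  {z | ∀ t : ℂ, expChar (t • z) ∈ W}

/-- The tangent cone `TC₁(W)` of a subset `W` of `Hom(G, ℂˣ)` at the trivial character, in the
sense of Whitney: the common zero set in `Hom(G, ℂ)` of the initial forms of all the germs at `1`
of analytic functions vanishing on `W` near `1`. The germs are written in linear coordinates
`e : ℂⁿ ≃ Hom(G, ℂ)`, the exponential map (a local biholomorphism at `0` with identity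
differential) being used as a chart of `Hom(G, ℂˣ)` at `1`. If the homogeneous terms of degree
`< m` of a germ `f` vanish, then its term of degree `m` is either zero or the initial form. -/
def tangentCone (W : Set (G →* ℂˣ)) : Set (Additive G →+ ℂ) :=
  {z | ∃ (n : ℕ) (e : (Fin n → ℂ) ≃ₗ[ℂ] (Additive G →+ ℂ)),
    ∀ (f : (Fin n → ℂ) → ℂ) (P : FormalMultilinearSeries ℂ (Fin n → ℂ) ℂ),
      HasFPowerSeriesAt f P 0 →
      (∀ᶠ x in nhds (0 : Fin n → ℂ), expChar (e x) ∈ W → f x = 0) →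
      ∀ m : ℕ, (∀ j < m, ∀ x : Fin n → ℂ, P j (fun _ => x) = 0) →
        P m (fun _ => e.symm z) = 0}

/-- The connected component of the trivial character in `Hom(G, ℂˣ)`: the characters which factor
through the maximal torsion-free abelian quotient of `G`. -/
def identityComponent (G : Type*) [Group G] : Set (G →* ℂˣ) :=
  {ρ | ∀ g : G, IsOfFinOrder (Abelianization.of g) → ρ g = 1}

/-- Subtori of `Hom(G, ℂˣ)` passing through `1`, i.e. connected algebraic subgroups: the subsets
`μ^*(Hom(ℤ^m, ℂˣ))`, for `μ` an epimorphism from `G` to some `ℤ^m`. -/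
def IsSubtorus (T : Set (G →* ℂˣ)) : Prop :=
  ∃ (m : ℕ) (μ : G →* Multiplicative (Fin m → ℤ)), Function.Surjective μ ∧
    T = Set.range fun χ : Multiplicative (Fin m → ℤ) →* ℂˣ => χ.comp μ

/-- The pullback `ν^*(h) ∈ Hom(G, ℂ)` of `h ∈ Hom(B, ℂ)` along a homomorphism `ν : G → B`, for an
additive group `B`. -/
def pullbackHom {B : Type*} [AddCommGroup B] (ν : G →* Multiplicative B) (h : B →+ ℂ) :
    Additive G →+ ℂ :=
  h.comp (MonoidHom.toAdditiveLeft ν)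

end Characters

/-! ### Covers and finiteness of homology -/

section Covers

variable {X E : Type u} [TopologicalSpace X] [TopologicalSpace E]

/-- The map `p : E → X` is the Galois cover of `X` corresponding to `ν : π₁(X, x₀) → Q`: a
covering map with path connected total space such that `p_*(π₁(E, e₀)) = ker ν` for a point `e₀`
over `x₀`. -/
structure IsCoverOf {Q : Type*} [Group Q] {x₀ : X} (ν : FundamentalGroup X x₀ →* Q)
    (p : C(E, X)) : Prop where
  pathConnected : PathConnectedSpace E
  isCoveringMap : IsCoveringMap p
  range_eq_ker : ∃ (e₀ : E) (h : p e₀ = x₀), (FundamentalGroup.mapOfEq p h).range = ν.ker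

/-- Singular homology `H_i(E, ℂ)`. -/
def singularHomology (E : Type u) [TopologicalSpace E] (i : ℕ) : ModuleCat.{u} ℂ :=
  ((AlgebraicTopology.singularHomologyFunctor (ModuleCat.{u} ℂ) i).obj
    (ModuleCat.of ℂ (ULift.{u} ℂ))).obj (TopCat.of E)

end Covers

/-- Condition `(*)_k`: for all `i ≤ k`, the part of `V^i_1(X, ℂ)` in the connected component of `1`
is a union of subtori through `1`, and the tangent cone formula `TC₁(V^i_1(X, ℂ)) = R^i_1(X, ℂ)`
holds. -/
structure ConditionStar {X : Type u} [TopologicalSpace X] [PathConnectedSpace X] (x₀ : X) (k : ℕ) :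
    Prop where
  subtori : ∀ i ≤ k, ∃ S : Set (Set (FundamentalGroup X x₀ →* ℂˣ)),
    (∀ T ∈ S, IsSubtorus T) ∧
      charVariety x₀ i 1 ∩ identityComponent (FundamentalGroup X x₀) = ⋃₀ S
  tangentConeFormula : ∀ i ≤ k,
    homToH1 '' tangentCone (charVariety x₀ i 1) = resonanceVariety X i 1

end AbelCovers

end

/-! Write `Λ = ℂ[Q]` for the group algebra of the target `Q` of `ν`. Singular chains of the cover
are singular chains of `X` with coefficients in `Λ` (`coverChainEquiv_dd`), and specializing `Λ` at
a character `χ` of `Q` gives the chains that compute `H_*(X, ℂ_{χ∘ν})` (`spec_groupSys_dd`). Since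
`X` has finitely many cells in the relevant dimensions and `Λ` is Noetherian, the `Λ`-homology is
finitely generated in degrees at most `k` (`fgMod_homology`). This is proved directly on singular
chains, for any rank one local system: operators on chains are given by natural families of tuples
of points in prisms, so that subdivision and homotopy invariance are instances of one construction,
and cells are attached one at a time.

Two facts on complexes of free modules, possibly of infinite rank, connect this homology with the
characteristic varieties `V^i`. If `f` kills the homology in degrees up to `k`, a power of `f` is
null homotopic up to a term vanishing on cycles; this survives specialization, which is therefore
exact wherever `f` does not vanish (`exact_of_kills`). Conversely, if a specialization is exact in
degrees up to `k`, Nakayama's lemma produces an annihilator that does not vanish there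
(`exists_kills`). Hence the zero set of the annihilator ideal is the set of `χ` with `χ∘ν` in the
union of the `V^i`, `i ≤ k` (`exists_charVariety_iff`).

If the homology of the cover is finite dimensional, Cayley-Hamilton gives annihilators that are
polynomials in a single group element, so each complex line of exponentials leaves all the `V^i` at
once (`exists_expChar_notMem`). If the annihilator ideal has only countably many zeros, its quotient
algebra is finite dimensional, and so is the homology (`finite_quotient_of_countable`,
`fgMod_restrictScalars`).

For `Q = ℤ` the algebra is a domain and evaluation kernels are principal, so each degree can be
treated with its own character (`exists_kills_of_principal`). The product of the annihilators is a
nonzero Laurent polynomial, which has finitely many zeros.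

For `Q = ℤ^r`, condition `(*)_k` replaces resonance varieties by tangent cones. The inclusion of
`τ₁` in `TC₁` always holds. Conversely, the union of the `V^i` is cut out by finitely many elements
of the group algebra of the abelianization. A subtorus in it enters only through the coincidences it
forces among the finitely many exponents, so near `1` the logarithms lie in finitely many linear
subspaces whose exponentials remain in the union; thus `TC₁(V^i)` lies in `τ₁` of the union
(`tangentCone_subset_expTangentCone`). Together with the first criterion this gives one implication.
For the other, a character of infinite order in the zero set lies, after pullback, in a subtorus of
some `V^i` and yields a nonzero resonant class in the image of `ν^*`. If there is none, all zeros
are torsion characters, and these are countable. -/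

noncomputable section

namespace AbelCovers

/-! ### The augmented complex of tuples -/

section Tuples

variable {V V' : Type*} {R : Type*} [CommRing R]

/-- Formal linear combinations of finite tuples of elements of `V`. -/
abbrev Tup (V : Type*) (R : Type*) [CommRing R] := (Σ m : ℕ, Fin m → V) →₀ R

/-- The alternating sum of the faces of a tuple. -/
def tdS (R : Type*) [CommRing R] : (Σ m : ℕ, Fin m → V) → Tup V R
  | ⟨0, _⟩ => 0
  | ⟨m + 1, w⟩ => ∑ i : Fin (m + 1), Finsupp.single ⟨m, w ∘ i.succAbove⟩ ((-1) ^ (i : ℕ))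

/-- The differential of the augmented complex of tuples. -/
def td : Tup V R →ₗ[R] Tup V R := Finsupp.linearCombination R (tdS R)

/-- Prepending a point to a tuple. -/
def tcone (p : V) : Tup V R →ₗ[R] Tup V R :=
  Finsupp.lmapDomain R R fun s => ⟨s.1 + 1, Fin.cons p s.2⟩

/-- The map of tuples induced by a map of points. -/
def tmap (f : V → V') : Tup V R →ₗ[R] Tup V' R :=
  Finsupp.lmapDomain R R fun s => ⟨s.1, f ∘ s.2⟩

theorem td_single (s : Σ m : ℕ, Fin m → V) (r : R) : td (Finsupp.single s r) = r • tdS R s := by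
  simp [td]

theorem tcone_single (p : V) (s : Σ m : ℕ, Fin m → V) (r : R) :
    tcone p (Finsupp.single s r) = Finsupp.single ⟨s.1 + 1, Fin.cons p s.2⟩ r := by
  simp [tcone]

theorem tmap_single (f : V → V') (s : Σ m : ℕ, Fin m → V) (r : R) :
    tmap f (Finsupp.single s r) = Finsupp.single ⟨s.1, f ∘ s.2⟩ r := by
  simp [tmap]

theorem tmap_tmap {V'' : Type*} (g : V' → V'') (f : V → V') (x : Tup V R) :
    tmap g (tmap f x) = tmap (g ∘ f) x := by
  induction x using Finsupp.induction_linear with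
  | zero => simp
  | add x y hx hy => simp only [map_add, hx, hy]
  | single s r => simp [tmap_single, Function.comp_assoc]

theorem td_tmap (f : V → V') (x : Tup V R) : td (tmap f x) = tmap f (td x) := by
  induction x using Finsupp.induction_linear with
  | zero => simp
  | add x y hx hy => simp only [map_add, hx, hy]
  | single s r =>
    obtain ⟨m, w⟩ := s
    cases m with
    | zero => simp [tmap_single, td_single, tdS]
    | succ m => simp [tmap_single, td_single, tdS, Function.comp_assoc]

theorem cons_comp_succ_succAbove {m : ℕ} (p : V) (w : Fin (m + 1) → V) (i : Fin (m + 1)) :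
    (Fin.cons p w : Fin (m + 2) → V) ∘ i.succ.succAbove = Fin.cons p (w ∘ i.succAbove) := by
  funext j
  refine Fin.cases ?_ (fun j => ?_) j
  · simp
  · simp

theorem cons_comp_zero_succAbove {m : ℕ} (p : V) (w : Fin m → V) :
    (Fin.cons p w : Fin (m + 1) → V) ∘ (0 : Fin (m + 1)).succAbove = w := by
  funext j
  simp

/-- Deleting the apex returns the tuple, and deleting another entry gives the cone over a face. The
formula has no exceptional low degree because the empty tuple is kept as augmentation. -/
theorem td_tcone (p : V) (x : Tup V R) : td (tcone p x) = x - tcone p (td x) := by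
  induction x using Finsupp.induction_linear with
  | zero => simp
  | add x y hx hy => simp only [map_add, hx, hy]; abel
  | single s r =>
    obtain ⟨m, w⟩ := s
    rw [tcone_single, td_single, td_single]
    cases m with
    | zero =>
      simp only [tdS, Nat.reduceAdd]
      rw [Fin.sum_univ_succ, cons_comp_zero_succAbove]
      simp
    | succ m =>
      simp only [tdS]
      rw [Fin.sum_univ_succ, cons_comp_zero_succAbove]
      simp only [cons_comp_succ_succAbove, map_smul, map_sum, tcone_single, Fin.val_succ, pow_succ,
        mul_neg, mul_one, Finsupp.single_neg, Finset.sum_neg_distrib, Fin.val_zero, pow_zero,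
        smul_add, smul_neg, Finsupp.smul_single, smul_eq_mul, sub_eq_add_neg]

/-- Every nonempty tuple is the cone from its first entry over its tail, so the cone formula gives
an induction on the length. -/
theorem td_td (x : Tup V R) : td (td x) = 0 := by
  have key : ∀ (m : ℕ) (w : Fin m → V), td (td (Finsupp.single ⟨m, w⟩ (1 : R))) = 0 := by
    intro m
    induction m with
    | zero => intro w; simp [td_single, tdS]
    | succ m ih =>
      intro w
      have : (Finsupp.single ⟨m + 1, w⟩ (1 : R) : Tup V R)
          = tcone (w 0) (Finsupp.single ⟨m, Fin.tail w⟩ 1) := by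
        rw [tcone_single, Fin.cons_self_tail]
      rw [this, td_tcone, map_sub, td_tcone, ih]
      simp
  induction x using Finsupp.induction_linear with
  | zero => simp
  | add x y hx hy => simp only [map_add, hx, hy, add_zero]
  | single s r =>
    have : (Finsupp.single s r : Tup V R) = r • Finsupp.single s 1 := by simp
    rw [this, map_smul, map_smul, key s.1 s.2, smul_zero]

end Tuples

/-! ### Families of tuples in prisms -/

section Families

variable {R : Type*} [CommRing R]

/-- The prism over the standard simplex with `N` vertices. -/
def prism (N : ℕ) : Set ((Fin N → ℝ) × ℝ) := stdSimplex ℝ (Fin N) ×ˢ Set.Icc (0 : ℝ) 1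

theorem convex_prism (N : ℕ) : Convex ℝ (prism N) :=
  (convex_stdSimplex ℝ (Fin N)).prod (convex_Icc 0 1)

/-- A point of a prism, from its components. -/
def prismMk {N : ℕ} (x : stdSimplex ℝ (Fin N)) (t : unitInterval) : prism N :=
  ⟨(x.1, t.1), x.2, t.2⟩

/-- The component of a point of a prism in the simplex. -/
def prismFst {N : ℕ} (p : prism N) : stdSimplex ℝ (Fin N) := ⟨p.1.1, p.2.1⟩

/-- The height of a point of a prism. -/
def prismSnd {N : ℕ} (p : prism N) : unitInterval := ⟨p.1.2, p.2.2⟩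

/-- The map of prisms induced by a map of vertices. -/
def prismMap {M N : ℕ} (θ : Fin M → Fin N) (p : prism M) : prism N :=
  prismMk (stdSimplex.map θ (prismFst p)) (prismSnd p)

theorem prismMap_comp {L M N : ℕ} (θ : Fin M → Fin N) (η : Fin L → Fin M) :
    prismMap θ ∘ prismMap η = prismMap (θ ∘ η) := by
  funext p
  exact congrArg (fun x => prismMk x (prismSnd p)) (stdSimplex.map_comp_apply η θ (prismFst p))

theorem prismMap_vertex {M N : ℕ} (θ : Fin M → Fin N) (i : Fin M) (t : unitInterval) :
    prismMap θ (prismMk (stdSimplex.vertex i) t) = prismMk (stdSimplex.vertex (θ i)) t :=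
  congrArg (fun x => prismMk x t) (stdSimplex.map_vertex θ i)

/-- Families of tuples in the prisms. -/
abbrev Fam (R : Type*) [CommRing R] := ∀ N : ℕ, Tup (prism N) R

/-- The alternating sum of the faces of a family. -/
def fb (c : Fam R) : Fam R
  | 0 => 0
  | N + 1 => ∑ i : Fin (N + 1), (-1 : R) ^ (i : ℕ) • tmap (prismMap i.succAbove) (c N)

/-- Evaluation of a family on tuples of vertices. -/
def evFam (c : Fam R) (N : ℕ) : Tup (Fin N) R →ₗ[R] Tup (prism N) R :=
  Finsupp.linearCombination R fun s => tmap (prismMap s.2) (c s.1)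

theorem fb_eq_evFam (c : Fam R) (N : ℕ) :
    fb c N = evFam c N (td (Finsupp.single ⟨N, id⟩ 1)) := by
  cases N with
  | zero => simp [fb, td_single, tdS]
  | succ N => simp [fb, td_single, tdS, evFam]

/-- With `fb_eq_evFam`, this exhibits `fb` as precomposition with `td` on tuples of vertices, so
that `fb ∘ fb = 0` is inherited from `td ∘ td = 0`. -/
theorem evFam_fb (c : Fam R) (N : ℕ) (x : Tup (Fin N) R) :
    evFam (fb c) N x = evFam c N (td x) := by
  induction x using Finsupp.induction_linear with
  | zero => simp
  | add x y hx hy => simp only [map_add, hx, hy]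
  | single s r =>
    obtain ⟨m, w⟩ := s
    cases m with
    | zero => simp [evFam, fb, td_single, tdS]
    | succ m =>
      simp [evFam, fb, td_single, tdS, tmap_tmap, prismMap_comp]

theorem fb_fb (c : Fam R) : fb (fb c) = 0 := by
  funext N
  rw [fb_eq_evFam, evFam_fb, td_td, map_zero, Pi.zero_apply]

theorem td_fb (c : Fam R) (N : ℕ) : td (fb c N) = fb (fun N => td (c N)) N := by
  cases N with
  | zero => simp [fb]
  | succ N => simp [fb, td_tmap]

theorem fb_sub (c c' : Fam R) : fb (c - c') = fb c - fb c' := by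
  funext N
  cases N with
  | zero => simp [fb]
  | succ N => simp [fb, smul_sub]

/-- The barycenter of the base of a prism. -/
def prismBary (N : ℕ) : prism (N + 1) := prismMk stdSimplex.barycenter 0

/-- The family of the vertices at a given height. -/
def vertFam (t : unitInterval) : Fam R := fun N =>
  Finsupp.single ⟨N, fun i => prismMk (stdSimplex.vertex i) t⟩ 1

theorem td_vertFam (t : unitInterval) (N : ℕ) : td (vertFam t N : Tup _ R) = fb (vertFam t) N := by
  cases N with
  | zero => simp [fb, vertFam, td_single, tdS]
  | succ N =>
    simp only [fb, vertFam, td_single, tdS, tmap_single, one_smul]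
    refine Finset.sum_congr rfl fun i _ => ?_
    rw [Finsupp.smul_single, smul_eq_mul, mul_one]
    congr 2
    funext j
    exact (prismMap_vertex _ _ _).symm

/-- Barycentric subdivision, as a family. -/
def subFam : Fam R
  | 0 => Finsupp.single ⟨0, Fin.elim0⟩ 1
  | N + 1 => tcone (prismBary N)
      (∑ i : Fin (N + 1), (-1 : R) ^ (i : ℕ) • tmap (prismMap i.succAbove) (subFam N))

theorem subFam_succ (N : ℕ) : (subFam (N + 1) : Tup _ R) = tcone (prismBary N) (fb subFam (N + 1)) :=
  rfl

/-- The relation `td c = fb c` is what makes a family act on singular chains as a chain map. For the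
subdivision, the correction term in the cone formula is `fb (fb subFam)`, which vanishes. -/
theorem td_subFam (N : ℕ) : td (subFam N : Tup _ R) = fb subFam N := by
  induction N with
  | zero => simp [subFam, fb, td_single, tdS]
  | succ N ih =>
    rw [subFam_succ, td_tcone, td_fb]
    have : fb (fun N => td (subFam N : Tup _ R)) (N + 1) = fb (fb subFam) (N + 1) := by
      simp only [fb, ih]
    rw [this, fb_fb]
    simp

/-- The homotopy between two families of cycles given by coning. -/
def htpyFam (α β : Fam R) : Fam R
  | 0 => 0
  | N + 1 => tcone (prismBary N) (α (N + 1) - β (N + 1) -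
      ∑ i : Fin (N + 1), (-1 : R) ^ (i : ℕ) • tmap (prismMap i.succAbove) (htpyFam α β N))

theorem htpyFam_succ (α β : Fam R) (N : ℕ) : htpyFam α β (N + 1) = tcone (prismBary N)
    (α (N + 1) - β (N + 1) - fb (htpyFam α β) (N + 1)) :=
  rfl

/-- Acyclic models made explicit: by induction `α - β - fb (htpyFam α β)` is a cycle in the prism,
hence the boundary of its cone. The hypothesis `h0` starts the induction at the empty simplex. -/
theorem td_htpyFam {α β : Fam R} (hα : ∀ N, td (α N) = fb α N) (hβ : ∀ N, td (β N) = fb β N)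
    (h0 : α 0 = β 0) (N : ℕ) : td (htpyFam α β N) + fb (htpyFam α β) N = α N - β N := by
  induction N with
  | zero => simp [htpyFam, fb, h0]
  | succ N ih =>
    have h2 : td (α (N + 1) - β (N + 1) - fb (htpyFam α β) (N + 1)) =
        fb α (N + 1) - fb β (N + 1) - fb (fun N => td (htpyFam α β N)) (N + 1) := by
      rw [map_sub, map_sub, td_fb, hα, hβ]
    rw [htpyFam_succ, td_tcone, h2]
    have h1 : fb (fun N => td (htpyFam α β N)) (N + 1) =
        fb (α - β - fb (htpyFam α β)) (N + 1) := by
      have : td (htpyFam α β N) = (α - β - fb (htpyFam α β)) N :=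
        eq_sub_of_add_eq ih
      simp only [fb, this]
    rw [h1, fb_sub, fb_sub, fb_fb]
    simp

end Families

/-! ### Rank one local systems and singular chains -/

section LocalSystems

variable {X Y : Type*} [TopologicalSpace X] [TopologicalSpace Y] {R : Type*} [CommRing R]

/-- A local system of free modules of rank one, trivialised at every point: parallel transport
along path classes. -/
structure LocSys (X : Type*) [TopologicalSpace X] (R : Type*) [CommRing R] where
  /-- Parallel transport. -/
  tr {x y : X} : Path.Homotopic.Quotient x y → Rˣ
  tr_trans {x y z : X} (γ : Path.Homotopic.Quotient x y) (δ : Path.Homotopic.Quotient y z) :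
    tr (γ.trans δ) = tr γ * tr δ

/-- The pullback of a local system. -/
def LocSys.comap (w : LocSys Y R) (f : C(X, Y)) : LocSys X R where
  tr γ := w.tr (γ.map f)
  tr_trans γ δ := by
    induction γ using Quotient.inductionOn
    induction δ using Quotient.inductionOn
    rename_i p q
    rw [← w.tr_trans]
    exact congrArg (fun γ => w.tr (Path.Homotopic.Quotient.mk γ)) (Path.map_trans p q f.continuous)

variable (w : LocSys X R)

/-- Parallel transport along the image of a path in a path connected space. -/
def LocSys.wt {D : Type*} [TopologicalSpace D] [PathConnectedSpace D] (F : C(D, X)) (a b : D) :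
    Rˣ :=
  w.tr ((Path.Homotopic.Quotient.mk (PathConnectedSpace.somePath a b)).map F)

section

variable {D D' : Type*} [TopologicalSpace D] [SimplyConnectedSpace D] [TopologicalSpace D']
  [SimplyConnectedSpace D']

/-- The domain is simply connected, so the path chosen in `wt` may be replaced by any other one with
the same ends. -/
theorem LocSys.wt_eq (F : C(D, X)) {a b : D} (p : Path.Homotopic.Quotient a b) :
    w.wt F a b = w.tr (p.map F) := by
  unfold LocSys.wt
  rw [Subsingleton.elim p (Path.Homotopic.Quotient.mk (PathConnectedSpace.somePath a b))]

theorem LocSys.wt_mul (F : C(D, X)) (a b c : D) : w.wt F a b * w.wt F b c = w.wt F a c := by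
  rw [LocSys.wt, LocSys.wt, ← w.tr_trans,
    w.wt_eq F ((Path.Homotopic.Quotient.mk (PathConnectedSpace.somePath a b)).trans
      (Path.Homotopic.Quotient.mk (PathConnectedSpace.somePath b c)))]
  congr 1
  exact (congrArg Path.Homotopic.Quotient.mk
    (Path.map_trans (PathConnectedSpace.somePath a b) (PathConnectedSpace.somePath b c)
      F.continuous)).symm

theorem LocSys.wt_self (F : C(D, X)) (a : D) : w.wt F a a = 1 :=
  mul_eq_left.mp (w.wt_mul F a a a)

theorem LocSys.wt_comp (F : C(D, X)) (g : C(D', D)) (a b : D') :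
    w.wt (F.comp g) a b = w.wt F (g a) (g b) := by
  exact (w.wt_eq F ((Path.Homotopic.Quotient.mk (PathConnectedSpace.somePath a b)).map g)).symm

end

/-- Parallel transport along an edge of a singular simplex. -/
def LocSys.edge {n : ℕ} (σ : Simp X n) (i j : Fin (n + 1)) : Rˣ :=
  w.wt σ (stdSimplex.vertex i) (stdSimplex.vertex j)

/-- The singular chains of `X`, of all degrees together. -/
abbrev Ch (X : Type*) [TopologicalSpace X] (R : Type*) [CommRing R] := (Σ n : ℕ, Simp X n) →₀ R

/-- The boundary of a singular simplex. -/
def LocSys.bdS : (Σ n : ℕ, Simp X n) → Ch X R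
  | ⟨0, _⟩ => 0
  | ⟨n + 1, σ⟩ => ∑ i : Fin (n + 2), Finsupp.single ⟨n, pull i.succAbove σ⟩
      ((-1) ^ (i : ℕ) * (w.edge σ 0 (i.succAbove 0) : R))

/-- The boundary operator with coefficients in a local system. -/
def LocSys.bd : Ch X R →ₗ[R] Ch X R := Finsupp.linearCombination R w.bdS

theorem LocSys.bd_single (s : Σ n : ℕ, Simp X n) (r : R) :
    w.bd (Finsupp.single s r) = r • w.bdS s := by
  simp [LocSys.bd]

end LocalSystems

/-! ### Affine simplices -/

section Affine

variable {E : Type*} [AddCommGroup E] [Module ℝ E] [TopologicalSpace E] [ContinuousAdd E]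
  [ContinuousSMul ℝ E] {s : Set E}

/-- The affine simplex in a convex set with given vertices. -/
def aff (hs : Convex ℝ s) {m : ℕ} (v : Fin (m + 1) → s) : Simp s m where
  toFun x := ⟨∑ i, x i • (v i : E), hs.sum_mem (fun i _ => x.2.1 i) x.2.2 fun i _ => (v i).2⟩
  continuous_toFun := by
    refine Continuous.subtype_mk (continuous_finsetSum _ fun i _ => ?_) _
    exact ((continuous_apply i).comp continuous_subtype_val).smul continuous_const

theorem aff_apply (hs : Convex ℝ s) {m : ℕ} (v : Fin (m + 1) → s)
    (x : stdSimplex ℝ (Fin (m + 1))) : (aff hs v x : E) = ∑ i, x i • (v i : E) :=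
  rfl

theorem stdSimplex_map_apply {m n : ℕ} (θ : Fin m → Fin n) (x : stdSimplex ℝ (Fin m)) (j : Fin n) :
    stdSimplex.map θ x j = ∑ i with θ i = j, x i := by
  change FunOnFinite.linearMap ℝ ℝ θ x j = _
  rw [FunOnFinite.linearMap_apply_apply]

theorem sum_map_smul {E : Type*} [AddCommGroup E] [Module ℝ E] {m n : ℕ} (θ : Fin m → Fin n) (x : stdSimplex ℝ (Fin m)) (v : Fin n → E) :
    ∑ j, stdSimplex.map θ x j • v j = ∑ i, x i • v (θ i) := by
  simp only [stdSimplex_map_apply, Finset.sum_smul]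
  rw [← Finset.sum_fiberwise (s := Finset.univ) (g := θ)]
  refine Finset.sum_congr rfl fun j _ => Finset.sum_congr rfl fun i hi => ?_
  rw [(Finset.mem_filter.mp hi).2]

theorem pull_aff (hs : Convex ℝ s) {m n : ℕ} (θ : Fin (m + 1) → Fin (n + 1)) (v : Fin (n + 1) → s) :
    pull θ (aff hs v) = aff hs (v ∘ θ) := by
  ext x
  exact sum_map_smul θ x fun j => (v j : E)

theorem aff_vertex (hs : Convex ℝ s) {m : ℕ} (v : Fin (m + 1) → s) (i : Fin (m + 1)) :
    aff hs v (stdSimplex.vertex i) = v i := by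
  refine Subtype.ext ?_
  rw [aff_apply]
  rw [Finset.sum_eq_single i]
  · simp [DFunLike.coe]
  · intro j _ hj
    have : (stdSimplex.vertex i : stdSimplex ℝ (Fin (m + 1))) j = 0 := by
      simp [DFunLike.coe, hj]
    rw [this, zero_smul]
  · simp

theorem comp_aff {E' : Type*} [AddCommGroup E'] [Module ℝ E'] [TopologicalSpace E']
    [ContinuousAdd E'] [ContinuousSMul ℝ E'] {s' : Set E'} (hs : Convex ℝ s) (hs' : Convex ℝ s')
    {m : ℕ} (v : Fin (m + 1) → s) (g : C(s, s')) (L : E →ₗ[ℝ] E') (hg : ∀ x : s, (g x : E') = L x) :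
    g.comp (aff hs v) = aff hs' (g ∘ v) := by
  ext x
  simp only [ContinuousMap.comp_apply, hg, aff_apply, Function.comp, map_sum, map_smul]

end Affine

/-! ### Tuples of points in a convex set as twisted singular chains. -/

section Push

variable {X Y : Type*} [TopologicalSpace X] [TopologicalSpace Y] {R : Type*} [CommRing R]
  {E : Type*} [AddCommGroup E] [Module ℝ E] [TopologicalSpace E] [ContinuousAdd E]
  [ContinuousSMul ℝ E] {s : Set E} (w : LocSys X R)

/-- The image of a tuple of points of a convex set under a continuous map, as a singular chain. -/
def LocSys.pushS (hs : Convex ℝ s) [PathConnectedSpace s] (F : C(s, X)) (b : s) :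
    (Σ m : ℕ, Fin m → s) → Ch X R
  | ⟨0, _⟩ => 0
  | ⟨m + 1, v⟩ => Finsupp.single ⟨m, F.comp (aff hs v)⟩ (w.wt F b (v 0) : R)

/-- The image of a chain of tuples of points of a convex set under a continuous map. -/
def LocSys.push (hs : Convex ℝ s) [PathConnectedSpace s] (F : C(s, X)) (b : s) :
    Tup s R →ₗ[R] Ch X R :=
  Finsupp.linearCombination R (w.pushS hs F b)

theorem LocSys.push_single (hs : Convex ℝ s) [PathConnectedSpace s] (F : C(s, X)) (b : s)
    (v : Σ m : ℕ, Fin m → s) (r : R) :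
    w.push hs F b (Finsupp.single v r) = r • w.pushS hs F b v := by
  simp [LocSys.push]

/-- The coefficient of a tuple is the transport from the base point `b` to its first entry. When a
face changes that entry, the twist in `bd` is exactly the missing transport, by multiplicativity. -/
theorem LocSys.bd_push (hs : Convex ℝ s) [SimplyConnectedSpace s] (F : C(s, X)) (b : s)
    (x : Tup s R) : w.bd (w.push hs F b x) = w.push hs F b (td x) := by
  induction x using Finsupp.induction_linear with
  | zero => simp
  | add x y hx hy => simp only [map_add, hx, hy]
  | single v r =>
    obtain ⟨m, v⟩ := v
    match m, v with
    | 0, v => simp [LocSys.push_single, td_single, tdS, LocSys.pushS]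
    -- The boundary of a single point is the empty tuple, which `pushS` sends to zero: the
    -- augmentation disappears in the passage to chains.
    | 1, v =>
      simp only [LocSys.push_single, td_single, tdS, LocSys.pushS, map_smul, LocSys.bd_single,
        LocSys.bdS, map_sum, smul_zero, Finset.sum_const_zero]
    | m + 2, v =>
      simp only [LocSys.push_single, td_single, tdS, LocSys.pushS, map_smul, LocSys.bd_single,
        LocSys.bdS, map_sum]
      congr 1
      rw [Finset.smul_sum]
      refine Finset.sum_congr rfl fun i _ => ?_
      have h1 : pull i.succAbove (F.comp (aff hs v)) = F.comp (aff hs (v ∘ i.succAbove)) := by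
        rw [← pull_aff]
        rfl
      have h2 : w.edge (F.comp (aff hs v)) 0 (i.succAbove 0) = w.wt F (v 0) (v (i.succAbove 0)) := by
        unfold LocSys.edge
        rw [LocSys.wt_comp, aff_vertex, aff_vertex]
      rw [h1, h2, Finsupp.smul_single, Finsupp.smul_single, Function.comp_apply,
        ← w.wt_mul F b (v 0) (v (i.succAbove 0))]
      congr 1
      simp only [smul_eq_mul, Units.val_mul]
      ring

end Push

/-! ### Operators on singular chains defined by families -/

section Operators

variable {X : Type*} [TopologicalSpace X] {R : Type*} [CommRing R] (w : LocSys X R)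

theorem continuous_prismFst {N : ℕ} : Continuous (prismFst (N := N)) :=
  Continuous.subtype_mk (continuous_fst.comp continuous_subtype_val) _

theorem continuous_prismSnd {N : ℕ} : Continuous (prismSnd (N := N)) :=
  Continuous.subtype_mk (continuous_snd.comp continuous_subtype_val) _

/-- The restriction of a homotopy to the prism over a simplex. -/
def prismHtpy (H : C(X × unitInterval, X)) {n : ℕ} (σ : Simp X n) : C(prism (n + 1), X) where
  toFun p := H (σ (prismFst p), prismSnd p)
  continuous_toFun := H.continuous.comp
    ((σ.continuous.comp continuous_prismFst).prodMk continuous_prismSnd)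

instance contractible_prism (N : ℕ) : ContractibleSpace (prism (N + 1)) :=
  (convex_prism (N + 1)).contractibleSpace ⟨_, (prismBary N).2⟩

/-- The initial vertex of the base of a prism. -/
def prismBase (n : ℕ) : prism (n + 1) := prismMk (stdSimplex.vertex 0) 0

/-- The operator on singular chains defined by a homotopy and a family. -/
def LocSys.op (H : C(X × unitInterval, X)) (c : Fam R) : Ch X R →ₗ[R] Ch X R :=
  Finsupp.linearCombination R fun s =>
    w.push (convex_prism _) (prismHtpy H s.2) (prismBase s.1) (c (s.1 + 1))

theorem LocSys.op_single (H : C(X × unitInterval, X)) (c : Fam R) (s : Σ n : ℕ, Simp X n) (r : R) :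
    w.op H c (Finsupp.single s r) =
      r • w.push (convex_prism _) (prismHtpy H s.2) (prismBase s.1) (c (s.1 + 1)) := by
  simp [LocSys.op]

theorem LocSys.bd_op (H : C(X × unitInterval, X)) (c : Fam R) (x : Ch X R) :
    w.bd (w.op H c x) = w.op H (fun N => td (c N)) x := by
  induction x using Finsupp.induction_linear with
  | zero => simp
  | add x y hx hy => simp only [map_add, hx, hy]
  | single s r => simp [op_single, bd_push]

/-- The map of prisms induced by a map of vertices, as a continuous map. -/
def prismMapC {M N : ℕ} (θ : Fin M → Fin N) : C(prism M, prism N) where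
  toFun := prismMap θ
  continuous_toFun := Continuous.subtype_mk (Continuous.prodMk
    (continuous_subtype_val.comp ((stdSimplex.continuous_map θ).comp continuous_prismFst))
    (continuous_subtype_val.comp continuous_prismSnd)) _

theorem prismMapC_comp_aff {M N m : ℕ} (θ : Fin M → Fin N) (v : Fin (m + 1) → prism M) :
    (prismMapC θ).comp (aff (convex_prism M) v) = aff (convex_prism N) (prismMap θ ∘ v) := by
  refine comp_aff _ _ _ _ ((FunOnFinite.linearMap ℝ ℝ θ).prodMap LinearMap.id) fun x => ?_
  rfl

theorem LocSys.push_tmap {n m : ℕ} (θ : Fin (m + 1) → Fin (n + 1)) (F : C(prism (n + 1), X))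
    (b : prism (n + 1)) (b' : prism (m + 1)) (x : Tup (prism (m + 1)) R) :
    w.push (convex_prism _) F b (tmap (prismMap θ) x) =
      (w.wt F b (prismMap θ b') : R) •
        w.push (convex_prism _) (F.comp (prismMapC θ)) b' x := by
  induction x using Finsupp.induction_linear with
  | zero => simp
  | add x y hx hy => simp only [map_add, hx, hy, smul_add]
  | single v r =>
    obtain ⟨k, v⟩ := v
    cases k with
    | zero => simp [tmap_single, push_single, pushS]
    | succ k =>
      simp only [tmap_single, push_single, pushS]
      have h : w.wt (F.comp (prismMapC θ)) b' (v 0) = w.wt F (prismMap θ b') (prismMap θ (v 0)) :=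
        w.wt_comp F (prismMapC θ) b' (v 0)
      rw [h, ContinuousMap.comp_assoc, prismMapC_comp_aff, Function.comp_apply,
        ← w.wt_mul F b (prismMap θ b')]
      simp only [Finsupp.smul_single, smul_eq_mul, Units.val_mul]
      congr 1
      ring

/-- The prism over the simplex without vertices is empty, so only the empty tuple occurs. This
covers the faces of a `0`-simplex. -/
theorem push_tmap_zero {n : ℕ} (θ : Fin 0 → Fin (n + 1)) (F : C(prism (n + 1), X))
    (b : prism (n + 1)) (x : Tup (prism 0) R) :
    w.push (convex_prism _) F b (tmap (prismMap θ) x) = 0 := by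
  induction x using Finsupp.induction_linear with
  | zero => simp
  | add x y hx hy => simp only [map_add, hx, hy, add_zero]
  | single v r =>
    obtain ⟨k, v⟩ := v
    cases k with
    | zero => simp [tmap_single, LocSys.push_single, LocSys.pushS]
    | succ k =>
      have := (prismFst (v 0)).2.2
      simp at this

/-- The prism over a face of `σ` is a face of the prism over `σ`; the two base points differ by a
transport along the bottom of the prism. Since the homotopy starts at the identity, that transport
is the edge weight in the twisted boundary. Together with `bd_op`, every identity between families
becomes an identity between operators. -/
theorem LocSys.op_bd {H : C(X × unitInterval, X)} (hH : ∀ x, H (x, 0) = x) (c : Fam R) (x : Ch X R) :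
    w.op H c (w.bd x) = w.op H (fb c) x := by
  induction x using Finsupp.induction_linear with
  | zero => simp
  | add x y hx hy => simp only [map_add, hx, hy]
  | single s r =>
    obtain ⟨n, σ⟩ := s
    rw [bd_single, op_single, map_smul]
    congr 1
    cases n with
    | zero => simp [bdS, fb, push_tmap_zero]
    | succ n =>
      simp only [bdS, fb, map_sum, op_single, map_smul]
      refine Finset.sum_congr rfl fun i _ => ?_
      rw [push_tmap w i.succAbove (prismHtpy H σ) (prismBase (n + 1)) (prismBase n), smul_smul]
      have h1 : (prismHtpy H σ).comp (prismMapC i.succAbove) = prismHtpy H (pull i.succAbove σ) := by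
        ext p
        rfl
      have h2 : w.edge σ 0 (i.succAbove 0) =
          w.wt (prismHtpy H σ) (prismBase (n + 1)) (prismMap i.succAbove (prismBase n)) := by
        -- The inclusion of the bottom of the prism, along which `prismHtpy H σ` restricts to `σ`.
        let g : C(stdSimplex ℝ (Fin (n + 1 + 1)), prism (n + 1 + 1)) :=
          ⟨fun x => prismMk x 0, Continuous.subtype_mk
            (continuous_subtype_val.prodMk continuous_const) _⟩
        have hg : (prismHtpy H σ).comp g = σ := by
          ext p
          exact hH _
        have := w.wt_comp (prismHtpy H σ) g (stdSimplex.vertex 0) (stdSimplex.vertex (i.succAbove 0))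
        rw [hg] at this
        rw [prismBase, prismBase, prismMap_vertex]
        exact this
      rw [h1, h2]

theorem LocSys.op_vertFam_zero {H : C(X × unitInterval, X)} (hH : ∀ x, H (x, 0) = x) (x : Ch X R) :
    w.op H (vertFam 0) x = x := by
  induction x using Finsupp.induction_linear with
  | zero => simp
  | add x y hx hy => simp only [map_add, hx, hy]
  | single s r =>
    obtain ⟨n, σ⟩ := s
    rw [op_single, vertFam, push_single, pushS, one_smul]
    have h1 : (prismHtpy H σ).comp (aff (convex_prism (n + 1))
        fun i => prismMk (stdSimplex.vertex i) 0) = σ := by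
      ext x
      refine (congrArg H (Prod.ext (congrArg σ ?_) ?_)).trans (hH (σ x))
      · refine Subtype.ext (funext fun j => ?_)
        change (∑ i, x i • ((stdSimplex.vertex i : stdSimplex ℝ (Fin (n + 1))).1, (0 : ℝ))).1 j = x j
        simp [Prod.fst_sum, Finset.sum_apply, Pi.single_apply]
      · refine Subtype.ext ?_
        change (∑ i, x i • ((stdSimplex.vertex i : stdSimplex ℝ (Fin (n + 1))).1, (0 : ℝ))).2 = 0
        simp [Prod.snd_sum]
    have h2 : w.wt (prismHtpy H σ) (prismBase n) (prismMk (stdSimplex.vertex 0) 0) = 1 :=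
      w.wt_self _ _
    rw [h1, h2]
    simp

/-- The square of the boundary operator vanishes. -/
theorem LocSys.bd_bd (x : Ch X R) : w.bd (w.bd x) = 0 := by
  -- For the constant homotopy the family of bottom vertices acts as the identity, so `bd ∘ bd` is
  -- the operator of `td (td c)`, which vanishes.
  have hH : ∀ x : X, (⟨Prod.fst, continuous_fst⟩ : C(X × unitInterval, X)) (x, 0) = x := fun _ => rfl
  rw [← w.op_vertFam_zero hH x, bd_op, bd_op]
  simp only [td_td]
  simp [op, Finsupp.linearCombination_apply]

end Operators

/-! ### Supports of chains, relative cycles and boundaries -/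

section Supports

variable {X : Type*} [TopologicalSpace X] (R : Type*) [CommRing R]

/-- Chains of all degrees with simplices in `A`. -/
def chA (A : Set X) : Submodule R (Ch X R) := Finsupp.supported R R {s | Set.range s.2 ⊆ A}

/-- Chains of degree `i` with simplices in `A`. -/
def chIn (i : ℕ) (A : Set X) : Submodule R (Ch X R) :=
  Finsupp.supported R R {s | s.1 = i ∧ Set.range s.2 ⊆ A}

variable {R}

theorem chIn_le_chA (i : ℕ) (A : Set X) : chIn R i A ≤ chA R A :=
  Finsupp.supported_mono fun _ h => h.2

theorem chIn_mono (i : ℕ) {A B : Set X} (h : A ⊆ B) : chIn R i A ≤ chIn R i B :=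
  Finsupp.supported_mono fun _ hs => ⟨hs.1, hs.2.trans h⟩

theorem chA_mono {A B : Set X} (h : A ⊆ B) : chA R A ≤ chA R B :=
  Finsupp.supported_mono fun _ hs => hs.trans h

theorem mem_chIn_of_mem_chA {i : ℕ} {A B : Set X} {x : Ch X R} (h : x ∈ chIn R i B)
    (h' : x ∈ chA R A) : x ∈ chIn R i A :=
  fun _ hs => ⟨(h hs).1, h' hs⟩

theorem mem_chA_inter {A B : Set X} {x : Ch X R} (h : x ∈ chA R A) (h' : x ∈ chA R B) :
    x ∈ chA R (A ∩ B) :=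
  fun _ hs => Set.subset_inter (h hs) (h' hs)

theorem single_mem_chIn {i : ℕ} {A : Set X} {σ : Simp X i} (h : Set.range σ ⊆ A) (r : R) :
    Finsupp.single ⟨i, σ⟩ r ∈ chIn R i A :=
  Finsupp.single_mem_supported R r ⟨rfl, h⟩

theorem map_mem_of_supported {ι M : Type*} [AddCommGroup M] [Module R M] {s : Set ι}
    {f : (ι →₀ R) →ₗ[R] M} {S : Submodule R M} (h : ∀ a ∈ s, f (Finsupp.single a 1) ∈ S)
    {x : ι →₀ R} (hx : x ∈ Finsupp.supported R R s) : f x ∈ S := by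
  suffices H : Finsupp.supported R R s ≤ S.comap f from H hx
  rw [Finsupp.supported_eq_span_single, Submodule.span_le]
  rintro _ ⟨a, ha, rfl⟩
  exact h a ha

theorem map_mem_of_chIn {i : ℕ} {A : Set X} {M : Type*} [AddCommGroup M] [Module R M]
    {f : Ch X R →ₗ[R] M} {S : Submodule R M}
    (h : ∀ σ : Simp X i, Set.range σ ⊆ A → f (Finsupp.single ⟨i, σ⟩ 1) ∈ S) {x : Ch X R}
    (hx : x ∈ chIn R i A) : f x ∈ S := by
  refine map_mem_of_supported ?_ hx
  rintro ⟨n, σ⟩ ⟨rfl, hσ⟩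
  exact h σ hσ

theorem map_mem_of_chA {A : Set X} {M : Type*} [AddCommGroup M] [Module R M]
    {f : Ch X R →ₗ[R] M} {S : Submodule R M}
    (h : ∀ i, ∀ y ∈ chIn R i A, f y ∈ S) {x : Ch X R} (hx : x ∈ chA R A) : f x ∈ S := by
  refine map_mem_of_supported ?_ hx
  rintro ⟨n, σ⟩ hσ
  exact h n _ (single_mem_chIn hσ 1)

variable (w : LocSys X R)

theorem range_pull {m n : ℕ} (θ : Fin (m + 1) → Fin (n + 1)) (σ : Simp X n) :
    Set.range (pull θ σ) ⊆ Set.range σ :=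
  Set.range_comp_subset_range (stdSimplex.map θ) σ

theorem bd_mem {i : ℕ} {A : Set X} {x : Ch X R} (h : x ∈ chIn R (i + 1) A) :
    w.bd x ∈ chIn R i A := by
  refine map_mem_of_chIn (f := w.bd) (fun σ hσ => ?_) h
  rw [w.bd_single, one_smul, LocSys.bdS]
  exact Submodule.sum_mem _ fun j _ => single_mem_chIn ((range_pull _ _).trans hσ) _

theorem bd_zero_degree {A : Set X} {x : Ch X R} (h : x ∈ chIn R 0 A) : w.bd x = 0 := by
  refine map_mem_of_chIn (f := w.bd) (S := ⊥) (fun σ hσ => ?_) h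
  simp [w.bd_single, LocSys.bdS]

theorem bd_mem_chA {A : Set X} {x : Ch X R} (h : x ∈ chA R A) : w.bd x ∈ chA R A := by
  refine map_mem_of_chA (f := w.bd) (fun i y hy => ?_) h
  cases i with
  | zero => rw [bd_zero_degree w hy]; exact zero_mem _
  | succ i => exact chIn_le_chA _ _ (bd_mem w hy)

/-- Relative cycles. -/
def relZ (i : ℕ) (B A : Set X) : Submodule R (Ch X R) := chIn R i B ⊓ (chA R A).comap w.bd

theorem mem_relZ {i : ℕ} {B A : Set X} {x : Ch X R} :
    x ∈ relZ w i B A ↔ x ∈ chIn R i B ∧ w.bd x ∈ chA R A :=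
  Iff.rfl

/-- Relative boundaries. -/
def relD (i : ℕ) (B A : Set X) : Submodule R (Ch X R) := (chIn R (i + 1) B).map w.bd ⊔ chIn R i A

theorem relD_mono (i : ℕ) {B B' A A' : Set X} (hB : B ⊆ B') (hA : A ⊆ A') :
    relD w i B A ≤ relD w i B' A' :=
  sup_le_sup (Submodule.map_mono (chIn_mono _ hB)) (chIn_mono _ hA)

theorem relZ_mono (i : ℕ) {B B' A A' : Set X} (hB : B ⊆ B') (hA : A ⊆ A') :
    relZ w i B A ≤ relZ w i B' A' :=
  inf_le_inf (chIn_mono _ hB) (Submodule.comap_mono (chA_mono hA))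

end Supports

/-! ### Gradings of families -/

section Graded

variable {R : Type*} [CommRing R]

/-- A family consists of tuples with `e` more entries than the prism has edges. -/
def FamDeg (c : Fam R) (e : ℕ) : Prop := ∀ N, c N ∈ Finsupp.supported R R {s | s.1 = N + e}

theorem tcone_mem {V : Type*} (p : V) {m : ℕ} {x : Tup V R}
    (h : x ∈ Finsupp.supported R R {s : Σ m : ℕ, Fin m → V | s.1 = m}) :
    tcone p x ∈ Finsupp.supported R R {s : Σ m : ℕ, Fin m → V | s.1 = m + 1} := by
  refine map_mem_of_supported (f := tcone p) (fun s hs => ?_) h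
  rw [tcone_single]
  exact Finsupp.single_mem_supported R _ (congrArg (· + 1) hs)

theorem tmap_mem {V V' : Type*} (f : V → V') {m : ℕ} {x : Tup V R}
    (h : x ∈ Finsupp.supported R R {s : Σ m : ℕ, Fin m → V | s.1 = m}) :
    tmap f x ∈ Finsupp.supported R R {s : Σ m : ℕ, Fin m → V' | s.1 = m} := by
  refine map_mem_of_supported (f := tmap f) (fun s hs => ?_) h
  rw [tmap_single]
  exact Finsupp.single_mem_supported R _ hs

theorem famDeg_vertFam (t : unitInterval) : FamDeg (vertFam t : Fam R) 0 := fun _ =>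
  Finsupp.single_mem_supported R _ rfl

theorem vertFam_zero (t : unitInterval) :
    (vertFam t 0 : Tup _ R) = Finsupp.single ⟨0, Fin.elim0⟩ 1 := by
  unfold vertFam
  congr 2
  exact funext fun j => j.elim0

theorem famDeg_htpyFam {α β : Fam R} (hα : FamDeg α 0) (hβ : FamDeg β 0) :
    FamDeg (htpyFam α β) 1 := by
  intro N
  induction N with
  | zero => exact zero_mem _
  | succ N ih =>
    refine tcone_mem _ (Submodule.sub_mem _ (Submodule.sub_mem _ (hα _) (hβ _)) ?_)
    exact Submodule.sum_mem _ fun i _ => Submodule.smul_mem _ _ (tmap_mem _ ih)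

theorem famDeg_subFam : FamDeg (subFam : Fam R) 0 := by
  intro N
  induction N with
  | zero => exact Finsupp.single_mem_supported R _ rfl
  | succ N ih =>
    exact tcone_mem _ (Submodule.sum_mem _ fun i _ => Submodule.smul_mem _ _ (tmap_mem _ ih))

variable {X : Type*} [TopologicalSpace X] (w : LocSys X R) {H : C(X × unitInterval, X)}

theorem op_mem {c : Fam R} {e : ℕ} (hc : FamDeg c e) {A B : Set X}
    (hH : ∀ x ∈ A, ∀ t, H (x, t) ∈ B) {i : ℕ} {x : Ch X R} (hx : x ∈ chIn R i A) :
    w.op H c x ∈ chIn R (i + e) B := by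
  refine map_mem_of_chIn (f := w.op H c) (fun σ hσ => ?_) hx
  rw [w.op_single, one_smul]
  refine map_mem_of_supported (f := w.push (convex_prism _) (prismHtpy H σ) (prismBase i)) ?_
    (hc (i + 1))
  rintro ⟨m, v⟩ hm
  change m = i + 1 + e at hm
  obtain rfl : m = i + e + 1 := by omega
  rw [w.push_single, one_smul, LocSys.pushS]
  refine single_mem_chIn ?_ _
  rintro _ ⟨y, rfl⟩
  exact hH _ (hσ ⟨_, rfl⟩) _

theorem op_mem_chA {c : Fam R} {e : ℕ} (hc : FamDeg c e) {A B : Set X}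
    (hH : ∀ x ∈ A, ∀ t, H (x, t) ∈ B) {x : Ch X R} (hx : x ∈ chA R A) :
    w.op H c x ∈ chA R B :=
  map_mem_of_chA (f := w.op H c) (fun _ _ hy => chIn_le_chA _ _ (op_mem w hc hH hy)) hx

theorem op_add (c c' : Fam R) (x : Ch X R) : w.op H (c + c') x = w.op H c x + w.op H c' x := by
  induction x using Finsupp.induction_linear with
  | zero => simp
  | add x y hx hy => simp only [map_add, hx, hy]; abel
  | single s r => simp [w.op_single]

theorem op_sub (c c' : Fam R) (x : Ch X R) : w.op H (c - c') x = w.op H c x - w.op H c' x := by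
  rw [eq_sub_iff_add_eq, ← op_add, sub_add_cancel]

/-- Two families of cycles induce homotopic operators. -/
theorem op_sub_op_mem_relD (h0 : ∀ x, H (x, 0) = x) {α β : Fam R} (dα : FamDeg α 0)
    (dβ : FamDeg β 0) (hα : ∀ N, td (α N) = fb α N) (hβ : ∀ N, td (β N) = fb β N)
    (hαβ : α 0 = β 0) {A B : Set X} (hA : ∀ x ∈ A, ∀ t, H (x, t) ∈ A)
    (hB : ∀ x ∈ B, ∀ t, H (x, t) ∈ B) {i : ℕ} {x : Ch X R} (hx : x ∈ relZ w i B A) :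
    w.op H α x - w.op H β x ∈ relD w i B A := by
  -- The family identity `td_htpyFam`, read as a chain homotopy between the two operators.
  have key : w.op H α x - w.op H β x =
      w.bd (w.op H (htpyFam α β) x) + w.op H (htpyFam α β) (w.bd x) := by
    rw [w.op_bd h0, w.bd_op, ← op_add, ← op_sub]
    congr 2
    funext N
    exact (td_htpyFam hα hβ hαβ N).symm
  have hd := famDeg_htpyFam dα dβ
  rw [key]
  refine Submodule.add_mem_sup ⟨_, op_mem w hd hB hx.1, rfl⟩ ?_
  cases i with
  | zero => rw [bd_zero_degree w hx.1, map_zero]; exact zero_mem _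
  | succ i => exact op_mem w hd hA (mem_chIn_of_mem_chA (bd_mem w hx.1) hx.2)

theorem op_mem_relZ (h0 : ∀ x, H (x, 0) = x) {α : Fam R} (dα : FamDeg α 0)
    (hα : ∀ N, td (α N) = fb α N) {A B : Set X} (hA : ∀ x ∈ A, ∀ t, H (x, t) ∈ A)
    (hB : ∀ x ∈ B, ∀ t, H (x, t) ∈ B) {i : ℕ} {x : Ch X R} (hx : x ∈ relZ w i B A) :
    w.op H α x ∈ relZ w i B A := by
  refine ⟨op_mem w dα hB hx.1, ?_⟩
  have : w.bd (w.op H α x) = w.op H α (w.bd x) := by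
    rw [w.op_bd h0, w.bd_op]
    congr 2
    funext N
    exact hα N
  change w.bd _ ∈ chA R A
  rw [this]
  exact op_mem_chA w dα hA hx.2

theorem op_vertFam_one_mem {A B : Set X} (hH : ∀ x ∈ A, H (x, 1) ∈ B) {i : ℕ} {x : Ch X R}
    (hx : x ∈ chIn R i A) : w.op H (vertFam 1) x ∈ chIn R i B := by
  refine map_mem_of_chIn (f := w.op H (vertFam 1)) (fun σ hσ => ?_) hx
  rw [w.op_single, one_smul, vertFam, w.push_single, one_smul, LocSys.pushS]
  refine single_mem_chIn ?_ _
  rintro _ ⟨y, rfl⟩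
  have h1 : prismSnd (aff (convex_prism (i + 1))
      (fun j => prismMk (stdSimplex.vertex j) 1) y) = 1 := by
    refine Subtype.ext ?_
    change (∑ j, y j • ((stdSimplex.vertex j : stdSimplex ℝ (Fin (i + 1))).1, (1 : ℝ))).2 = 1
    simp [Prod.snd_sum]
  change H (σ _, prismSnd _) ∈ B
  rw [h1]
  exact hH _ (hσ ⟨_, rfl⟩)

/-- A deformation moves relative cycles to the image of its final stage. -/
theorem exists_deformation (h0 : ∀ x, H (x, 0) = x) {A B A' B' : Set X}
    (hA : ∀ x ∈ A, ∀ t, H (x, t) ∈ A) (hB : ∀ x ∈ B, ∀ t, H (x, t) ∈ B)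
    (hA' : ∀ x ∈ A, H (x, 1) ∈ A') (hB' : ∀ x ∈ B, H (x, 1) ∈ B') {i : ℕ} :
    relZ w i B A ≤ relZ w i B' A' ⊔ relD w i B A := by
  intro x hx
  have h1 := op_sub_op_mem_relD w h0 (famDeg_vertFam 1) (famDeg_vertFam 0) (td_vertFam 1)
    (td_vertFam 0) ((vertFam_zero 1).trans (vertFam_zero 0).symm) hA hB hx
  rw [w.op_vertFam_zero h0] at h1
  have h2 : w.op H (vertFam 1) x ∈ relZ w i B' A' := by
    refine ⟨op_vertFam_one_mem w hB' hx.1, ?_⟩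
    have : w.bd (w.op H (vertFam 1) x) = w.op H (vertFam 1) (w.bd x) := by
      rw [w.op_bd h0, w.bd_op]
      congr 2
      funext N
      exact td_vertFam 1 N
    change w.bd _ ∈ chA R A'
    rw [this]
    exact map_mem_of_chA (f := w.op H (vertFam 1))
      (fun _ _ hy => chIn_le_chA _ _ (op_vertFam_one_mem w hA' hy)) hx.2
  rw [← sub_sub_cancel (w.op H (vertFam 1) x) x]
  exact Submodule.sub_mem _ (Submodule.mem_sup_left h2) (Submodule.mem_sup_right h1)

/-- If `B` deforms into `A`, then all relative cycles are relative boundaries. -/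
theorem relZ_le_relD_of_deformation (h0 : ∀ x, H (x, 0) = x) {A B : Set X}
    (hA : ∀ x ∈ A, ∀ t, H (x, t) ∈ A) (hB : ∀ x ∈ B, ∀ t, H (x, t) ∈ B)
    (hBA : ∀ x ∈ B, H (x, 1) ∈ A) {i : ℕ} : relZ w i B A ≤ relD w i B A := by
  refine (exists_deformation w h0 hA hB (fun x hx => hA x hx 1) hBA).trans (sup_le ?_ le_rfl)
  exact inf_le_left.trans le_sup_right

end Graded

/-! ### Barycentric subdivision makes simplices small -/

section Mesh

variable {R : Type*} [CommRing R]

/-- Affine images of a simplex whose edges have length at most `C` have edges of length at most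
`(N - 1) / N * C`. -/
def SmallTuple (N : ℕ) (v : Σ m : ℕ, Fin m → prism N) : Prop :=
  v.1 = N ∧ ∀ (k : ℕ) (x : Fin N → (Fin k → ℝ)) (C : ℝ), (∀ a b, ‖x a - x b‖ ≤ C) →
    ∀ i j, ‖∑ a, prismFst (v.2 i) a • x a - ∑ a, prismFst (v.2 j) a • x a‖ ≤
      ((N : ℝ) - 1) / N * C

/-- The difference is the average, with weights `q b`, of the vectors `(N + 1)⁻¹ ∑ a, (x a - x b)`;
the term `a = b` vanishes, which leaves `N` terms of norm at most `C`. -/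
theorem norm_barycenter_sub_le {N k : ℕ} (x : Fin (N + 1) → (Fin k → ℝ)) {C : ℝ}
    (h : ∀ a b, ‖x a - x b‖ ≤ C) (q : stdSimplex ℝ (Fin (N + 1))) :
    ‖∑ a, (stdSimplex.barycenter : stdSimplex ℝ (Fin (N + 1))) a • x a - ∑ a, q a • x a‖ ≤
      (((N + 1 : ℕ) : ℝ) - 1) / (N + 1 : ℕ) * C := by
  have hC : 0 ≤ C := (norm_nonneg _).trans (h 0 0)
  have hN : ((N + 1 : ℕ) : ℝ) ≠ 0 := by positivity
  have e1 : ∑ a, (stdSimplex.barycenter : stdSimplex ℝ (Fin (N + 1))) a • x a - ∑ a, q a • x a =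
      ∑ b, q b • ((1 / ((N + 1 : ℕ) : ℝ)) • ∑ a, (x a - x b)) := by
    simp only [Finset.sum_sub_distrib, smul_sub, Finset.sum_const, Finset.card_univ,
      Fintype.card_fin, ← Nat.cast_smul_eq_nsmul ℝ, smul_smul]
    rw [← Finset.sum_smul, ← Finset.sum_mul]
    have : ∑ b, q b = 1 := q.2.2
    rw [this, one_mul, Finset.smul_sum]
    congr 1
    · refine Finset.sum_congr rfl fun a _ => ?_
      have : (stdSimplex.barycenter : stdSimplex ℝ (Fin (N + 1))) a =
          ((Fintype.card (Fin (N + 1)) : ℕ) : ℝ)⁻¹ := stdSimplex.barycenter_apply a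
      rw [this, Fintype.card_fin, one_div]
    · refine Finset.sum_congr rfl fun a _ => ?_
      field_simp
  rw [e1]
  calc ‖∑ b, q b • ((1 / ((N + 1 : ℕ) : ℝ)) • ∑ a, (x a - x b))‖
      ≤ ∑ b, ‖q b • ((1 / ((N + 1 : ℕ) : ℝ)) • ∑ a, (x a - x b))‖ := norm_sum_le _ _
    _ ≤ ∑ b, q b * ((((N + 1 : ℕ) : ℝ) - 1) / (N + 1 : ℕ) * C) := by
        refine Finset.sum_le_sum fun b _ => ?_
        rw [norm_smul, Real.norm_of_nonneg (show 0 ≤ q b from q.2.1 b)]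
        refine mul_le_mul_of_nonneg_left ?_ (q.2.1 b)
        rw [norm_smul, Real.norm_of_nonneg (by positivity), div_mul_eq_mul_div, one_mul,
          div_mul_eq_mul_div]
        refine div_le_div_of_nonneg_right ?_ (by positivity)
        refine (norm_sum_le _ _).trans ?_
        rw [← Finset.add_sum_erase _ _ (Finset.mem_univ b), sub_self, norm_zero, zero_add]
        refine (Finset.sum_le_card_nsmul _ _ C fun a _ => h a b).trans ?_
        rw [Finset.card_erase_of_mem (Finset.mem_univ b), Finset.card_univ, Fintype.card_fin,
          nsmul_eq_mul]
        simp
    _ = (((N + 1 : ℕ) : ℝ) - 1) / (N + 1 : ℕ) * C := by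
        rw [← Finset.sum_mul, show ∑ b, q b = 1 from q.2.2, one_mul]

/-- An edge through the apex is estimated by the barycenter bound, any other edge lies in a face and
is estimated by induction, since `(N - 1) / N` increases with `N`. Allowing arbitrary affine images
`x` in `SmallTuple` is what permits iteration. -/
theorem subFam_small (N : ℕ) : (subFam N : Tup _ R) ∈ Finsupp.supported R R {v | SmallTuple N v} := by
  induction N with
  | zero => exact Finsupp.single_mem_supported R _ ⟨rfl, fun k x C h i => i.elim0⟩
  | succ N ih =>
    rw [subFam_succ, fb, map_sum]
    refine Submodule.sum_mem _ fun l _ => ?_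
    rw [map_smul]
    refine Submodule.smul_mem _ _ ?_
    refine map_mem_of_supported (f := tcone (prismBary N) ∘ₗ tmap (prismMap l.succAbove)) ?_ ih
    rintro ⟨m, v⟩ ⟨hm, hv⟩
    obtain rfl : m = N := hm
    rw [LinearMap.comp_apply, tmap_single, tcone_single]
    refine Finsupp.single_mem_supported R _ ⟨rfl, fun k x C h i j => ?_⟩
    have hC : 0 ≤ C := (norm_nonneg _).trans (h 0 0)
    have hm : (((m + 1 : ℕ) : ℝ) - 1) / (m + 1 : ℕ) * C ≥ 0 := by
      refine mul_nonneg (div_nonneg ?_ (by positivity)) hC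
      push_cast
      simp
    refine Fin.cases ?_ (fun i => ?_) i <;> refine Fin.cases ?_ (fun j => ?_) j
    · rw [sub_self, norm_zero]
      exact hm
    · exact norm_barycenter_sub_le x h _
    · rw [norm_sub_rev]
      exact norm_barycenter_sub_le x h _
    · have e : ∀ i : Fin m, ∑ a, prismFst ((Fin.cons (prismBary m)
          (prismMap l.succAbove ∘ v) : Fin (m + 1) → prism (m + 1)) i.succ) a • x a =
          ∑ a, prismFst (v i) a • x (l.succAbove a) := fun i => by
        rw [Fin.cons_succ]
        exact sum_map_smul l.succAbove (prismFst (v i)) x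
      change ‖∑ a, prismFst ((Fin.cons (prismBary m)
          (prismMap l.succAbove ∘ v) : Fin (m + 1) → prism (m + 1)) i.succ) a • x a -
          ∑ a, prismFst ((Fin.cons (prismBary m)
          (prismMap l.succAbove ∘ v) : Fin (m + 1) → prism (m + 1)) j.succ) a • x a‖ ≤ _
      rw [e, e]
      refine (hv k (fun a => x (l.succAbove a)) C (fun a b => h _ _) i j).trans ?_
      refine mul_le_mul_of_nonneg_right ?_ hC
      have hm : 0 < m := i.pos
      have hm' : (0 : ℝ) < m := by exact_mod_cast hm
      rw [div_le_div_iff₀ hm' (by positivity)]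
      push_cast
      nlinarith

variable {X : Type*} [TopologicalSpace X] (w : LocSys X R)

/-- The constant homotopy. -/
def constHtpy (X : Type*) [TopologicalSpace X] : C(X × unitInterval, X) := ⟨Prod.fst, continuous_fst⟩

/-- The barycentric subdivision of singular chains. -/
def LocSys.sd : Ch X R →ₗ[R] Ch X R := w.op (constHtpy X) subFam

/-- The affine simplices of mesh at most `C` in a given singular simplex. -/
def smallIn {n : ℕ} (σ : Simp X n) (C : ℝ) : Set (Σ n : ℕ, Simp X n) :=
  {s | ∃ v : Fin (n + 1) → stdSimplex ℝ (Fin (n + 1)),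
    s = ⟨n, σ.comp (aff (convex_stdSimplex ℝ (Fin (n + 1))) v)⟩ ∧ ∀ a b, ‖(v a).1 - (v b).1‖ ≤ C}

/-- An affine simplex inside an affine simplex is affine, so one subdivision multiplies the mesh by
the factor `n / (n + 1)`. -/
theorem sd_smallIn {n : ℕ} (σ : Simp X n) {C : ℝ} {x : Ch X R}
    (hx : x ∈ Finsupp.supported R R (smallIn σ C)) :
    w.sd x ∈ Finsupp.supported R R (smallIn σ ((((n + 1 : ℕ) : ℝ) - 1) / (n + 1 : ℕ) * C)) := by
  refine map_mem_of_supported (f := w.sd) ?_ hx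
  rintro _ ⟨v, rfl, hv⟩
  rw [LocSys.sd, w.op_single, one_smul]
  refine map_mem_of_supported (f := w.push _ _ _) ?_ (subFam_small (n + 1))
  rintro ⟨m, y⟩ ⟨hm, hy⟩
  obtain rfl : m = n + 1 := hm
  rw [w.push_single, one_smul, LocSys.pushS]
  have e1 : (⟨prismFst, continuous_prismFst⟩ : C(prism (n + 1), stdSimplex ℝ (Fin (n + 1)))).comp
      (aff (convex_prism (n + 1)) y) = aff (convex_stdSimplex ℝ (Fin (n + 1))) (prismFst ∘ y) :=
    comp_aff _ _ y _ (LinearMap.fst ℝ (Fin (n + 1) → ℝ) ℝ) fun _ => rfl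
  have e2 : (aff (convex_stdSimplex ℝ (Fin (n + 1))) v).comp
      (aff (convex_stdSimplex ℝ (Fin (n + 1))) (prismFst ∘ y)) =
      aff (convex_stdSimplex ℝ (Fin (n + 1)))
        (aff (convex_stdSimplex ℝ (Fin (n + 1))) v ∘ prismFst ∘ y) := by
    refine comp_aff _ _ _ _ (∑ i, (LinearMap.proj i).smulRight (v i).1) fun x => ?_
    simp [aff_apply, LinearMap.sum_apply]
    rfl
  refine Finsupp.single_mem_supported R _ (show _ ∈ smallIn σ _ from
    ⟨aff (convex_stdSimplex ℝ (Fin (n + 1))) v ∘ prismFst ∘ y, ?_, ?_⟩)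
  · rw [← e2, ← e1]
    rfl
  · intro a b
    exact hy (n + 1) (fun i => (v i).1) C hv a b

theorem sd_pow_smallIn {n : ℕ} (σ : Simp X n) (m : ℕ) :
    (w.sd ^ m) (Finsupp.single ⟨n, σ⟩ 1) ∈
      Finsupp.supported R R (smallIn σ (((((n + 1 : ℕ) : ℝ) - 1) / (n + 1 : ℕ)) ^ m)) := by
  induction m with
  | zero =>
    refine Finsupp.single_mem_supported R _ ⟨fun i => stdSimplex.vertex i, ?_, fun a b => ?_⟩
    · congr 1
      ext x
      refine congrArg σ (Subtype.ext (funext fun j => ?_))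
      rw [aff_apply]
      simp [Finset.sum_apply, Pi.single_apply]
      rfl
    · rw [pow_zero, pi_norm_le_iff_of_nonneg zero_le_one]
      intro i
      have ha := mem_Icc_of_mem_stdSimplex (stdSimplex.vertex a : stdSimplex ℝ (Fin (n + 1))).2 i
      have hb := mem_Icc_of_mem_stdSimplex (stdSimplex.vertex b : stdSimplex ℝ (Fin (n + 1))).2 i
      rw [Pi.sub_apply, Real.norm_eq_abs, abs_le]
      constructor <;> linarith [ha.1, ha.2, hb.1, hb.2]
  | succ m ih =>
    rw [pow_succ' w.sd, Module.End.mul_apply, pow_succ']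
    exact sd_smallIn w σ ih

theorem constHtpy_mem {A : Set X} : ∀ x ∈ A, ∀ t, constHtpy X (x, t) ∈ A := fun _ hx _ => hx

theorem sd_pow_mem_chIn {i : ℕ} {A : Set X} {x : Ch X R} (hx : x ∈ chIn R i A) (m : ℕ) :
    (w.sd ^ m) x ∈ chIn R i A := by
  induction m with
  | zero => exact hx
  | succ m ih =>
    rw [pow_succ', Module.End.mul_apply]
    exact op_mem w famDeg_subFam constHtpy_mem ih

theorem sd_pow_relZ {i : ℕ} {A B : Set X} {x : Ch X R} (hx : x ∈ relZ w i B A) (m : ℕ) :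
    (w.sd ^ m) x ∈ relZ w i B A ∧ (w.sd ^ m) x - x ∈ relD w i B A := by
  induction m with
  | zero => exact ⟨hx, by simp⟩
  | succ m ih =>
    rw [pow_succ', Module.End.mul_apply]
    refine ⟨op_mem_relZ w (fun _ => rfl) famDeg_subFam td_subFam constHtpy_mem constHtpy_mem ih.1,
      ?_⟩
    have h := op_sub_op_mem_relD w (H := constHtpy X) (fun _ => rfl) famDeg_subFam
      (famDeg_vertFam 0) td_subFam (td_vertFam 0) (vertFam_zero 0).symm constHtpy_mem constHtpy_mem
      ih.1
    rw [w.op_vertFam_zero (fun _ => rfl)] at h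
    have := Submodule.add_mem _ h ih.2
    rwa [sub_add_sub_cancel] at this

/-- A Lebesgue number `δ` of the cover of the standard simplex by the two preimages exceeds the mesh
after enough subdivisions; by convexity each small affine simplex lies in the `δ`-ball around its
first vertex. -/
theorem exists_sd_pow_single_mem {U' V' B : Set X} (hU : IsOpen U') (hV : IsOpen V')
    (hB : B ⊆ U' ∪ V') {n : ℕ} (σ : Simp X n) (hσ : Set.range σ ⊆ B) :
    ∃ m, (w.sd ^ m) (Finsupp.single ⟨n, σ⟩ 1) ∈ chIn R n (U' ∩ B) ⊔ chIn R n (V' ∩ B) := by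
  obtain ⟨δ, hδ, hδ'⟩ := lebesgue_number_lemma_of_metric (s := Set.univ)
    (c := fun b : Bool => if b then σ ⁻¹' U' else σ ⁻¹' V') isCompact_univ
    (by
      rintro (_ | _)
      · exact hV.preimage σ.continuous
      · exact hU.preimage σ.continuous)
    (by
      intro x _
      rcases hB (hσ ⟨x, rfl⟩) with h | h
      · exact Set.mem_iUnion.mpr ⟨true, h⟩
      · exact Set.mem_iUnion.mpr ⟨false, h⟩)
  have hr1 : (((n + 1 : ℕ) : ℝ) - 1) / (n + 1 : ℕ) < 1 := by
    rw [div_lt_one (by positivity)]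
    linarith
  have hr0 : 0 ≤ (((n + 1 : ℕ) : ℝ) - 1) / (n + 1 : ℕ) := by
    refine div_nonneg ?_ (by positivity)
    push_cast
    simp
  obtain ⟨m, hm⟩ := exists_pow_lt_of_lt_one hδ hr1
  refine ⟨m, ?_⟩
  refine map_mem_of_supported (f := LinearMap.id) ?_ (sd_pow_smallIn w σ m)
  rintro _ ⟨v, rfl, hv⟩
  rw [LinearMap.id_apply]
  obtain ⟨b, hb⟩ := hδ' (v 0) trivial
  have hball : ∀ y, aff (convex_stdSimplex ℝ (Fin (n + 1))) v y ∈ Metric.ball (v 0) δ := by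
    intro y
    rw [Metric.mem_ball, Subtype.dist_eq, dist_eq_norm]
    refine lt_of_le_of_lt ?_ hm
    rw [aff_apply]
    have e : ∑ i, y i • (v i).1 - (v 0).1 = ∑ i, y i • ((v i).1 - (v 0).1) := by
      simp only [smul_sub, Finset.sum_sub_distrib]
      rw [← Finset.sum_smul, show ∑ i, y i = 1 from y.2.2, one_smul]
    rw [e]
    refine (norm_sum_le _ _).trans ?_
    calc ∑ i, ‖y i • ((v i).1 - (v 0).1)‖
        ≤ ∑ i, y i * ((((n + 1 : ℕ) : ℝ) - 1) / (n + 1 : ℕ)) ^ m := by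
          refine Finset.sum_le_sum fun i _ => ?_
          rw [norm_smul, Real.norm_of_nonneg (show 0 ≤ y i from y.2.1 i)]
          exact mul_le_mul_of_nonneg_left (hv i 0) (y.2.1 i)
      _ = _ := by rw [← Finset.sum_mul, show ∑ i, y i = 1 from y.2.2, one_mul]
  have hsub : ∀ y, σ (aff (convex_stdSimplex ℝ (Fin (n + 1))) v y) ∈ B := fun y => hσ ⟨_, rfl⟩
  cases b with
  | true =>
    refine Submodule.mem_sup_left (single_mem_chIn ?_ 1)
    rintro _ ⟨y, rfl⟩
    exact ⟨hb (hball y), hsub y⟩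
  | false =>
    refine Submodule.mem_sup_right (single_mem_chIn ?_ 1)
    rintro _ ⟨y, rfl⟩
    exact ⟨hb (hball y), hsub y⟩

theorem sd_pow_mem_sup {i : ℕ} {A B : Set X} {x : Ch X R} (hx : x ∈ chIn R i A ⊔ chIn R i B)
    (m : ℕ) : (w.sd ^ m) x ∈ chIn R i A ⊔ chIn R i B := by
  obtain ⟨y, hy, z, hz, rfl⟩ := Submodule.mem_sup.mp hx
  rw [map_add]
  exact Submodule.add_mem_sup (sd_pow_mem_chIn w hy m) (sd_pow_mem_chIn w hz m)

theorem exists_sd_pow_mem {U' V' B : Set X} (hU : IsOpen U') (hV : IsOpen V')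
    (hB : B ⊆ U' ∪ V') {n : ℕ} {x : Ch X R} (hx : x ∈ chIn R n B) :
    ∃ m, (w.sd ^ m) x ∈ chIn R n (U' ∩ B) ⊔ chIn R n (V' ∩ B) := by
  have key : ∀ s ∈ {s : Σ n : ℕ, Simp X n | s.1 = n ∧ Set.range s.2 ⊆ B},
      ∃ m, (w.sd ^ m) (Finsupp.single s (1 : R)) ∈ chIn R n (U' ∩ B) ⊔ chIn R n (V' ∩ B) := by
    rintro ⟨_, σ⟩ ⟨rfl, hσ⟩
    exact exists_sd_pow_single_mem w hU hV hB σ hσ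
  rw [chIn, Finsupp.supported_eq_span_single] at hx
  induction hx using Submodule.span_induction with
  | mem y hy =>
    obtain ⟨s, hs, rfl⟩ := hy
    exact key s hs
  | zero => exact ⟨0, by simp⟩
  | add y z _ _ hy hz =>
    obtain ⟨m, hm⟩ := hy
    obtain ⟨k, hk⟩ := hz
    refine ⟨m + k, ?_⟩
    rw [map_add]
    refine Submodule.add_mem _ ?_ ?_
    · rw [add_comm, pow_add, Module.End.mul_apply]
      exact sd_pow_mem_sup w hm k
    · rw [pow_add, Module.End.mul_apply]
      exact sd_pow_mem_sup w hk m
  | smul r y _ hy =>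
    obtain ⟨m, hm⟩ := hy
    exact ⟨m, by rw [map_smul]; exact Submodule.smul_mem _ _ hm⟩

/-- Excision. -/
theorem excision {U' V' B : Set X} (hU : IsOpen U') (hV : IsOpen V') (hB : B ⊆ U' ∪ V') {n : ℕ}
    {N : Submodule R (Ch X R)}
    (h : relZ w n (V' ∩ B) (U' ∩ V' ∩ B) ≤ N ⊔ relD w n (V' ∩ B) (U' ∩ V' ∩ B)) :
    relZ w n B (U' ∩ B) ≤ N ⊔ relD w n B (U' ∩ B) := by
  intro x hx
  obtain ⟨m, hm⟩ := exists_sd_pow_mem w hU hV hB hx.1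
  obtain ⟨hz, hd⟩ := sd_pow_relZ w hx m
  -- The part `y` lies in `U'`, so it is a relative boundary for trivial reasons; the part `v` is
  -- then a relative cycle of the smaller pair, to which `h` applies.
  obtain ⟨y, hy, v, hv, e⟩ := Submodule.mem_sup.mp hm
  have hv' : v ∈ relZ w n (V' ∩ B) (U' ∩ V' ∩ B) := by
    refine ⟨hv, ?_⟩
    have h1 : w.bd v ∈ chA R (U' ∩ B) := by
      have : w.bd v = w.bd ((w.sd ^ m) x) - w.bd y := by rw [← e, map_add, add_sub_cancel_left]
      rw [this]
      exact Submodule.sub_mem _ hz.2 (bd_mem_chA w (chIn_le_chA _ _ hy))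
    refine chA_mono ?_ (mem_chA_inter h1 (bd_mem_chA w (chIn_le_chA _ _ hv)))
    rintro z ⟨⟨h1, h2⟩, h3, -⟩
    exact ⟨⟨h1, h3⟩, h2⟩
  rw [← sub_sub_cancel ((w.sd ^ m) x) x, ← e]
  refine Submodule.sub_mem _ (Submodule.add_mem _ ?_ ?_) (Submodule.mem_sup_right (e ▸ hd))
  · exact Submodule.mem_sup_right (Submodule.mem_sup_right hy)
  · refine sup_le_sup_left (relD_mono w n Set.inter_subset_right ?_) N (h hv')
    rintro z ⟨⟨h1, -⟩, h3⟩
    exact ⟨h1, h3⟩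

end Mesh

/-! ### Finite generation modulo a submodule -/

section FGMod

variable {R : Type*} [CommRing R] {M M' : Type*} [AddCommGroup M] [Module R M] [AddCommGroup M']
  [Module R M']

/-- `W` is contained in `N + D` for a finitely generated `N`, and for `N = 0` if `p` holds. -/
def FGMod (p : Prop) (W D : Submodule R M) : Prop :=
  ∃ N : Submodule R M, N.FG ∧ (p → N = ⊥) ∧ W ≤ N ⊔ D

theorem FGMod.mono {p : Prop} {W W' D D' : Submodule R M} (h : FGMod p W D) (hW : W' ≤ W)
    (hD : D ≤ D') : FGMod p W' D' := by
  obtain ⟨N, h1, h2, h3⟩ := h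
  exact ⟨N, h1, h2, hW.trans (h3.trans (sup_le_sup_left hD N))⟩

theorem FGMod.congr {p q : Prop} {W D : Submodule R M} (h : FGMod p W D) (hpq : q → p) :
    FGMod q W D := by
  obtain ⟨N, h1, h2, h3⟩ := h
  exact ⟨N, h1, fun hq => h2 (hpq hq), h3⟩

theorem FGMod.map {p : Prop} {W D : Submodule R M} (h : FGMod p W D) (f : M →ₗ[R] M') :
    FGMod p (W.map f) (D.map f) := by
  obtain ⟨N, h1, h2, h3⟩ := h
  refine ⟨N.map f, h1.map f, fun hp => by rw [h2 hp, Submodule.map_bot], ?_⟩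
  rw [← Submodule.map_sup]
  exact Submodule.map_mono h3

theorem fgMod_of_le {p : Prop} {W D : Submodule R M} (h : W ≤ D) : FGMod p W D :=
  ⟨⊥, Submodule.fg_bot, fun _ => rfl, by simpa using h⟩

theorem exists_fg_lift (f : M →ₗ[R] M') {W : Submodule R M} (h : (W.map f).FG) :
    ∃ N ≤ W, N.FG ∧ N.map f = W.map f := by
  obtain ⟨s, hs⟩ := h
  have h1 : (s : Set M') ⊆ f '' W := by
    have : (s : Set M') ⊆ W.map f := hs ▸ Submodule.subset_span
    exact this
  classical
  obtain ⟨t, ht, hts⟩ := Finset.subset_set_image_iff.mp h1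
  refine ⟨Submodule.span R t, Submodule.span_le.mpr ht, ⟨t, rfl⟩, ?_⟩
  rw [Submodule.map_span, ← Finset.coe_image, hts, hs]

variable [IsNoetherianRing R]

theorem fg_of_le {N N' : Submodule R M} (h : N'.FG) (hN : N ≤ N') : N.FG := by
  have : IsNoetherian R N' := isNoetherian_of_fg_of_noetherian N' h
  have h2 : (N.comap N'.subtype).FG := IsNoetherian.noetherian _
  have h3 := h2.map N'.subtype
  rwa [Submodule.map_comap_subtype, inf_eq_right.mpr hN] at h3

/-- Modulo `D` the map `f` is injective on `W`, so `W / D` embeds in a finitely generated module;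
Noetherianity gives generators, and these can be lifted into `W` itself. When `p` holds the
embedding target vanishes, and no generators are needed. -/
theorem FGMod.exists_le {p : Prop} {W D : Submodule R M} {W' D' : Submodule R M'}
    (h : FGMod p W' D') (f : M →ₗ[R] M') (hW : ∀ x ∈ W, f x ∈ W')
    (hD : ∀ x ∈ W, f x ∈ D' → x ∈ D) :
    ∃ N ≤ W, N.FG ∧ (p → N = ⊥) ∧ W ≤ N ⊔ D := by
  obtain ⟨N, h1, h2, h3⟩ := h
  by_cases hp : p
  · refine ⟨⊥, bot_le, Submodule.fg_bot, fun _ => rfl, fun x hx => ?_⟩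
    rw [h2 hp, bot_sup_eq] at h3
    rw [bot_sup_eq]
    exact hD x hx (h3 (hW x hx))
  · have h4 : (W.map (D'.mkQ ∘ₗ f)).FG := by
      refine fg_of_le (h1.map D'.mkQ) ?_
      rintro _ ⟨x, hx, rfl⟩
      obtain ⟨y, hy, z, hz, e⟩ := Submodule.mem_sup.mp (h3 (hW x hx))
      refine ⟨y, hy, ?_⟩
      rw [LinearMap.comp_apply, ← e, map_add, (Submodule.Quotient.mk_eq_zero D').mpr hz |> 
        (show D'.mkQ z = 0 from ·), add_zero]
    obtain ⟨N', h5, h6, h7⟩ := exists_fg_lift _ h4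
    refine ⟨N', h5, h6, fun hp' => absurd hp' hp, fun x hx => ?_⟩
    obtain ⟨y, hy, e⟩ : (D'.mkQ ∘ₗ f) x ∈ N'.map (D'.mkQ ∘ₗ f) := h7 ▸ ⟨x, hx, rfl⟩
    have : x - y ∈ D := by
      refine hD _ (Submodule.sub_mem _ hx (h5 hy)) ?_
      rw [← Submodule.ker_mkQ D', LinearMap.mem_ker, map_sub, map_sub]
      exact sub_eq_zero.mpr e.symm
    rw [← add_sub_cancel y x]
    exact Submodule.add_mem_sup hy this

theorem FGMod.pull {p : Prop} {W D : Submodule R M} {W' D' : Submodule R M'}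
    (h : FGMod p W' D') (f : M →ₗ[R] M') (hW : ∀ x ∈ W, f x ∈ W')
    (hD : ∀ x ∈ W, f x ∈ D' → x ∈ D) : FGMod p W D := by
  obtain ⟨N, -, h⟩ := h.exists_le f hW hD
  exact ⟨N, h⟩

end FGMod

/-! ### Transfer along embeddings -/

section Embedding

variable {X Y : Type*} [TopologicalSpace X] [TopologicalSpace Y] {R : Type*} [CommRing R]
  (w : LocSys X R)

/-- The map of chains induced by a continuous map. -/
def chMap (f : C(Y, X)) : Ch Y R →ₗ[R] Ch X R :=
  Finsupp.lmapDomain R R fun s => ⟨s.1, f.comp s.2⟩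

theorem chMap_single (f : C(Y, X)) (s : Σ n : ℕ, Simp Y n) (r : R) :
    chMap f (Finsupp.single s r) = Finsupp.single ⟨s.1, f.comp s.2⟩ r := by
  simp [chMap]

theorem bd_chMap (f : C(Y, X)) (x : Ch Y R) : w.bd (chMap f x) = chMap f ((w.comap f).bd x) := by
  induction x using Finsupp.induction_linear with
  | zero => simp
  | add x y hx hy => simp only [map_add, hx, hy]
  | single s r =>
    obtain ⟨n, σ⟩ := s
    rw [chMap_single, w.bd_single, LocSys.bd_single, map_smul]
    congr 1
    cases n with
    | zero => simp [LocSys.bdS]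
    | succ n =>
      simp only [LocSys.bdS, map_sum, chMap_single]
      rfl

theorem exists_comp_eq {f : C(Y, X)} (hf : Topology.IsEmbedding f) {A : Set Y} {n : ℕ}
    {σ : Simp X n} (hσ : Set.range σ ⊆ f '' A) :
    ∃ τ : Simp Y n, Set.range τ ⊆ A ∧ f.comp τ = σ := by
  choose τ hτA hτ using fun x => hσ ⟨x, rfl⟩
  refine ⟨⟨τ, hf.isInducing.continuous_iff.mpr ?_⟩, ?_, ?_⟩
  · rw [show f ∘ τ = σ from funext hτ]
    exact σ.continuous
  · rintro _ ⟨x, rfl⟩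
    exact hτA x
  · ext x
    exact hτ x

theorem map_chIn {f : C(Y, X)} (hf : Topology.IsEmbedding f) (i : ℕ) (A : Set Y) :
    (chIn R i A).map (chMap f) = chIn R i (f '' A) := by
  unfold chIn chMap
  rw [Finsupp.lmapDomain_supported]
  congr 1
  ext ⟨n, σ⟩
  constructor
  · rintro ⟨⟨m, τ⟩, ⟨rfl, hτ⟩, h⟩
    obtain ⟨rfl, h⟩ := Sigma.mk.inj h
    obtain rfl := eq_of_heq h
    refine ⟨rfl, ?_⟩
    rintro _ ⟨x, rfl⟩
    exact ⟨_, hτ ⟨x, rfl⟩, rfl⟩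
  · rintro ⟨rfl, hσ⟩
    obtain ⟨τ, h1, h2⟩ := exists_comp_eq hf hσ
    exact ⟨⟨n, τ⟩, ⟨rfl, h1⟩, congrArg (Sigma.mk n) h2⟩

theorem mem_chA_of_chMap_mem {f : C(Y, X)} (hf : Function.Injective f) {A : Set Y} {x : Ch Y R}
    (h : chMap f x ∈ chA R (f '' A)) : x ∈ chA R A := by
  intro s hs
  have h1 : (⟨s.1, f.comp s.2⟩ : Σ n : ℕ, Simp X n) ∈ (chMap f x).support := by
    rw [Finset.mem_coe, Finsupp.mem_support_iff] at hs
    rw [Finsupp.mem_support_iff]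
    have : Function.Injective fun s : Σ n : ℕ, Simp Y n =>
        (⟨s.1, f.comp s.2⟩ : Σ n : ℕ, Simp X n) := by
      rintro ⟨n, σ⟩ ⟨m, τ⟩ h
      obtain ⟨rfl, h⟩ := Sigma.mk.inj h
      congr 1
      ext x
      exact hf (DFunLike.congr_fun (eq_of_heq h) x)
    change Finsupp.mapDomain _ x _ ≠ 0
    rwa [Finsupp.mapDomain_apply this x s]
  rintro _ ⟨y, rfl⟩
  obtain ⟨a, ha, e⟩ := h h1 ⟨y, rfl⟩
  exact hf e ▸ ha

theorem relZ_image_le {f : C(Y, X)} (hf : Topology.IsEmbedding f) (i : ℕ) (B A : Set Y) :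
    relZ w i (f '' B) (f '' A) ≤ (relZ (w.comap f) i B A).map (chMap f) := by
  rintro x ⟨h1, h2⟩
  rw [← map_chIn hf] at h1
  obtain ⟨y, hy, rfl⟩ := h1
  refine ⟨y, ⟨hy, mem_chA_of_chMap_mem hf.injective ?_⟩, rfl⟩
  rw [← bd_chMap]
  exact h2

theorem map_relD_le {f : C(Y, X)} (hf : Topology.IsEmbedding f) (i : ℕ) (B A : Set Y) :
    (relD (w.comap f) i B A).map (chMap f) ≤ relD w i (f '' B) (f '' A) := by
  unfold relD
  rw [Submodule.map_sup, map_chIn hf]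
  refine sup_le_sup_right ?_ _
  rintro _ ⟨_, ⟨y, hy, rfl⟩, rfl⟩
  rw [← bd_chMap]
  exact ⟨_, map_chIn (R := R) hf (i + 1) B ▸ ⟨y, hy, rfl⟩, rfl⟩

theorem FGMod.image {f : C(Y, X)} (hf : Topology.IsEmbedding f) {p : Prop} {i : ℕ} {B A : Set Y}
    (h : FGMod p (relZ (w.comap f) i B A) (relD (w.comap f) i B A)) :
    FGMod p (relZ w i (f '' B) (f '' A)) (relD w i (f '' B) (f '' A)) :=
  (h.map (chMap f)).mono (relZ_image_le w hf i B A) (map_relD_le w hf i B A)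

end Embedding

/-! ### Euclidean space modulo a punctured Euclidean space -/

section Euclidean

variable {R : Type*} [CommRing R]

/-- The straight-line contraction to `p` preserves `U` and ends inside it. -/
theorem relZ_le_relD_of_starConvex {n : ℕ} (w : LocSys (Fin n → ℝ) R) {U : Set (Fin n → ℝ)}
    {p : Fin n → ℝ} (hp : p ∈ U) (hU : StarConvex ℝ p U) (i : ℕ) :
    relZ w i Set.univ U ≤ relD w i Set.univ U := by
  let H : C((Fin n → ℝ) × unitInterval, Fin n → ℝ) :=
    ⟨fun q => (q.2 : ℝ) • p + (1 - (q.2 : ℝ)) • q.1, by fun_prop⟩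
  refine relZ_le_relD_of_deformation w (H := H) (fun x => ?_) (fun x hx t => ?_)
    (fun x _ t => Set.mem_univ _) fun x _ => ?_
  · simp [H]
  · exact hU hx t.2.1 (by linarith [t.2.2]) (by ring)
  · simpa [H] using hp

/-- The half of punctured space in which the first coordinate times `ε` is positive or the other
coordinates do not vanish. -/
def halfPunctured (n : ℕ) (ε : ℝ) : Set (Fin (n + 1) → ℝ) := {x | 0 < ε * x 0 ∨ Fin.tail x ≠ 0}

theorem continuous_tail (n : ℕ) : Continuous (Fin.tail : (Fin (n + 1) → ℝ) → Fin n → ℝ) :=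
  continuous_pi fun i => continuous_apply i.succ

theorem isOpen_halfPunctured (n : ℕ) (ε : ℝ) : IsOpen (halfPunctured n ε) :=
  (isOpen_lt continuous_const (continuous_const.mul (continuous_apply 0))).union
    ((isOpen_compl_singleton (x := (0 : Fin n → ℝ))).preimage (continuous_tail n))

/-- The set is star-shaped about the point `ε` on the first axis. -/
theorem relZ_halfPunctured (n : ℕ) {ε : ℝ} (hε : ε ≠ 0) (w : LocSys (Fin (n + 1) → ℝ) R) (i : ℕ) :
    relZ w i Set.univ (halfPunctured n ε) ≤ relD w i Set.univ (halfPunctured n ε) := by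
  have hε2 : 0 < ε * ε := mul_self_pos.mpr hε
  refine relZ_le_relD_of_starConvex w (p := Fin.cons ε 0) (Or.inl (by simpa using hε2)) ?_ i
  intro x hx a b ha hb hab
  rcases hx with hx | hx
  · left
    simp only [Pi.add_apply, Pi.smul_apply, Fin.cons_zero, smul_eq_mul, mul_add]
    rcases ha.eq_or_lt with rfl | ha
    · obtain rfl : b = 1 := by linarith
      simpa using hx
    · nlinarith [mul_pos ha hε2, mul_nonneg hb hx.le]
  · rcases hb.eq_or_lt with rfl | hb
    · left
      obtain rfl : a = 1 := by linarith
      simpa using hε2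
    · right
      have : Fin.tail (a • (Fin.cons ε 0 : Fin (n + 1) → ℝ) + b • x) = b • Fin.tail x := by
        funext j
        simp [Fin.tail]
      rw [this]
      exact smul_ne_zero hb.ne' hx

/-- The inclusion of a hyperplane. -/
def hyperplane (n : ℕ) : C(Fin n → ℝ, Fin (n + 1) → ℝ) where
  toFun x := Fin.cons 0 x
  continuous_toFun := continuous_pi fun i => by
    refine Fin.cases ?_ (fun i => ?_) i
    · simpa using continuous_const
    · simpa using continuous_apply i

theorem isEmbedding_hyperplane (n : ℕ) : Topology.IsEmbedding (hyperplane n) := by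
  refine Topology.IsEmbedding.of_leftInverse (f := Fin.tail) ?_ (continuous_tail n)
    (hyperplane n).continuous
  intro x
  exact Fin.tail_cons _ _

variable [IsNoetherianRing R]

/-- Induction on the dimension. Punctured space is the union of two open half-punctured spaces, each
acyclic relative to the whole space, which meet in the complement of the first axis. Degree `j + 1`
of the pair `(ℝ^(n+1), {0}ᶜ)` injects by the boundary into degree `j` of `{0}ᶜ` relative to one
half. By excision the latter is controlled by the other half relative to the intersection, which
injects into the whole space relative to the intersection, and this deforms onto the pair for `ℝ^n`.
Injections suffice, as `FGMod` pulls back along them over a Noetherian ring. -/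
theorem fgMod_punctured (n : ℕ) (w : LocSys (Fin n → ℝ) R) (i : ℕ) :
    FGMod (i < n) (relZ w i Set.univ {0}ᶜ) (relD w i Set.univ {0}ᶜ) := by
  induction n generalizing i with
  | zero =>
    -- A one-point space has a single singular simplex in each degree, so all chains together are
    -- finitely generated, and the vanishing clause is void.
    refine ⟨chIn R i Set.univ, ?_, fun h => absurd h (Nat.not_lt_zero i), ?_⟩
    · rw [chIn, Finsupp.supported_eq_span_single]
      refine Submodule.fg_span (Set.Finite.image _ (Set.Subsingleton.finite ?_))
      rintro ⟨n, σ⟩ ⟨rfl, -⟩ ⟨m, τ⟩ ⟨h, -⟩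
      obtain rfl : m = n := h
      congr 1
      ext x j
      exact j.elim0
    · exact inf_le_left.trans le_sup_left
  | succ n ih =>
    have hsub : ∀ ε : ℝ, halfPunctured n ε ⊆ {0}ᶜ := by
      rintro ε x hx rfl
      rcases hx with hx | hx
      · simp at hx
      · exact hx rfl
    cases i with
    | zero =>
      refine fgMod_of_le fun x hx => ?_
      have h1 : x ∈ relZ w 0 Set.univ (halfPunctured n 1) := by
        refine (mem_relZ w).mpr ⟨hx.1, ?_⟩
        rw [bd_zero_degree w hx.1]
        exact zero_mem _
      exact relD_mono w 0 subset_rfl (hsub 1) (relZ_halfPunctured n one_ne_zero w 0 h1)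
    | succ j =>
      have hcov : ({0}ᶜ : Set (Fin (n + 1) → ℝ)) ⊆ halfPunctured n 1 ∪ halfPunctured n (-1) := by
        intro x hx
        by_cases ht : Fin.tail x = 0
        · have h0 : x 0 ≠ 0 := by
            intro h0
            refine hx (funext fun j => ?_)
            refine Fin.cases h0 (fun j => ?_) j
            exact congrFun ht j
          rcases h0.lt_or_gt with h | h
          · exact Or.inr (Or.inl (by linarith))
          · exact Or.inl (Or.inl (by linarith))
        · exact Or.inl (Or.inr ht)
      have hint : halfPunctured n 1 ∩ halfPunctured n (-1) = {x | Fin.tail x ≠ 0} := by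
        ext x
        constructor
        · rintro ⟨h1 | h1, h2 | h2⟩
          · exact absurd h2 (by linarith)
          · exact h2
          · exact h1
          · exact h1
        · exact fun h => ⟨Or.inr h, Or.inr h⟩
      have s1 : FGMod (j < n) (relZ w j Set.univ {x | Fin.tail x ≠ 0})
          (relD w j Set.univ {x | Fin.tail x ≠ 0}) := by
        -- Shrinking the first coordinate to zero deforms the pair onto the hyperplane and its
        -- punctured version.
        let H : C((Fin (n + 1) → ℝ) × unitInterval, Fin (n + 1) → ℝ) :=
          ⟨fun q => Fin.cons ((1 - (q.2 : ℝ)) * q.1 0) (Fin.tail q.1), continuous_pi fun i => by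
            refine Fin.cases ?_ (fun i => ?_) i
            · simp only [Fin.cons_zero]
              fun_prop
            · simp only [Fin.cons_succ, Fin.tail]
              fun_prop⟩
        have h1 := exists_deformation w (H := H) (A := {x | Fin.tail x ≠ 0}) (B := Set.univ)
          (A' := hyperplane n '' {0}ᶜ) (B' := hyperplane n '' Set.univ) (i := j)
          (fun x => by
            change (Fin.cons ((1 - (0 : ℝ)) * x 0) (Fin.tail x) : Fin (n + 1) → ℝ) = x
            rw [sub_zero, one_mul, Fin.cons_self_tail])
          (fun x hx t => hx) (fun x _ t => trivial)
          (fun x hx => ⟨Fin.tail x, hx, by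
            change _ = (Fin.cons ((1 - (1 : ℝ)) * x 0) (Fin.tail x) : Fin (n + 1) → ℝ)
            rw [sub_self, zero_mul]
            rfl⟩)
          (fun x hx => ⟨Fin.tail x, trivial, by
            change _ = (Fin.cons ((1 - (1 : ℝ)) * x 0) (Fin.tail x) : Fin (n + 1) → ℝ)
            rw [sub_self, zero_mul]
            rfl⟩)
        obtain ⟨N, hN, hp, hle⟩ :=
          FGMod.image w (isEmbedding_hyperplane n) (ih (w.comap (hyperplane n)) j)
        refine ⟨N, hN, hp, h1.trans (sup_le (hle.trans (sup_le_sup_left ?_ N)) le_sup_right)⟩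
        refine relD_mono w j (Set.subset_univ _) ?_
        rintro _ ⟨x, hx, rfl⟩
        exact hx
      have s2 : FGMod (j < n) (relZ w j (halfPunctured n (-1)) {x | Fin.tail x ≠ 0})
          (relD w j (halfPunctured n (-1)) {x | Fin.tail x ≠ 0}) := by
        refine s1.pull LinearMap.id
          (fun x hx => relZ_mono w j (Set.subset_univ _) subset_rfl hx) fun x hx h => ?_
        obtain ⟨_, ⟨y, hy, rfl⟩, v, hv, e⟩ := Submodule.mem_sup.mp h
        have hy' : y ∈ relZ w (j + 1) Set.univ (halfPunctured n (-1)) := by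
          refine (mem_relZ w).mpr ⟨hy, ?_⟩
          have : w.bd y = x - v := eq_sub_of_add_eq e
          rw [this]
          exact Submodule.sub_mem _ (chIn_le_chA _ _ hx.1)
            (chA_mono (fun x hx => Or.inr hx) (chIn_le_chA _ _ hv))
        obtain ⟨_, ⟨z, hz, rfl⟩, z', hz', rfl⟩ :=
          Submodule.mem_sup.mp (relZ_halfPunctured n (by norm_num) w (j + 1) hy')
        rw [map_add, w.bd_bd, zero_add] at e
        rw [show x = w.bd z' + v from e.symm]
        exact Submodule.add_mem_sup ⟨z', hz', rfl⟩ hv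
      have s3 : FGMod (j < n) (relZ w j {0}ᶜ (halfPunctured n 1))
          (relD w j {0}ᶜ (halfPunctured n 1)) := by
        obtain ⟨N, hN, hp, hle⟩ := s2
        have h1 := excision w (isOpen_halfPunctured n 1) (isOpen_halfPunctured n (-1)) hcov
          (n := j) (N := N)
        have hint' : {x : Fin (n + 1) → ℝ | Fin.tail x ≠ 0} ∩ {0}ᶜ = {x | Fin.tail x ≠ 0} :=
          Set.inter_eq_left.mpr fun x hx => hsub 1 (Or.inr hx)
        rw [hint, Set.inter_eq_left.mpr (hsub 1), Set.inter_eq_left.mpr (hsub (-1)),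
          hint'] at h1
        exact ⟨N, hN, hp, h1 hle⟩
      refine (s3.congr (fun h : j + 1 < n + 1 => by omega)).pull w.bd (fun x hx => ?_)
        fun x hx h => ?_
      · refine (mem_relZ w).mpr ⟨mem_chIn_of_mem_chA (bd_mem w hx.1) hx.2, ?_⟩
        rw [w.bd_bd]
        exact zero_mem _
      · obtain ⟨_, ⟨y, hy, rfl⟩, v, hv, e⟩ := Submodule.mem_sup.mp h
        have h1 : x - y ∈ relZ w (j + 1) Set.univ (halfPunctured n 1) := by
          refine (mem_relZ w).mpr
            ⟨Submodule.sub_mem _ hx.1 (chIn_mono _ (Set.subset_univ _) hy), ?_⟩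
          rw [map_sub, ← e, add_sub_cancel_left]
          exact chIn_le_chA _ _ hv
        have h2 := relD_mono w (j + 1) subset_rfl (hsub 1)
          (relZ_halfPunctured n one_ne_zero w (j + 1) h1)
        rw [← sub_add_cancel x y]
        exact Submodule.add_mem _ h2 (Submodule.mem_sup_right hy)

end Euclidean

/-! ### Attaching a cell -/

section Attach

variable {X : Type*} [TopologicalSpace X] {n : ℕ}

/-- The radial deformation of a punctured ball onto the sphere. -/
def radial (t : ℝ) (y : Fin n → ℝ) : Fin n → ℝ := ((1 - t) + t * ‖y‖⁻¹) • y

theorem radial_zero (y : Fin n → ℝ) : radial 0 y = y := by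
  simp [radial]

theorem radial_of_norm (t : ℝ) {y : Fin n → ℝ} (hy : ‖y‖ = 1) : radial t y = y := by
  simp [radial, hy]

theorem norm_radial {t : ℝ} (ht : t ∈ Set.Icc (0 : ℝ) 1) {y : Fin n → ℝ} (hy : y ≠ 0) :
    ‖radial t y‖ = (1 - t) * ‖y‖ + t := by
  have h : 0 < ‖y‖ := norm_pos_iff.mpr hy
  have h1 : 0 ≤ 1 - t := by linarith [ht.2]
  have h2 : 0 ≤ t * ‖y‖⁻¹ := mul_nonneg ht.1 (inv_nonneg.mpr h.le)
  rw [radial, norm_smul, Real.norm_of_nonneg (by linarith)]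
  field_simp

variable {φ : PartialEquiv (Fin n → ℝ) X} {A : Set X}

open Classical in
/-- The deformation onto `A` of the complement of the centre of a cell attached to `A`. -/
def cellRetract (φ : PartialEquiv (Fin n → ℝ) X) (A : Set X) (p : X × unitInterval) : X :=
  if p.1 ∈ A then p.1 else φ (radial p.2 (φ.symm p.1))

section

variable (hs : φ.source = Metric.ball 0 1) (hfr : φ '' Metric.sphere 0 1 ⊆ A)
  (hdis : Disjoint (φ '' Metric.ball 0 1) A)

include hs hfr hdis

-- On the open ball `φ.symm` inverts `φ`; on the sphere the value lies in `A`, and the radial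
-- deformation fixes the point anyway. The two branches of the definition therefore agree with one
-- formula on the closed ball.
omit [TopologicalSpace X] in
theorem cellRetract_image {y : Fin n → ℝ} (hy : ‖y‖ ≤ 1) (t : unitInterval) :
    cellRetract φ A (φ y, t) = φ (radial t y) := by
  unfold cellRetract
  rcases hy.lt_or_eq with h | h
  · have h1 : y ∈ Metric.ball (0 : Fin n → ℝ) 1 := by simpa using h
    rw [if_neg (Set.disjoint_left.mp hdis ⟨y, h1, rfl⟩)]
    change φ (radial t (φ.symm (φ y))) = _
    rw [φ.left_inv (hs ▸ h1)]
  · rw [if_pos (hfr ⟨y, by simpa using h, rfl⟩), radial_of_norm _ h]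

variable [T2Space X] (hc : ContinuousOn φ (Metric.closedBall 0 1))

include hc

/-- The map `φ × id` on the compact closed ball times the interval is closed, and remains closed
over the complement of the centre. Continuity can thus be tested after composing with it, where the
retraction becomes the radial formula. -/
theorem continuousOn_cellRetract :
    ContinuousOn (fun p : {p : X × unitInterval | p.1 ≠ φ 0} => cellRetract φ A p)
      {p | p.1.1 ∈ φ '' Metric.closedBall 0 1} := by
  let K := Metric.closedBall (0 : Fin n → ℝ) 1
  have : CompactSpace K := isCompact_iff_compactSpace.mp (isCompact_closedBall 0 1)
  let Q : K × unitInterval → X × unitInterval := fun z => (φ z.1, z.2)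
  have hφ : Continuous fun y : K => φ y := hc.domRestrict
  have hQ : Continuous Q := (hφ.comp continuous_fst).prodMk continuous_snd
  let S : Set (X × unitInterval) := {p | p.1 ≠ φ 0}
  have hQS : IsClosedMap (S.restrictPreimage Q) := hQ.isClosedMap.restrictPreimage S
  have hne : ∀ z : Q ⁻¹' S, (z.1.1 : Fin n → ℝ) ≠ 0 := by
    intro z h
    refine z.2 ?_
    change φ z.1.1 = φ 0
    rw [h]
  let g : Q ⁻¹' S → X := fun z => φ (radial z.1.2 z.1.1)
  have hle : ∀ z : Q ⁻¹' S, ‖(z.1.1 : Fin n → ℝ)‖ ≤ 1 := fun z =>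
    mem_closedBall_zero_iff.mp z.1.1.2
  have hg : Continuous g := by
    refine hc.comp_continuous ?_ fun z => ?_
    · have h1 : Continuous fun z : Q ⁻¹' S => (z.1.1 : Fin n → ℝ) := by fun_prop
      have h2 : Continuous fun z : Q ⁻¹' S => (z.1.2 : ℝ) := by fun_prop
      have h3 : Continuous fun z : Q ⁻¹' S => ‖(z.1.1 : Fin n → ℝ)‖⁻¹ :=
        h1.norm.inv₀ fun z => norm_ne_zero_iff.mpr (hne z)
      exact ((continuous_const.sub h2).add (h2.mul h3)).smul h1
    · rw [mem_closedBall_zero_iff, norm_radial z.1.2.2 (hne z)]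
      have h1 := z.1.2.2.1
      have h2 := z.1.2.2.2
      nlinarith [hle z]
  rw [continuousOn_iff_isClosed]
  intro F hF
  refine ⟨S.restrictPreimage Q '' (g ⁻¹' F), hQS _ (hF.preimage hg), ?_⟩
  ext p
  constructor
  · rintro ⟨h1, h2⟩
    refine ⟨?_, h2⟩
    obtain ⟨y, hy, e⟩ := h2
    have hz : Q (⟨y, hy⟩, p.1.2) = p.1 := Prod.ext e rfl
    refine ⟨⟨(⟨y, hy⟩, p.1.2), show Q _ ∈ S from hz ▸ p.2⟩, ?_, Subtype.ext hz⟩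
    change φ (radial p.1.2 y) ∈ F
    rw [← cellRetract_image hs hfr hdis (by simpa using hy)]
    have : cellRetract φ A p.1 ∈ F := h1
    rw [← hz] at this
    exact this
  · rintro ⟨⟨z, hz, rfl⟩, h2⟩
    refine ⟨?_, h2⟩
    change cellRetract φ A (φ z.1.1, z.1.2) ∈ F
    rw [cellRetract_image hs hfr hdis (hle z)]
    exact hz

variable (hA : IsClosed A)

include hA

/-- The identity on `A` and the radial deformation on the closed cell are continuous on two closed
sets covering the space, hence glue. The norm formula keeps the deformation away from the centre and
brings it to the sphere at time `1`. -/
theorem exists_cell_deformation : ∃ H : C(↥((A ∪ φ '' Metric.closedBall 0 1) \ {φ 0}) × unitInterval,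
      ↥((A ∪ φ '' Metric.closedBall 0 1) \ {φ 0})),
    (∀ x, H (x, 0) = x) ∧ (∀ x : ↥((A ∪ φ '' Metric.closedBall 0 1) \ {φ 0}), x.1 ∈ A →
      ∀ t, (H (x, t)).1 ∈ A) ∧ ∀ x, (H (x, 1)).1 ∈ A := by
  have h0 : φ 0 ∉ A := Set.disjoint_left.mp hdis ⟨0, by simp, rfl⟩
  have hmem : ∀ x : ↥((A ∪ φ '' Metric.closedBall 0 1) \ {φ 0}), ∀ t : unitInterval,
      cellRetract φ A (x, t) ∈ (A ∪ φ '' Metric.closedBall 0 1) \ {φ 0} := by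
    rintro ⟨x, hx | ⟨y, hy, rfl⟩, hx0⟩ t
    · have : cellRetract φ A (x, t) = x := if_pos hx
      rw [this]
      exact ⟨Or.inl hx, hx0⟩
    · have hy1 : ‖y‖ ≤ 1 := by simpa using hy
      have hy0 : y ≠ 0 := fun h => hx0 (by rw [h]; rfl)
      rw [cellRetract_image hs hfr hdis hy1]
      have hn := norm_radial t.2 hy0
      have hp := norm_pos_iff.mpr hy0
      have hn1 : ‖radial t y‖ ≤ 1 := by
        have h1 := t.2.1
        have h2 := t.2.2
        rw [hn]
        nlinarith
      refine ⟨Or.inr ⟨_, by simpa using hn1, rfl⟩, fun h => ?_⟩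
      rcases hn1.lt_or_eq with h1 | h1
      · have h2 := φ.injOn (hs ▸ (by simpa using h1) : radial (t : ℝ) y ∈ φ.source)
          (hs ▸ (by simp) : (0 : Fin n → ℝ) ∈ φ.source) h
        rw [h2, norm_zero] at hn
        have h1 := t.2.1
        have h2 := t.2.2
        nlinarith
      · have : φ (radial t y) ∈ A := hfr ⟨_, by simpa using h1, rfl⟩
        rw [h] at this
        exact h0 this
  have hcont : Continuous fun p : ↥((A ∪ φ '' Metric.closedBall 0 1) \ {φ 0}) × unitInterval =>
      cellRetract φ A (p.1.1, p.2) := by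
    let ι : ↥((A ∪ φ '' Metric.closedBall 0 1) \ {φ 0}) × unitInterval →
        {p : X × unitInterval | p.1 ≠ φ 0} := fun p => ⟨(p.1.1, p.2), p.1.2.2⟩
    have hι : Continuous ι := by fun_prop
    have hcl : IsClosed (φ '' Metric.closedBall 0 1) :=
      ((isCompact_closedBall 0 1).image_of_continuousOn hc).isClosed
    have hval : Continuous fun p : ↥((A ∪ φ '' Metric.closedBall 0 1) \ {φ 0}) × unitInterval =>
        p.1.1 := by fun_prop
    have h1 : ContinuousOn (fun p : ↥((A ∪ φ '' Metric.closedBall 0 1) \ {φ 0}) × unitInterval =>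
        cellRetract φ A (p.1.1, p.2)) {p | p.1.1 ∈ A} :=
      hval.continuousOn.congr fun p hp => if_pos hp
    have h2 : ContinuousOn (fun p : ↥((A ∪ φ '' Metric.closedBall 0 1) \ {φ 0}) × unitInterval =>
        cellRetract φ A (p.1.1, p.2)) {p | p.1.1 ∈ φ '' Metric.closedBall 0 1} :=
      (continuousOn_cellRetract hs hfr hdis hc).comp hι.continuousOn fun p hp => hp
    rw [← continuousOn_univ]
    refine (h1.union_of_isClosed h2 (hA.preimage hval) (hcl.preimage hval)).mono ?_
    exact fun p _ => p.1.2.1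
  refine ⟨⟨fun p => ⟨_, hmem p.1 p.2⟩, hcont.subtype_mk _⟩, fun x => Subtype.ext ?_, fun x hx t => ?_,
    fun x => ?_⟩
  · change cellRetract φ A (x.1, 0) = x.1
    rcases x.2.1 with hx | ⟨y, hy, e⟩
    · exact if_pos hx
    · rw [← e, cellRetract_image hs hfr hdis (by simpa using hy)]
      change φ (radial (0 : ℝ) y) = _
      rw [radial_zero]
  · change cellRetract φ A (x.1, t) ∈ A
    rw [cellRetract, if_pos hx]
    exact hx
  · change cellRetract φ A (x.1, 1) ∈ A
    rcases x.2.1 with hx | ⟨y, hy, e⟩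
    · rw [cellRetract, if_pos hx]
      exact hx
    · have hy0 : y ≠ 0 := fun h => x.2.2 (by rw [← e, h]; rfl)
      rw [← e, cellRetract_image hs hfr hdis (by simpa using hy)]
      refine hfr ⟨_, ?_, rfl⟩
      rw [mem_sphere_zero_iff_norm]
      change ‖radial (1 : ℝ) y‖ = 1
      rw [norm_radial (t := 1) (by simp) hy0]
      simp

end

/-- The open unit ball is homeomorphic to Euclidean space with the centre going to the origin, which
turns an open cell modulo its punctured part into the pair treated in `fgMod_punctured`. -/
theorem exists_cell_embedding (hs : φ.source = Metric.ball 0 1)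
    (hc : ContinuousOn φ (Metric.closedBall 0 1)) (hcs : ContinuousOn φ.symm φ.target) :
    ∃ f : C(Fin n → ℝ, X), Topology.IsEmbedding f ∧ f '' Set.univ = φ '' Metric.ball 0 1 ∧
      f '' {0}ᶜ = φ '' Metric.ball 0 1 \ {φ 0} := by
  let b : OpenPartialHomeomorph (Fin n → ℝ) (Fin n → ℝ) := OpenPartialHomeomorph.univUnitBall
  have hbs : b.source = Set.univ := rfl
  have hbt : b.target = Metric.ball 0 1 := rfl
  have hb : ∀ x, b x ∈ Metric.ball (0 : Fin n → ℝ) 1 := fun x => hbt ▸ b.map_source (hbs ▸ trivial)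
  have hb0 : b 0 = 0 := OpenPartialHomeomorph.univUnitBall_apply_zero
  have hbc : Continuous b := by
    rw [← continuousOn_univ, ← hbs]
    exact b.continuousOn
  let f : C(Fin n → ℝ, X) := ⟨fun x => φ (b x),
    hc.comp_continuous hbc fun x => Metric.ball_subset_closedBall (hb x)⟩
  have htar : φ.target = φ '' Metric.ball 0 1 := by rw [← hs, φ.image_source_eq_target]
  have hf : Topology.IsEmbedding f := by
    let g : (Fin n → ℝ) → φ.target := fun x => ⟨f x, htar ▸ ⟨b x, hb x, rfl⟩⟩
    have hg : Topology.IsEmbedding g := by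
      have hgc : Continuous g := f.continuous.subtype_mk _
      refine Topology.IsEmbedding.of_leftInverse (f := fun v : φ.target => b.symm (φ.symm v))
        ?_ ?_ hgc
      · intro x
        change b.symm (φ.symm (φ (b x))) = x
        rw [φ.left_inv (hs ▸ hb x), b.left_inv (hbs ▸ trivial)]
      · refine b.symm.continuousOn.comp_continuous hcs.domRestrict fun v => ?_
        rw [OpenPartialHomeomorph.symm_source, hbt, ← hs]
        exact φ.map_target v.2
    exact Topology.IsEmbedding.subtypeVal.comp hg
  have hsurj : ∀ y ∈ Metric.ball (0 : Fin n → ℝ) 1, b (b.symm y) = y := fun y hy =>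
    b.right_inv (hbt ▸ hy)
  refine ⟨f, hf, ?_, ?_⟩
  · ext x
    constructor
    · rintro ⟨y, -, rfl⟩
      exact ⟨b y, hb y, rfl⟩
    · rintro ⟨y, hy, rfl⟩
      exact ⟨b.symm y, trivial, congrArg φ (hsurj y hy)⟩
  · have hf0 : f 0 = φ 0 := congrArg φ hb0
    ext x
    constructor
    · rintro ⟨y, hy, rfl⟩
      refine ⟨⟨b y, hb y, rfl⟩, fun h => hy ?_⟩
      exact hf.injective (h.trans hf0.symm)
    · rintro ⟨⟨y, hy, rfl⟩, hx⟩
      refine ⟨b.symm y, fun h => hx ?_, congrArg φ (hsurj y hy)⟩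
      rw [← hsurj y hy, show b.symm y = 0 from h, hb0]
      rfl

variable {R : Type*} [CommRing R] [IsNoetherianRing R]

/-- The homology of a space obtained by attaching a cell, relative to the original space. -/
theorem fgMod_attach [T2Space X] (w : LocSys X R) (hs : φ.source = Metric.ball 0 1)
    (hfr : φ '' Metric.sphere 0 1 ⊆ A) (hdis : Disjoint (φ '' Metric.ball 0 1) A)
    (hc : ContinuousOn φ (Metric.closedBall 0 1)) (hcs : ContinuousOn φ.symm φ.target)
    (hA : IsClosed A) (i : ℕ) :
    FGMod (i < n) (relZ w i (A ∪ φ '' Metric.closedBall 0 1) A)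
      (relD w i (A ∪ φ '' Metric.closedBall 0 1) A) := by
  set B := A ∪ φ '' Metric.closedBall 0 1 with hB
  have h0 : φ 0 ∉ A := Set.disjoint_left.mp hdis ⟨0, by simp, rfl⟩
  have hret : relZ w i (B \ {φ 0}) A ≤ relD w i (B \ {φ 0}) A := by
    obtain ⟨H, hH0, hHA, hH1⟩ := exists_cell_deformation hs hfr hdis hc hA
    let ι : C(↥(B \ {φ 0}), X) := ⟨Subtype.val, continuous_subtype_val⟩
    have hι : Topology.IsEmbedding ι := Topology.IsEmbedding.subtypeVal
    have h1 := relZ_le_relD_of_deformation (w.comap ι) hH0 (A := ι ⁻¹' A) (B := Set.univ)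
      hHA (fun x _ t => Set.mem_univ _) (fun x _ => hH1 x) (i := i)
    have e1 : ι '' Set.univ = B \ {φ 0} := by
      rw [Set.image_univ]
      exact Subtype.range_coe
    have e2 : ι '' (ι ⁻¹' A) = A := by
      refine (Subtype.image_preimage_coe _ _).trans (Set.inter_eq_right.mpr fun x hx => ⟨Or.inl hx, ?_⟩)
      rintro rfl
      exact h0 hx
    have h2 := (relZ_image_le w hι i Set.univ (ι ⁻¹' A)).trans
      ((Submodule.map_mono h1).trans (map_relD_le w hι i Set.univ (ι ⁻¹' A)))
    rwa [e1, e2] at h2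
  have hcell : FGMod (i < n) (relZ w i (φ '' Metric.ball 0 1) (φ '' Metric.ball 0 1 \ {φ 0}))
      (relD w i (φ '' Metric.ball 0 1) (φ '' Metric.ball 0 1 \ {φ 0})) := by
    obtain ⟨f, hf, e1, e2⟩ := exists_cell_embedding hs hc hcs
    have := FGMod.image w hf (fgMod_punctured n (w.comap f) i)
    rwa [e1, e2] at this
  have hVB : Aᶜ ∩ B = φ '' Metric.ball 0 1 := by
    ext x
    constructor
    · rintro ⟨h1, h2 | ⟨y, hy, rfl⟩⟩
      · exact absurd h2 h1
      · rw [← Metric.ball_union_sphere] at hy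
        rcases hy with hy | hy
        · exact ⟨y, hy, rfl⟩
        · exact absurd (hfr ⟨y, hy, rfl⟩) h1
    · rintro ⟨y, hy, rfl⟩
      exact ⟨Set.disjoint_left.mp hdis ⟨y, hy, rfl⟩,
        Or.inr ⟨y, Metric.ball_subset_closedBall hy, rfl⟩⟩
  have hUVB : {φ 0}ᶜ ∩ Aᶜ ∩ B = φ '' Metric.ball 0 1 \ {φ 0} := by
    rw [Set.inter_assoc, hVB, Set.inter_comm]
    rfl
  have hUB : {φ 0}ᶜ ∩ B = B \ {φ 0} := by
    rw [Set.inter_comm]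
    rfl
  have hex : FGMod (i < n) (relZ w i B (B \ {φ 0})) (relD w i B (B \ {φ 0})) := by
    obtain ⟨N, hN, hp, hle⟩ := hcell
    have h1 := excision w (U' := {φ 0}ᶜ) (V' := Aᶜ) (B := B) (n := i) (N := N)
      isOpen_compl_singleton hA.isOpen_compl (fun x _ => by
        by_cases hx : x ∈ A
        · left
          rintro rfl
          exact h0 hx
        · exact Or.inr hx)
    rw [hVB, hUVB, hUB] at h1
    exact ⟨N, hN, hp, h1 hle⟩
  have hAU : A ⊆ B \ {φ 0} := fun x hx => ⟨Or.inl hx, by rintro rfl; exact h0 hx⟩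
  -- Relative cycles of `(B, A)` are compared with those of `(B, B \ {φ 0})`: the comparison is
  -- injective because `B \ {φ 0}` has no homology relative to `A`.
  refine hex.pull LinearMap.id (fun x hx => relZ_mono w i subset_rfl hAU hx) fun x hx h => ?_
  obtain ⟨_, ⟨y, hy, rfl⟩, v, hv, e⟩ := Submodule.mem_sup.mp h
  have hv' : v ∈ relZ w i (B \ {φ 0}) A := by
    refine (mem_relZ w).mpr ⟨hv, ?_⟩
    have : w.bd v = w.bd x := by
      rw [show x = w.bd y + v from e.symm, map_add, w.bd_bd, zero_add]
    rw [this]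
    exact hx.2
  rw [show x = w.bd y + v from e.symm]
  exact Submodule.add_mem _ (Submodule.mem_sup_left ⟨y, hy, rfl⟩)
    (relD_mono w i Set.sdiff_subset subset_rfl (hret hv'))

end Attach

/-! ### Homology of CW complexes -/

section Transitivity

variable {X : Type*} [TopologicalSpace X] {R : Type*} [CommRing R] (w : LocSys X R)

theorem chIn_empty (i : ℕ) : chIn R i (∅ : Set X) = ⊥ := by
  rw [chIn, eq_bot_iff]
  intro x hx
  have : x.support = ∅ := by
    refine Finset.eq_empty_of_forall_notMem fun s hs => ?_
    exact (hx hs).2 ⟨stdSimplex.vertex 0, rfl⟩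
  exact (Submodule.mem_bot R).mpr (Finsupp.support_eq_empty.mp this)

/-- The exact sequence of a triple. Choosing the generators for `(B, A)` among relative cycles of
`(B, A')` keeps the remainder `c` a relative cycle of `(A, A')`. -/
theorem FGMod.trans [IsNoetherianRing R] {p : Prop} {i : ℕ} {B A A' : Set X} (hBA : A ⊆ B)
    (hA : A' ⊆ A) (h : FGMod p (relZ w i B A) (relD w i B A))
    (h' : FGMod p (relZ w i A A') (relD w i A A')) :
    FGMod p (relZ w i B A') (relD w i B A') := by
  obtain ⟨N, hN, hfg, hp, hle⟩ := h.exists_le LinearMap.id (W := relZ w i B A')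
    (D := relD w i B A) (fun x hx => relZ_mono w i subset_rfl hA hx) fun x _ hx => hx
  obtain ⟨N', hfg', hp', hle'⟩ := h'
  refine ⟨N ⊔ N', hfg.sup hfg', fun h => by rw [hp h, hp' h, sup_bot_eq], fun x hx => ?_⟩
  obtain ⟨n, hn, d, hd, rfl⟩ := Submodule.mem_sup.mp (hle hx)
  obtain ⟨b, hb, c, hc, rfl⟩ := Submodule.mem_sup.mp hd
  obtain ⟨y, hy, rfl⟩ := hb
  have hc' : c ∈ relZ w i A A' := by
    refine ⟨hc, ?_⟩
    have h1 : w.bd (n + (w.bd y + c)) ∈ chA R A' := hx.2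
    rw [map_add, map_add, w.bd_bd, zero_add] at h1
    have h2 : w.bd n ∈ chA R A' := (hN hn).2
    simpa using Submodule.sub_mem _ h1 h2
  have h3 := sup_le_sup_left (relD_mono w i hBA subset_rfl) N' (hle' hc')
  rw [sup_assoc]
  refine Submodule.add_mem_sup hn (Submodule.add_mem _ ?_ h3)
  exact Submodule.mem_sup_right (Submodule.mem_sup_left ⟨y, hy, rfl⟩)

end Transitivity

/-! ### Finite subcomplexes and finite generation by induction over cells. -/

section Cells

open Topology

variable {X : Type*} [TopologicalSpace X] [CWComplex (Set.univ : Set X)]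

variable (X) in
/-- The cells of a CW complex. -/
abbrev Cell : Type _ := Σ n, RelCWComplex.cell (Set.univ : Set X) n

/-- The closed cell. -/
abbrev Cell.closed (e : Cell X) : Set X := RelCWComplex.closedCell (C := (Set.univ : Set X)) e.1 e.2

/-- The open cell. -/
abbrev Cell.opn (e : Cell X) : Set X := RelCWComplex.openCell (C := (Set.univ : Set X)) e.1 e.2

/-- The frontier of a cell. -/
abbrev Cell.frontier (e : Cell X) : Set X :=
  RelCWComplex.cellFrontier (C := (Set.univ : Set X)) e.1 e.2

/-- The union of the closed cells in a finite set. -/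
def cellUnion (s : Finset (Cell X)) : Set X := ⋃ e ∈ s, e.closed

theorem mem_cellUnion {s : Finset (Cell X)} {x : X} : x ∈ cellUnion s ↔ ∃ e ∈ s, x ∈ e.closed := by
  simp [cellUnion]

theorem cellUnion_mono {s t : Finset (Cell X)} (h : s ⊆ t) : cellUnion s ⊆ cellUnion t :=
  Set.biUnion_subset_biUnion_left h

/-- Finite sets of cells which span subcomplexes. -/
def IsSubcx (s : Finset (Cell X)) : Prop :=
  ∀ e ∈ s, ∀ x ∈ e.frontier, ∃ e' ∈ s, e'.1 < e.1 ∧ x ∈ e'.closed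

theorem exists_isSubcx_of_forall {t : Finset (Cell X)}
    (h : ∀ e ∈ t, ∃ s : Finset (Cell X), IsSubcx s ∧ e ∈ s) : ∃ s, IsSubcx s ∧ t ⊆ s := by
  classical
  choose! f hf using h
  refine ⟨t.biUnion f, fun e he x hx => ?_, fun e he => Finset.mem_biUnion.mpr ⟨e, he, (hf e he).2⟩⟩
  obtain ⟨a, ha, hea⟩ := Finset.mem_biUnion.mp he
  obtain ⟨e', h1, h2⟩ := (hf a ha).1 e hea x hx
  exact ⟨e', Finset.mem_biUnion.mpr ⟨a, ha, h1⟩, h2⟩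

theorem exists_isSubcx_mem (e : Cell X) : ∃ s : Finset (Cell X), IsSubcx s ∧ e ∈ s := by
  classical
  obtain ⟨n, c⟩ := e
  induction n using Nat.strong_induction_on with
  | _ n ih =>
    obtain ⟨I, hI⟩ := CWComplex.cellFrontier_subset_finite_closedCell n c
    let t : Finset (Cell X) := (Finset.range n).sigma I
    obtain ⟨s, hs, hts⟩ := exists_isSubcx_of_forall (t := t) fun e he => by
      obtain ⟨m, c'⟩ := e
      exact ih m (by simpa using (Finset.mem_sigma.mp he).1) c'
    refine ⟨insert ⟨n, c⟩ s, fun e he x hx => ?_, Finset.mem_insert_self _ _⟩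
    rcases Finset.mem_insert.mp he with rfl | he
    · have := hI hx
      simp only [Set.mem_iUnion] at this
      obtain ⟨m, hm, j, hj, hxj⟩ := this
      exact ⟨⟨m, j⟩, Finset.mem_insert_of_mem (hts (Finset.mem_sigma.mpr
        ⟨Finset.mem_range.mpr hm, hj⟩)), hm, hxj⟩
    · obtain ⟨e', h1, h2⟩ := hs e he x hx
      exact ⟨e', Finset.mem_insert_of_mem h1, h2⟩

theorem exists_isSubcx (t : Finset (Cell X)) : ∃ s, IsSubcx s ∧ t ⊆ s :=
  exists_isSubcx_of_forall fun e _ => exists_isSubcx_mem e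

theorem IsSubcx.exists_mem_opn {s : Finset (Cell X)} (hs : IsSubcx s) {x : X}
    (hx : x ∈ cellUnion s) : ∃ e ∈ s, x ∈ e.opn := by
  obtain ⟨e, he, hxe⟩ := mem_cellUnion.mp hx
  generalize hn : e.1 = n
  induction n using Nat.strong_induction_on generalizing e with
  | _ n ih =>
    have := hxe
    rw [Cell.closed, ← RelCWComplex.cellFrontier_union_openCell_eq_closedCell] at this
    rcases this with h | h
    · obtain ⟨e', h1, h2, h3⟩ := hs e he x h
      exact ih e'.1 (hn ▸ h2) e' h1 h3 rfl
    · exact ⟨e, he, h⟩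

theorem IsSubcx.disjoint {s : Finset (Cell X)} (hs : IsSubcx s) {e : Cell X} (he : e ∉ s) :
    Disjoint e.opn (cellUnion s) := by
  refine Set.disjoint_left.mpr fun x hx hxs => ?_
  obtain ⟨e', h1, h2⟩ := hs.exists_mem_opn hxs
  refine Set.disjoint_left.mp (RelCWComplex.disjoint_openCell_of_ne (C := (Set.univ : Set X))
    (i := e.2) (j := e'.2) ?_) hx h2
  rintro h
  exact he ((show e = e' from h) ▸ h1)

theorem IsSubcx.erase [DecidableEq (Cell X)] {s : Finset (Cell X)} (hs : IsSubcx s) {e : Cell X}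
    (hmax : ∀ e' ∈ s, e'.1 ≤ e.1) : IsSubcx (s.erase e) := by
  intro a ha x hx
  obtain ⟨e', h1, h2, h3⟩ := hs a (Finset.mem_of_mem_erase ha) x hx
  refine ⟨e', Finset.mem_erase.mpr ⟨?_, h1⟩, h2, h3⟩
  rintro rfl
  exact absurd (hmax a (Finset.mem_of_mem_erase ha)) (not_le.mpr h2)

variable [T2Space X]

theorem isClosed_cellUnion (s : Finset (Cell X)) : IsClosed (cellUnion s) :=
  s.finite_toSet.isClosed_biUnion fun _ _ => RelCWComplex.isClosed_closedCell

/-- A closed cell lies in a finite subcomplex, which is a finite union of open cells; hence `Q`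
meets it in a finite set. -/
theorem isClosed_of_finite_inter_opn {Q : Set X} (hQ : ∀ e : Cell X, (Q ∩ e.opn).Finite) :
    IsClosed Q := by
  rw [CWComplex.closed (Set.univ : Set X) Q (Set.subset_univ _)]
  intro n j
  obtain ⟨s, hs, hjs⟩ := exists_isSubcx_mem (⟨n, j⟩ : Cell X)
  refine Set.Finite.isClosed (Set.Finite.subset (s.finite_toSet.biUnion fun e _ => hQ e) ?_)
  rintro x ⟨hx, hxj⟩
  obtain ⟨e, he, hxe⟩ := hs.exists_mem_opn (mem_cellUnion.mpr ⟨_, hjs, hxj⟩)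
  exact Set.mem_biUnion he ⟨hx, hxe⟩

/-- A compact set meets only finitely many open cells: infinitely many would give, by choosing a
point in each, an infinite subset of `K` that remains closed after removal of any point and so has
no accumulation point. -/
theorem exists_isSubcx_of_isCompact {K : Set X} (hK : IsCompact K) :
    ∃ s : Finset (Cell X), IsSubcx s ∧ K ⊆ cellUnion s := by
  have hcover : ∀ x : X, ∃ e : Cell X, x ∈ e.opn := fun x => by
    have : x ∈ ⋃ (n : ℕ) (j : RelCWComplex.cell (Set.univ : Set X) n),
        RelCWComplex.openCell (C := (Set.univ : Set X)) n j := by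
      rw [CWComplex.iUnion_openCell_eq_complex]
      trivial
    simp only [Set.mem_iUnion] at this
    obtain ⟨n, j, h⟩ := this
    exact ⟨⟨n, j⟩, h⟩
  let T : Set (Cell X) := {e | (K ∩ e.opn).Nonempty}
  have hT : T.Finite := by
    rcases isEmpty_or_nonempty X with hX | hX
    · exact Set.Subsingleton.finite fun e he => (hX.false he.some).elim
    choose! x hx using fun e (he : e ∈ T) => he
    have huniq : ∀ e ∈ T, ∀ e' : Cell X, x e ∈ e'.opn → e = e' := fun e he e' h => by
      by_contra hne
      exact Set.disjoint_left.mp (RelCWComplex.disjoint_openCell_of_ne (C := (Set.univ : Set X))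
        (i := e.2) (j := e'.2) hne) (hx e he).2 h
    have hinj : Set.InjOn x T := fun e he e' he' h => huniq e he e' (h ▸ (hx e' he').2)
    refine Set.Finite.of_finite_image ?_ hinj
    by_contra hinf
    obtain ⟨y, -, hy⟩ := Set.Infinite.exists_accPt_of_subset_isCompact hinf hK
      (by rintro _ ⟨e, he, rfl⟩; exact (hx e he).1)
    have hcl : IsClosed (x '' T \ {y}) := by
      refine isClosed_of_finite_inter_opn fun e => Set.Finite.subset (Set.finite_singleton (x e)) ?_
      rintro _ ⟨⟨⟨e', he', rfl⟩, -⟩, h⟩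
      rw [huniq e' he' e h]
      rfl
    have := accPt_iff_clusterPt.mp hy
    have h2 : y ∈ closure (x '' T \ {y}) := by
      rw [mem_closure_iff_clusterPt]
      convert this using 1
      rw [Filter.inf_principal, Set.inter_comm]
      rfl
    rw [hcl.closure_eq] at h2
    exact h2.2 rfl
  obtain ⟨s, hs, hTs⟩ := exists_isSubcx hT.toFinset
  refine ⟨s, hs, fun x hx => ?_⟩
  obtain ⟨e, he⟩ := hcover x
  exact mem_cellUnion.mpr ⟨e, hTs (hT.mem_toFinset.mpr ⟨x, hx, he⟩),
    RelCWComplex.openCell_subset_closedCell _ _ he⟩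

variable {R : Type*} [CommRing R] [IsNoetherianRing R] (w : LocSys X R)

theorem fgMod_erase [DecidableEq (Cell X)] {s : Finset (Cell X)} (hs : IsSubcx s) {e : Cell X}
    (he : e ∈ s) (hmax : ∀ e' ∈ s, e'.1 ≤ e.1) (i : ℕ) :
    FGMod (i < e.1) (relZ w i (cellUnion s) (cellUnion (s.erase e)))
      (relD w i (cellUnion s) (cellUnion (s.erase e))) := by
  have h1 : cellUnion s = cellUnion (s.erase e) ∪
      RelCWComplex.map (C := (Set.univ : Set X)) e.1 e.2 '' Metric.closedBall 0 1 := by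
    conv_lhs => rw [← Finset.insert_erase he]
    rw [cellUnion, Finset.set_biUnion_insert, Set.union_comm]
    rfl
  rw [h1]
  refine fgMod_attach w (RelCWComplex.source_eq e.1 e.2) (fun x hx => ?_)
    ((hs.erase hmax).disjoint (Finset.notMem_erase e s))
    (RelCWComplex.continuousOn e.1 e.2) (RelCWComplex.continuousOn_symm e.1 e.2)
    (isClosed_cellUnion _) i
  obtain ⟨e', h1, h2, h3⟩ := hs e he x hx
  refine mem_cellUnion.mpr ⟨e', Finset.mem_erase.mpr ⟨?_, h1⟩, h3⟩
  rintro rfl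
  exact absurd h2 (lt_irrefl _)

theorem fgMod_cellUnion {s : Finset (Cell X)} (hs : IsSubcx s) (i : ℕ) :
    FGMod False (relZ w i (cellUnion s) ∅) (relD w i (cellUnion s) ∅) := by
  classical
  generalize hn : s.card = n
  induction n generalizing s with
  | zero =>
    refine fgMod_of_le fun x hx => Submodule.mem_sup_right ?_
    rw [Finset.card_eq_zero.mp hn, cellUnion] at hx
    simpa using hx.1
  | succ n ih =>
    obtain ⟨e, he, hmax⟩ := s.exists_max_image (fun e => e.1) (Finset.card_pos.mp (by omega))
    refine FGMod.trans w (cellUnion_mono (Finset.erase_subset e s)) (Set.empty_subset _)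
      ((fgMod_erase w hs he hmax i).congr False.elim) (ih (hs.erase hmax) ?_)
    rw [Finset.card_erase_of_mem he, hn]
    rfl

/-- Cells are removed in order of decreasing dimension; a cell of dimension above `K` contributes
nothing in degree `i ≤ K`. The proposition `True` in `FGMod` expresses that no generators are
needed. -/
theorem relZ_le_relD_skeleton {s : Finset (Cell X)} (hs : IsSubcx s) {i K : ℕ} (hi : i ≤ K) :
    FGMod True (relZ w i (cellUnion s) (cellUnion (s.filter fun e => e.1 ≤ K)))
      (relD w i (cellUnion s) (cellUnion (s.filter fun e => e.1 ≤ K))) := by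
  classical
  generalize hn : s.card = n
  induction n generalizing s with
  | zero =>
    refine fgMod_of_le fun x hx => Submodule.mem_sup_right ?_
    rw [Finset.card_eq_zero.mp hn] at hx ⊢
    simpa using hx.1
  | succ n ih =>
    obtain ⟨e, he, hmax⟩ := s.exists_max_image (fun e => e.1) (Finset.card_pos.mp (by omega))
    by_cases hK : e.1 ≤ K
    · rw [Finset.filter_true_of_mem fun e' he' => (hmax e' he').trans hK]
      exact fgMod_of_le fun x hx => Submodule.mem_sup_right hx.1
    · have h1 : (s.filter fun e => e.1 ≤ K) = (s.erase e).filter fun e => e.1 ≤ K := by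
        rw [Finset.filter_erase, Finset.erase_eq_of_notMem]
        simp [hK]
      have h2 := ih (hs.erase hmax) (by rw [Finset.card_erase_of_mem he, hn]; rfl)
      rw [← h1] at h2
      refine FGMod.trans w (cellUnion_mono (Finset.erase_subset e s)) ?_
        ((fgMod_erase w hs he hmax i).congr fun _ => by omega) h2
      rw [h1]
      exact cellUnion_mono (Finset.filter_subset _ _)

/-- The homology of a CW complex with finitely many cells of dimension at most `K`, with
coefficients in a local system of rank one over a Noetherian ring, is finitely generated in
degrees at most `K`. -/
theorem fgMod_homology {K : ℕ}
    (hfin : ∀ n ≤ K, Finite (RelCWComplex.cell (Set.univ : Set X) n)) {i : ℕ} (hi : i ≤ K) :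
    FGMod False (relZ w i (Set.univ : Set X) ∅) (relD w i (Set.univ : Set X) ∅) := by
  classical
  have hfinite : {e : Cell X | e.1 ≤ K}.Finite := by
    have : {e : Cell X | e.1 ≤ K} = ⋃ n ∈ Set.Iic K, Set.range (Sigma.mk n) := by
      ext ⟨n, c⟩
      simp
    rw [this]
    refine Set.Finite.biUnion (Set.finite_Iic K) fun n hn => ?_
    have := hfin n hn
    exact Set.finite_range _
  let s₀ : Finset (Cell X) := hfinite.toFinset
  have hs₀ : ∀ e : Cell X, e ∈ s₀ ↔ e.1 ≤ K := fun e => hfinite.mem_toFinset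
  have hsub : IsSubcx s₀ := fun e he x hx => by
    obtain ⟨s, hs, hes⟩ := exists_isSubcx_mem e
    obtain ⟨e', -, h2, h3⟩ := hs e hes x hx
    exact ⟨e', (hs₀ e').mpr (h2.le.trans ((hs₀ e).mp he)), h2, h3⟩
  obtain ⟨N, hN, -, hle⟩ := fgMod_cellUnion w hsub i
  refine ⟨N, hN, False.elim, fun x hx => ?_⟩
  -- A chain has compact support, hence lies in a finite subcomplex, which is enlarged to contain
  -- the `K`-skeleton `s₀`. Modulo a boundary the cycle then moves into the `K`-skeleton.
  have hcomp : IsCompact (⋃ s ∈ x.support, Set.range s.2) :=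
    x.support.finite_toSet.isCompact_biUnion fun s _ => isCompact_range s.2.continuous
  obtain ⟨s₁, hs₁, hxs₁⟩ := exists_isSubcx_of_isCompact hcomp
  obtain ⟨s, hs, hss⟩ := exists_isSubcx (s₁ ∪ s₀)
  have hfil : (s.filter fun e => e.1 ≤ K) = s₀ := by
    ext e
    rw [Finset.mem_filter, hs₀, and_iff_right_iff_imp]
    exact fun h => hss (Finset.mem_union_right _ ((hs₀ e).mpr h))
  obtain ⟨N', -, h0, h1⟩ := relZ_le_relD_skeleton w hs hi
  rw [h0 trivial, bot_sup_eq, hfil] at h1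
  have hxz : x ∈ relZ w i (cellUnion s) (cellUnion s₀) := by
    refine ⟨fun t ht => ⟨(hx.1 ht).1, ?_⟩, chA_mono (Set.empty_subset _) hx.2⟩
    refine Set.Subset.trans ?_ (hxs₁.trans (cellUnion_mono
      (Finset.subset_union_left.trans hss)))
    exact Set.subset_biUnion_of_mem (u := fun s : Σ n, Simp X n => Set.range s.2) ht
  obtain ⟨b, ⟨y, hy, rfl⟩, c, hc, rfl⟩ := Submodule.mem_sup.mp (h1 hxz)
  have hc0 : c ∈ relZ w i (cellUnion s₀) ∅ := by
    refine ⟨hc, ?_⟩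
    have := hx.2
    change w.bd (w.bd y + c) ∈ chA R ∅ at this
    rwa [map_add, w.bd_bd, zero_add] at this
  refine Submodule.add_mem _ (Submodule.mem_sup_right (Submodule.mem_sup_left
    ⟨y, chIn_mono _ (Set.subset_univ _) hy, rfl⟩)) ?_
  exact sup_le_sup_left (relD_mono w i (Set.subset_univ _) subset_rfl) N (hle hc0)

end Cells

/-! ### Complexes of free modules and their specializations -/

section FreeComplex

variable {Λ k : Type*} [CommRing Λ] [Field k] {ι κ μ : Type*} (π : Λ →+* k)

/-- The change of coefficients on free modules. -/
def specMap : (ι →₀ Λ) →+ (ι →₀ k) := Finsupp.mapRange.addMonoidHom π.toAddMonoidHom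

theorem specMap_single (a : ι) (r : Λ) :
    specMap π (Finsupp.single a r) = Finsupp.single a (π r) := by
  simp [specMap]

theorem specMap_apply (x : ι →₀ Λ) (a : ι) : specMap π x a = π (x a) := rfl

theorem specMap_smul (r : Λ) (x : ι →₀ Λ) : specMap π (r • x) = π r • specMap π x := by
  ext a
  simp [specMap_apply]

theorem specMap_surjective (hπ : Function.Surjective π) :
    Function.Surjective (specMap (ι := ι) π) :=
  Finsupp.mapRange_surjective _ (map_zero π) hπ

/-- The specialization of a linear map of free modules. -/
def spec (h : (ι →₀ Λ) →ₗ[Λ] (κ →₀ Λ)) : (ι →₀ k) →ₗ[k] (κ →₀ k) :=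
  Finsupp.linearCombination k fun a => specMap π (h (Finsupp.single a 1))

theorem spec_specMap (h : (ι →₀ Λ) →ₗ[Λ] (κ →₀ Λ)) (x : ι →₀ Λ) :
    spec π h (specMap π x) = specMap π (h x) := by
  induction x using Finsupp.induction_linear with
  | zero => simp
  | add x y hx hy => simp only [map_add, hx, hy]
  | single a r =>
    rw [specMap_single, spec, Finsupp.linearCombination_single, ← specMap_smul, ← map_smul,
      Finsupp.smul_single, smul_eq_mul, mul_one]

variable {ι : ℕ → Type*} (d : ∀ i, (ι (i + 1) →₀ Λ) →ₗ[Λ] (ι i →₀ Λ))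

/-- The cycles of a complex. -/
def cyc {R : Type*} [CommRing R] (d : ∀ i, (ι (i + 1) →₀ R) →ₗ[R] (ι i →₀ R)) :
    ∀ i, Submodule R (ι i →₀ R)
  | 0 => ⊤
  | i + 1 => LinearMap.ker (d i)

/-- The boundaries of a complex. -/
def bnd {R : Type*} [CommRing R] (d : ∀ i, (ι (i + 1) →₀ R) →ₗ[R] (ι i →₀ R)) (i : ℕ) :
    Submodule R (ι i →₀ R) :=
  LinearMap.range (d i)

/-- `f` annihilates the homology in degree `i`. -/
def Kills {R : Type*} [CommRing R] (d : ∀ i, (ι (i + 1) →₀ R) →ₗ[R] (ι i →₀ R)) (f : R)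
    (i : ℕ) : Prop :=
  ∀ z ∈ cyc d i, f • z ∈ bnd d i

theorem Kills.mul_left {f : Λ} {i : ℕ} (h : Kills d f i) (g : Λ) : Kills d (g * f) i :=
  fun z hz => by
    rw [mul_smul]
    exact Submodule.smul_mem _ g (h z hz)

theorem Kills.add {f g : Λ} {i : ℕ} (h : Kills d f i) (h' : Kills d g i) : Kills d (f + g) i :=
  fun z hz => by
    rw [add_smul]
    exact Submodule.add_mem _ (h z hz) (h' z hz)

theorem exists_lift {M N : Type*} [AddCommGroup M] [Module Λ M] [AddCommGroup N] [Module Λ N]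
    (D : M →ₗ[Λ] N) (g : (κ →₀ Λ) →ₗ[Λ] N) (h : ∀ x, g x ∈ LinearMap.range D) :
    ∃ u : (κ →₀ Λ) →ₗ[Λ] M, ∀ x, D (u x) = g x := by
  choose u hu using fun a : κ => h (Finsupp.single a 1)
  refine ⟨Finsupp.linearCombination Λ u, fun x => ?_⟩
  have : D ∘ₗ Finsupp.linearCombination Λ u = g := by
    ext a
    simp [hu]
  exact LinearMap.congr_fun this x

variable {d} (hdd : ∀ i x, d i (d (i + 1) x) = 0)

include hdd

theorem bnd_le_cyc (i : ℕ) : bnd d i ≤ cyc d i := by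
  rintro _ ⟨x, rfl⟩
  cases i with
  | zero => trivial
  | succ i => exact hdd i x

/-- A null homotopy of a power of an element annihilating the homology. -/
theorem exists_homotopy {f : Λ} {j : ℕ} (hf : ∀ i ≤ j, Kills d f i) :
    ∃ (N : ℕ) (h : (ι j →₀ Λ) →ₗ[Λ] (ι (j + 1) →₀ Λ)),
      ∃ P : (ι j →₀ Λ) →ₗ[Λ] (ι j →₀ Λ), (∀ x, d j (h x) + P x = f ^ N • x) ∧
        (∀ x ∈ cyc d j, P x = 0) ∧
        ∀ x ∈ cyc (fun i => spec π (d i)) j, spec π P x = 0 := by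
  induction j with
  | zero =>
    obtain ⟨u, hu⟩ := exists_lift (d 0) (f • LinearMap.id) fun x => hf 0 le_rfl x trivial
    refine ⟨1, u, 0, fun x => by simp [hu], fun x _ => rfl, fun x _ => ?_⟩
    simp [spec, Finsupp.linearCombination_apply]
  | succ j ih =>
    obtain ⟨N, h, P, h1, h2, -⟩ := ih fun i hi => hf i (by omega)
    -- The homotopy in degree `j` makes `g` take values in cycles, so `f • g` takes values in
    -- boundaries and lifts through `d (j + 1)` by freeness.
    let g : (ι (j + 1) →₀ Λ) →ₗ[Λ] (ι (j + 1) →₀ Λ) := f ^ N • LinearMap.id - h ∘ₗ d j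
    have hg : ∀ x, g x ∈ cyc d (j + 1) := fun x => by
      have e := h1 (d j x)
      rw [h2 _ (bnd_le_cyc hdd j ⟨x, rfl⟩), add_zero] at e
      simp [g, cyc, e]
    obtain ⟨u, hu⟩ := exists_lift (d (j + 1)) (f • g) fun x => hf (j + 1) le_rfl _ (hg x)
    -- The error term factors through the differential, so it vanishes on cycles before and after
    -- specialization.
    refine ⟨N + 1, u, (f • h) ∘ₗ d j, fun x => ?_, fun x hx => ?_, fun x hx => ?_⟩
    · simp [hu, g, smul_sub, smul_smul, pow_succ']
    · have : d j x = 0 := hx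
      simp [this]
    · have hc : spec π ((f • h) ∘ₗ d j) = spec π (f • h) ∘ₗ spec π (d j) := by
        ext a : 1
        refine LinearMap.ext_ring ?_
        have := spec_specMap π ((f • h) ∘ₗ d j) (Finsupp.single a 1)
        rw [LinearMap.comp_apply, ← spec_specMap, ← spec_specMap, specMap_single, map_one] at this
        exact this
      rw [hc, LinearMap.comp_apply]
      have : spec π (d j) x = 0 := hx
      rw [this, map_zero]

/-- If an element which does not vanish under a specialization annihilates the homology, then the
specialized complex is exact. -/
theorem exact_of_kills (hπ : Function.Surjective π) {f : Λ} (hf0 : π f ≠ 0) {j : ℕ}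
    (hf : ∀ i ≤ j, Kills d f i) :
    cyc (fun i => spec π (d i)) j ≤ bnd (fun i => spec π (d i)) j := by
  intro x hx
  obtain ⟨N, h, P, h1, -, h3⟩ := exists_homotopy π hdd hf
  obtain ⟨y, rfl⟩ := specMap_surjective π hπ x
  have e := congrArg (specMap π) (h1 y)
  rw [map_add, ← spec_specMap, ← spec_specMap, ← spec_specMap, h3 _ hx, add_zero, specMap_smul,
    map_pow] at e
  have hne : π f ^ N ≠ 0 := pow_ne_zero N hf0
  refine ⟨(π f ^ N)⁻¹ • spec π h (specMap π y), ?_⟩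
  rw [map_smul, e, inv_smul_smul₀ hne]

omit hdd

theorem mem_smul_of_specMap_eq_zero {M : Type*} [AddCommGroup M] [Module Λ M] {S : Submodule Λ M}
    {g : (κ →₀ Λ) →ₗ[Λ] M} (hg : ∀ x, g x ∈ S) {u : κ →₀ Λ} (hu : specMap π u = 0) :
    g u ∈ RingHom.ker π • S := by
  rw [← Finsupp.sum_single u, Finsupp.sum, map_sum]
  refine Submodule.sum_mem _ fun a _ => ?_
  rw [← mul_one (u a), ← smul_eq_mul, ← Finsupp.smul_single, map_smul]
  refine Submodule.smul_mem_smul ?_ (hg _)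
  rw [RingHom.mem_ker, ← specMap_apply, hu]
  rfl

/-- Nakayama's lemma for the homology module, in the form that provides an annihilator congruent to
`1` modulo `I`. -/
theorem exists_kills_of_le [IsNoetherianRing Λ] {i : ℕ}
    (hF : FGMod False (cyc d i) (bnd d i)) {I : Ideal Λ}
    (hle : cyc d i ≤ bnd d i ⊔ I • cyc d i) : ∃ r : Λ, r - 1 ∈ I ∧ Kills d r i := by
  obtain ⟨N, hN, -, hZ⟩ := hF
  have hfg : ((cyc d i).map (bnd d i).mkQ).FG := by
    refine fg_of_le (hN.map (bnd d i).mkQ) ?_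
    refine (Submodule.map_mono hZ).trans ?_
    rw [Submodule.map_sup, Submodule.mkQ_map_self, sup_bot_eq]
  obtain ⟨r, hr, h⟩ := Submodule.exists_sub_one_mem_and_smul_eq_zero_of_fg_of_le_smul I
    ((cyc d i).map (bnd d i).mkQ) hfg (by
      refine (Submodule.map_mono hle).trans ?_
      rw [Submodule.map_sup, Submodule.mkQ_map_self, bot_sup_eq, Submodule.map_smul''])
  refine ⟨r, hr, fun z hz => ?_⟩
  have := h _ ⟨z, hz, rfl⟩
  rwa [← map_smul, Submodule.mkQ_apply, Submodule.Quotient.mk_eq_zero] at this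

/-- The specialized cycle is a boundary; lifting a bounding chain corrects `z` to a cycle with all
coefficients in the kernel of `π`. Such a cycle need not lie in `ker π` times the cycles, which is
the difficulty met in the next results. -/
theorem sub_boundary {hπ : Function.Surjective π} {i : ℕ} (hB : bnd d i ≤ cyc d i)
    (hE : cyc (fun i => spec π (d i)) i ≤ bnd (fun i => spec π (d i)) i) {z : ι i →₀ Λ}
    (hz : z ∈ cyc d i) : ∃ u ∈ cyc d i, specMap π u = 0 ∧ z - u ∈ bnd d i := by
  have h1 : specMap π z ∈ cyc (fun i => spec π (d i)) i := by
    cases i with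
    | zero => trivial
    | succ i =>
      have : d i z = 0 := hz
      change spec π (d i) (specMap π z) = 0
      rw [spec_specMap, this, map_zero]
  obtain ⟨y', hy⟩ := hE h1
  obtain ⟨y, rfl⟩ := specMap_surjective π hπ y'
  refine ⟨z - d i y, Submodule.sub_mem _ hz (hB ⟨y, rfl⟩), ?_, ?_⟩
  · rw [map_sub, ← spec_specMap]
    exact sub_eq_zero.mpr hy.symm
  · rw [sub_sub_cancel]
    exact ⟨y, rfl⟩

include hdd

/-- If a specialization of the complex is exact in degrees at most `j`, then an element which does
not vanish under the specialization annihilates the homology in degrees at most `j`. -/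
theorem exists_kills [IsNoetherianRing Λ] (hπ : Function.Surjective π) {j : ℕ}
    (hF : ∀ i ≤ j, FGMod False (cyc d i) (bnd d i))
    (hE : ∀ i ≤ j, cyc (fun i => spec π (d i)) i ≤ bnd (fun i => spec π (d i)) i) :
    ∃ f : Λ, π f ≠ 0 ∧ ∀ i ≤ j, Kills d f i := by
  have key : ∀ m, (∀ i < m, i ≤ j) → ∃ f : Λ, π f ≠ 0 ∧ ∀ i < m, Kills d f i := by
    intro m
    induction m with
    | zero => exact fun _ => ⟨1, by simp, fun i hi => absurd hi (Nat.not_lt_zero i)⟩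
    | succ m ih =>
      intro hm
      obtain ⟨f, hf0, hf⟩ := ih fun i hi => hm i (by omega)
      have hmj := hm m (by omega)
      -- A projection onto the cycles up to the factor `f ^ N`: it moves an element with
      -- coefficients in `ker π` into `ker π` times the cycles.
      obtain ⟨N, g, hg, hgz⟩ : ∃ (N : ℕ) (g : (ι m →₀ Λ) →ₗ[Λ] (ι m →₀ Λ)),
          (∀ x, g x ∈ cyc d m) ∧ ∀ x ∈ cyc d m, g x = f ^ N • x := by
        cases m with
        | zero => exact ⟨0, LinearMap.id, fun _ => trivial, fun x _ => by simp⟩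
        | succ m =>
          obtain ⟨N, h, P, h1, h2, -⟩ := exists_homotopy π hdd fun i (hi : i ≤ m) =>
            hf i (Nat.lt_succ_of_le hi)
          refine ⟨N, f ^ N • LinearMap.id - h ∘ₗ d m, fun x => ?_, fun x hx => ?_⟩
          · have e := h1 (d m x)
            rw [h2 _ (bnd_le_cyc hdd m ⟨x, rfl⟩), add_zero] at e
            simp [cyc, e]
          · have : d m x = 0 := hx
            simp [this]
      have hle : ∀ z ∈ cyc d m, f ^ N • z ∈ bnd d m ⊔ RingHom.ker π • cyc d m := by
        intro z hz
        obtain ⟨u, hu, hu0, hzu⟩ := sub_boundary (hπ := hπ) π (bnd_le_cyc hdd m) (hE m hmj) hz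
        rw [← sub_add_cancel z u, smul_add, ← hgz u hu]
        exact Submodule.add_mem_sup (Submodule.smul_mem _ _ hzu)
          (mem_smul_of_specMap_eq_zero π hg hu0)
      -- An inverse of `f ^ N` modulo `ker π`, which removes the factor `f ^ N` before Nakayama is
      -- applied.
      obtain ⟨c, hc⟩ := hπ (π (f ^ N))⁻¹
      have hc1 : 1 - c * f ^ N ∈ RingHom.ker π := by
        have : π (f ^ N) ≠ 0 := by
          rw [map_pow]
          exact pow_ne_zero _ hf0
        rw [RingHom.mem_ker, map_sub, map_mul, hc, inv_mul_cancel₀ this, map_one, sub_self]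
      obtain ⟨r, hr, hrk⟩ := exists_kills_of_le (hF m hmj)
        (I := RingHom.ker π) fun z hz => by
          have e : z = c • f ^ N • z + (1 - c * f ^ N) • z := by
            rw [smul_smul, ← add_smul, add_sub_cancel, one_smul]
          rw [e]
          exact Submodule.add_mem _ (Submodule.smul_mem _ _ (hle z hz))
            (Submodule.mem_sup_right (Submodule.smul_mem_smul hc1 hz))
      have hr1 : π r = 1 := by
        rw [RingHom.mem_ker, map_sub, map_one, sub_eq_zero] at hr
        exact hr
      refine ⟨r * f, by rwa [map_mul, hr1, one_mul], fun i hi => ?_⟩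
      rcases Nat.lt_succ_iff_lt_or_eq.mp hi with hi | rfl
      · exact (hf i hi).mul_left d r
      · rw [mul_comm]
        exact hrk.mul_left d f
  obtain ⟨f, hf0, hf⟩ := key (j + 1) fun i hi => by omega
  exact ⟨f, hf0, fun i hi => hf i (by omega)⟩

/-- For a principal specialization of a domain, exactness in a single degree is sufficient. -/
theorem exists_kills_of_principal [IsNoetherianRing Λ] [IsDomain Λ] (hπ : Function.Surjective π)
    {a : Λ} (ha0 : a ≠ 0) (ha : ∀ x, π x = 0 → a ∣ x) {i : ℕ}
    (hF : FGMod False (cyc d i) (bnd d i))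
    (hE : cyc (fun i => spec π (d i)) i ≤ bnd (fun i => spec π (d i)) i) (ha1 : π a = 0) :
    ∃ f : Λ, f ≠ 0 ∧ Kills d f i := by
  obtain ⟨r, hr, hrk⟩ := exists_kills_of_le hF (I := RingHom.ker π)
    fun z hz => by
      obtain ⟨u, hu, hu0, hzu⟩ := sub_boundary (hπ := hπ) π (bnd_le_cyc hdd i) hE hz
      choose g hg using fun b => ha (u b) (by rw [← specMap_apply, hu0]; rfl)
      have hgs : ∀ b, g b ≠ 0 → b ∈ u.support := fun b hb => by
        rw [Finsupp.mem_support_iff, hg b]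
        exact mul_ne_zero ha0 hb
      -- Dividing the corrected cycle by `a` leaves a cycle, since multiplication by `a` is
      -- injective on a free module over a domain. This replaces the projection built from lower
      -- degrees.
      let v : ι i →₀ Λ := Finsupp.onFinset u.support g hgs
      have huv : u = a • v := Finsupp.ext fun b => hg b
      have hv : v ∈ cyc d i := by
        cases i with
        | zero => trivial
        | succ i =>
          have : d i u = 0 := hu
          rw [huv, map_smul] at this
          exact (smul_eq_zero.mp this).resolve_left ha0
      rw [← sub_add_cancel z u]
      refine Submodule.add_mem_sup hzu ?_
      rw [huv]
      exact Submodule.smul_mem_smul ha1 hv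
  refine ⟨r, ?_, hrk⟩
  rintro rfl
  rw [RingHom.mem_ker, map_sub, map_one, map_zero, zero_sub, neg_eq_zero] at hr
  exact one_ne_zero hr

end FreeComplex

/-! ### Finite dimensionality -/

section FiniteDim

variable {k Λ M : Type*} [Field k] [CommRing Λ] [Algebra k Λ] [AddCommGroup M] [Module k M]
  [Module Λ M] [IsScalarTower k Λ M] {Z B : Submodule Λ M}

/-- An element of the algebra is annihilated by a monic polynomial modulo the annihilator of a
finite dimensional module. -/
theorem exists_aeval_smul_mem
    (h : FGMod False (Z.restrictScalars k) (B.restrictScalars k)) (q : Λ) :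
    ∃ p : Polynomial k, p ≠ 0 ∧ ∀ z ∈ Z, (Polynomial.aeval q p) • z ∈ B := by
  obtain ⟨W, hW, -, hle⟩ := h
  let H : Submodule Λ (M ⧸ B) := Z.map B.mkQ
  have hfin : Module.Finite k H := by
    have h1 : (H.restrictScalars k).FG := by
      refine fg_of_le (hW.map (B.mkQ.restrictScalars k)) ?_
      rintro _ ⟨z, hz, rfl⟩
      obtain ⟨x, hx, y, hy, rfl⟩ := Submodule.mem_sup.mp (hle hz)
      refine ⟨x, hx, ?_⟩
      have : B.mkQ y = 0 := (Submodule.Quotient.mk_eq_zero B).mpr hy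
      change B.mkQ x = B.mkQ (x + y)
      rw [map_add, this, add_zero]
    exact Module.Finite.iff_fg.mpr h1
  -- Multiplication by `q` on the finite dimensional quotient; its characteristic polynomial is the
  -- one sought, by Cayley-Hamilton.
  let T : Module.End k H := (Algebra.lsmul k k H q : Module.End k H)
  refine ⟨T.charpoly, T.charpoly_monic.ne_zero, fun z hz => ?_⟩
  have h1 := T.aeval_self_charpoly
  have h2 : Polynomial.aeval T T.charpoly = Algebra.lsmul k k H (Polynomial.aeval q T.charpoly) :=
    (Polynomial.aeval_algHom_apply (Algebra.lsmul k k H) q T.charpoly)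
  rw [h1] at h2
  have h3 := LinearMap.congr_fun h2 ⟨B.mkQ z, z, hz, rfl⟩
  have h4 : (Polynomial.aeval q T.charpoly) • B.mkQ z = 0 := (congrArg Subtype.val h3).symm
  rwa [← map_smul, Submodule.mkQ_apply, Submodule.Quotient.mk_eq_zero] at h4

/-- The quotient is a finitely generated module over `Λ ⧸ I`, which is finite over `k`; products of
lifted generators of the two span it over `k`. -/
theorem fgMod_restrictScalars {I : Ideal Λ} [Module.Finite k (Λ ⧸ I)] (h : FGMod False Z B)
    (hI : ∀ f ∈ I, ∀ z ∈ Z, f • z ∈ B) [IsNoetherianRing Λ] :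
    FGMod False (Z.restrictScalars k) (B.restrictScalars k) := by
  obtain ⟨N, hNZ, ⟨s, hs⟩, -, hle⟩ := h.exists_le LinearMap.id (W := Z) (D := B) (fun x hx => hx)
    fun x _ hx => hx
  obtain ⟨E, hE⟩ := exists_fg_lift ((Ideal.Quotient.mkₐ k I).toLinearMap) (W := ⊤)
    (by
      have : Submodule.map (Ideal.Quotient.mkₐ k I).toLinearMap ⊤ = ⊤ := by
        rw [Submodule.map_top, LinearMap.range_eq_top]
        exact Ideal.Quotient.mkₐ_surjective k I
      rw [this]
      exact Module.Finite.fg_top)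
  obtain ⟨-, ⟨t, ht⟩, hE⟩ := hE
  classical
  refine ⟨Submodule.span k (Set.image2 (· • ·) (t : Set Λ) (s : Set M)),
    Submodule.fg_span (Set.Finite.image2 _ t.finite_toSet s.finite_toSet), False.elim, ?_⟩
  have key : N.restrictScalars k ≤ Submodule.span k (Set.image2 (· • ·) (t : Set Λ) (s : Set M)) ⊔
      B.restrictScalars k := by
    intro x hx
    rw [Submodule.restrictScalars_mem, ← hs, Submodule.mem_span_finset] at hx
    obtain ⟨f, -, rfl⟩ := hx
    refine Submodule.sum_mem _ fun n hn => ?_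
    have hf : Ideal.Quotient.mk I (f n) ∈
        Submodule.map (Ideal.Quotient.mkₐ k I).toLinearMap (Submodule.span k t) := by
      rw [ht, hE]
      exact ⟨f n, trivial, rfl⟩
    obtain ⟨e, he, hef⟩ := hf
    rw [← add_sub_cancel e (f n), add_smul]
    refine Submodule.add_mem_sup ?_ ?_
    · have h1 : Submodule.span k (t : Set Λ) ≤ (Submodule.span k (Set.image2 (· • ·) (t : Set Λ)
          (s : Set M))).comap ((LinearMap.toSpanSingleton Λ M n).restrictScalars k) :=
        Submodule.span_le.mpr fun a ha => Submodule.subset_span ⟨a, ha, n, hn, rfl⟩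
      exact h1 he
    · refine hI _ ?_ _ (hNZ (hs ▸ Submodule.subset_span hn))
      rw [← Ideal.Quotient.eq]
      exact hef.symm
  intro z hz
  obtain ⟨x, hx, y, hy, rfl⟩ := Submodule.mem_sup.mp (hle hz)
  exact add_mem (key hx) (Submodule.mem_sup_right hy)

end FiniteDim

/-! ### Group algebras of finitely generated abelian groups -/

section GroupAlgebra

/-- The evaluation of elements of the group algebra at a character. -/
def ev {Q : Type*} [CommGroup Q] (χ : Q →* ℂˣ) : MonoidAlgebra ℂ Q →ₐ[ℂ] ℂ :=
  MonoidAlgebra.lift ℂ ℂ Q ((Units.coeHom ℂ).comp χ)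

variable {Q : Type*} [CommGroup Q]

theorem ev_of (χ : Q →* ℂˣ) (q : Q) : ev χ (MonoidAlgebra.of ℂ Q q) = χ q :=
  MonoidAlgebra.lift_of _ _

theorem ev_surjective (χ : Q →* ℂˣ) : Function.Surjective (ev χ) :=
  fun c => ⟨algebraMap ℂ _ c, AlgHom.commutes _ _⟩

theorem ev_apply (χ : Q →* ℂˣ) (f : MonoidAlgebra ℂ Q) :
    ev χ f = ∑ q ∈ f.coeff.support, f.coeff q * χ q := by
  rw [ev, MonoidAlgebra.lift_apply]
  rfl

/-- A complex algebra of finite type with countably many points is finite dimensional. -/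
theorem finite_of_countable_algHom {A : Type*} [CommRing A] [Algebra ℂ A] [Algebra.FiniteType ℂ A]
    [Countable (A →ₐ[ℂ] ℂ)] : Module.Finite ℂ A := by
  rcases subsingleton_or_nontrivial A with h | h
  · infer_instance
  -- Noether normalization: `A` is finite over a polynomial ring in `s` variables, and only `s = 0`
  -- has to be shown possible.
  obtain ⟨s, g, hg, hfin⟩ := exists_finite_inj_algHom_of_fg ℂ A
  rcases Nat.eq_zero_or_pos s with rfl | hs
  · have h1 : Module.Finite ℂ (MvPolynomial (Fin 0) ℂ) :=
      Module.Finite.equiv (MvPolynomial.isEmptyAlgEquiv ℂ (Fin 0)).symm.toLinearEquiv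
    have h2 : (algebraMap ℂ A).Finite := by
      have : (algebraMap ℂ A) = g.toRingHom.comp (algebraMap ℂ (MvPolynomial (Fin 0) ℂ)) :=
        (AlgHom.comp_algebraMap g).symm
      rw [this]
      exact RingHom.Finite.comp hfin (RingHom.finite_algebraMap.mpr h1)
    exact RingHom.finite_algebraMap.mp h2
  · exfalso
    -- By lying over and the Nullstellensatz, the first variable takes every complex value at some
    -- point, which gives uncountably many points.
    have hsurj : ∀ c : ℂ, ∃ φ : A →ₐ[ℂ] ℂ, φ (g (MvPolynomial.X ⟨0, hs⟩)) = c := by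
      intro c
      let e : MvPolynomial (Fin s) ℂ →ₐ[ℂ] ℂ := MvPolynomial.aeval fun _ => c
      have he : Function.Surjective e := fun x => ⟨MvPolynomial.C x, by simp [e]⟩
      let P : Ideal (MvPolynomial (Fin s) ℂ) := RingHom.ker e
      have hP : P.IsMaximal := RingHom.ker_isMaximal_of_surjective e he
      algebraize [g.toRingHom]
      have : Algebra.IsIntegral (MvPolynomial (Fin s) ℂ) A := ⟨hfin.to_isIntegral⟩
      obtain ⟨M, hM, hMP⟩ := Ideal.exists_ideal_over_maximal_of_isIntegral (S := A) P (by
        rw [(RingHom.injective_iff_ker_eq_bot (algebraMap (MvPolynomial (Fin s) ℂ) A)).mp hg]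
        exact bot_le)
      let _ : Field (A ⧸ M) := Ideal.Quotient.field M
      have h3 : Module.Finite ℂ (A ⧸ M) := finite_of_finite_type_of_isJacobsonRing ℂ (A ⧸ M)
      have hb : Function.Bijective (Algebra.ofId ℂ (A ⧸ M)) :=
        IsAlgClosed.algebraMap_bijective_of_isIntegral
      let E := AlgEquiv.ofBijective _ hb
      refine ⟨E.symm.toAlgHom.comp (Ideal.Quotient.mkₐ ℂ M), ?_⟩
      change E.symm (Ideal.Quotient.mk M (g (MvPolynomial.X ⟨0, hs⟩))) = c
      rw [AlgEquiv.symm_apply_eq]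
      have h4 : MvPolynomial.X ⟨0, hs⟩ - MvPolynomial.C c ∈ P := by
        rw [RingHom.mem_ker]
        simp [e]
      rw [← hMP, Ideal.mem_comap] at h4
      have h5 : g (MvPolynomial.X ⟨0, hs⟩) - algebraMap ℂ A c ∈ M := by
        have : g (MvPolynomial.C c) = algebraMap ℂ A c := g.commutes c
        rw [← this, ← map_sub]
        exact h4
      exact Ideal.Quotient.eq.mpr h5
    choose φ hφ using hsurj
    have hinj : Function.Injective φ := fun a b hab => by rw [← hφ a, ← hφ b, hab]
    exact not_countable_complex (Set.countable_univ_iff.mpr hinj.countable)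

/-- Complex points of the quotient algebra are determined by characters of `Q` at which `I`
vanishes. -/
theorem finite_quotient_of_countable [Group.FG Q] (I : Ideal (MonoidAlgebra ℂ Q))
    (h : {χ : Q →* ℂˣ | ∀ f ∈ I, ev χ f = 0}.Countable) :
    Module.Finite ℂ (MonoidAlgebra ℂ Q ⧸ I) := by
  have : Algebra.FiniteType ℂ (MonoidAlgebra ℂ Q) := inferInstance
  have : Algebra.FiniteType ℂ (MonoidAlgebra ℂ Q ⧸ I) :=
    Algebra.FiniteType.of_surjective (Ideal.Quotient.mkₐ ℂ I) (Ideal.Quotient.mkₐ_surjective ℂ I)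
  have := h.to_subtype
  let F : (MonoidAlgebra ℂ Q ⧸ I →ₐ[ℂ] ℂ) → (Q →* ℂˣ) := fun φ =>
    MonoidHom.toHomUnits ((MonoidAlgebra.lift ℂ ℂ Q).symm (φ.comp (Ideal.Quotient.mkₐ ℂ I)))
  have hF : ∀ φ, ev (F φ) = φ.comp (Ideal.Quotient.mkₐ ℂ I) := fun φ => by
    refine (MonoidAlgebra.lift ℂ ℂ Q).symm.injective (MonoidHom.ext fun q => ?_)
    exact ev_of (F φ) q
  have hmem : ∀ φ, F φ ∈ {χ : Q →* ℂˣ | ∀ f ∈ I, ev χ f = 0} := fun φ f hf => by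
    rw [hF]
    change φ (Ideal.Quotient.mk I f) = 0
    rw [Ideal.Quotient.eq_zero_iff_mem.mpr hf, map_zero]
  have hinj : Function.Injective fun φ => (⟨F φ, hmem φ⟩ : {χ : Q →* ℂˣ | ∀ f ∈ I, ev χ f = 0}) := by
    intro φ ψ h
    have h1 : F φ = F ψ := congrArg Subtype.val h
    have h2 := hF φ
    rw [h1, hF] at h2
    refine AlgHom.ext fun x => ?_
    obtain ⟨y, rfl⟩ := Ideal.Quotient.mk_surjective x
    exact (DFunLike.congr_fun h2 y).symm
  have : Countable (MonoidAlgebra ℂ Q ⧸ I →ₐ[ℂ] ℂ) := hinj.countable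
  exact finite_of_countable_algHom

theorem finite_zeros {f : MonoidAlgebra ℂ (Multiplicative ℤ)} (hf : f ≠ 0) :
    {χ : Multiplicative ℤ →* ℂˣ | ev χ f = 0}.Finite := by
  classical
  let s := f.coeff.support
  -- A shift by `N` makes all exponents nonnegative, which turns the Laurent polynomial into a
  -- polynomial with the same nonzero roots.
  let N : ℕ := s.sup fun q => (Multiplicative.toAdd q).natAbs
  have hN : ∀ q ∈ s, 0 ≤ Multiplicative.toAdd q + N := fun q hq => by
    have : (Multiplicative.toAdd q).natAbs ≤ N := Finset.le_sup (f := fun q : Multiplicative ℤ =>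
      (Multiplicative.toAdd q).natAbs) hq
    omega
  let p : Polynomial ℂ := ∑ q ∈ s, Polynomial.monomial (Multiplicative.toAdd q + N).toNat (f.coeff q)
  have hp : p ≠ 0 := by
    obtain ⟨q₀, hq₀⟩ : s.Nonempty := Finsupp.support_nonempty_iff.mpr fun h =>
      hf (MonoidAlgebra.coeff_eq_zero.mp h)
    intro h
    have h1 : p.coeff (Multiplicative.toAdd q₀ + N).toNat = f.coeff q₀ := by
      simp only [p, Polynomial.finsetSum_coeff, Polynomial.coeff_monomial]
      rw [Finset.sum_eq_single q₀]
      · simp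
      · intro q hq hne
        rw [if_neg]
        intro h2
        refine hne (Multiplicative.toAdd.injective ?_)
        have := hN q hq
        have := hN q₀ hq₀
        omega
      · exact fun h => absurd hq₀ h
    rw [h, Polynomial.coeff_zero] at h1
    exact Finsupp.mem_support_iff.mp hq₀ h1.symm
  have heval : ∀ χ : Multiplicative ℤ →* ℂˣ, ∀ q ∈ s,
      ((χ (Multiplicative.ofAdd 1) : ℂˣ) : ℂ) ^ (Multiplicative.toAdd q + N).toNat =
        (χ (Multiplicative.ofAdd 1) : ℂ) ^ N * χ q := fun χ q hq => by
    have h1 : q = Multiplicative.ofAdd (1 : ℤ) ^ (Multiplicative.toAdd q) := by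
      rw [← ofAdd_zsmul]
      simp
    conv_rhs => rw [h1]
    rw [map_zpow, ← zpow_natCast, Int.toNat_of_nonneg (hN q hq), ← Units.val_pow_eq_pow_val,
      ← Units.val_mul, ← Units.val_zpow_eq_zpow_val, zpow_add, mul_comm, zpow_natCast]
  refine Set.Finite.of_finite_image (f := fun χ : Multiplicative ℤ →* ℂˣ =>
    ((χ (Multiplicative.ofAdd 1) : ℂˣ) : ℂ)) ((p.rootSet_finite ℂ).subset ?_) ?_
  · rintro _ ⟨χ, hχ, rfl⟩
    rw [Polynomial.mem_rootSet]
    refine ⟨hp, ?_⟩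
    simp only [p, Polynomial.coe_aeval_eq_eval, Polynomial.eval_finsetSum,
      Polynomial.eval_monomial]
    have h2 : ev χ f = 0 := hχ
    rw [ev_apply] at h2
    calc _ = ∑ q ∈ s, (χ (Multiplicative.ofAdd 1) : ℂ) ^ N * (f.coeff q * χ q) :=
          Finset.sum_congr rfl fun q hq => by rw [heval χ q hq]; ring
      _ = 0 := by rw [← Finset.mul_sum, h2, mul_zero]
  · intro χ _ ψ _ h
    exact MonoidHom.ext_mint (Units.ext h)

theorem finite_quotient_of_ne_zero {f : MonoidAlgebra ℂ (Multiplicative ℤ)} (hf : f ≠ 0)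
    {I : Ideal (MonoidAlgebra ℂ (Multiplicative ℤ))} (hI : f ∈ I) :
    Module.Finite ℂ (MonoidAlgebra ℂ (Multiplicative ℤ) ⧸ I) :=
  finite_quotient_of_countable I ((finite_zeros hf).countable.mono fun _ hχ => hχ f hI)

instance : IsDomain (MonoidAlgebra ℂ (Multiplicative ℤ)) :=
  NoZeroDivisors.to_isDomain _

instance [Group.FG Q] : IsNoetherianRing (MonoidAlgebra ℂ Q) :=
  Algebra.FiniteType.isNoetherianRing ℂ _

/-- The generator is `T - χ(T)`: modulo it `T` is a scalar, so every element equals its value at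
`χ`. -/
theorem exists_principal (χ : Multiplicative ℤ →* ℂˣ) :
    ∃ a : MonoidAlgebra ℂ (Multiplicative ℤ), a ≠ 0 ∧ ev χ a = 0 ∧ ∀ f, ev χ f = 0 → a ∣ f := by
  let T := MonoidAlgebra.of ℂ (Multiplicative ℤ) (Multiplicative.ofAdd 1)
  let c : ℂ := χ (Multiplicative.ofAdd 1)
  refine ⟨T - algebraMap ℂ _ c, fun h => ?_, ?_, fun f hf => ?_⟩
  · let ψ : Multiplicative ℤ →* ℂˣ := zpowersHom _ (χ (Multiplicative.ofAdd 1) * Units.mk0 2 two_ne_zero)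
    have h1 := congrArg (ev ψ) h
    rw [map_sub, ev_of, AlgHom.commutes, map_zero, sub_eq_zero] at h1
    have h2 : (ψ (Multiplicative.ofAdd 1) : ℂ) = c * 2 := by simp [ψ, c]
    rw [h2] at h1
    have h3 : c ≠ 0 := Units.ne_zero _
    have h4 : c * 2 = c * 1 := by rw [mul_one]; exact h1
    have := mul_left_cancel₀ h3 h4
    norm_num at this
  · rw [map_sub, ev_of, AlgHom.commutes]
    exact sub_self _
  · let I := Ideal.span {T - algebraMap ℂ (MonoidAlgebra ℂ (Multiplicative ℤ)) c}
    have h1 : Ideal.Quotient.mkₐ ℂ I = (Algebra.ofId ℂ _).comp (ev χ) := by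
      refine (MonoidAlgebra.lift ℂ _ (Multiplicative ℤ)).symm.injective
        (MonoidHom.ext_mint ?_)
      change Ideal.Quotient.mk I T = algebraMap ℂ _ (ev χ T)
      rw [ev_of]
      exact Ideal.Quotient.eq.mpr (Ideal.subset_span rfl)
    have h2 := DFunLike.congr_fun h1 f
    rw [AlgHom.comp_apply, hf, map_zero] at h2
    exact Ideal.mem_span_singleton.mp (Ideal.Quotient.eq_zero_iff_mem.mp h2)

end GroupAlgebra

/-! ### Characters of free abelian groups -/

section LatticeCharacters

variable {m : ℕ}

/-- The character of a lattice with given values on the standard basis. -/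
def latticeChar (c : Fin m → ℂˣ) : Multiplicative (Fin m → ℤ) →* ℂˣ where
  toFun u := ∏ i, c i ^ (Multiplicative.toAdd u i)
  map_one' := by simp
  map_mul' u v := by simp [zpow_add, Finset.prod_mul_distrib]

theorem exists_char_ne {u v : Multiplicative (Fin m → ℤ)} (h : u ≠ v) :
    ∃ χ : Multiplicative (Fin m → ℤ) →* ℂˣ, χ u ≠ χ v := by
  classical
  obtain ⟨i, hi⟩ : ∃ i, Multiplicative.toAdd u i ≠ Multiplicative.toAdd v i := by
    by_contra! hc
    exact h (Multiplicative.toAdd.injective (funext hc))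
  let a : ℂˣ := Units.mk0 2 two_ne_zero
  refine ⟨latticeChar (Function.update (1 : Fin m → ℂˣ) i a), fun he => hi ?_⟩
  have key : ∀ w : Multiplicative (Fin m → ℤ),
      latticeChar (Function.update (1 : Fin m → ℂˣ) i a) w = a ^ Multiplicative.toAdd w i := fun w => by
    change ∏ j : Fin m, Function.update (1 : Fin m → ℂˣ) i a j ^ Multiplicative.toAdd w j = _
    rw [Finset.prod_eq_single i]
    · simp
    · intro j _ hj
      simp [hj]
    · exact fun h => absurd (Finset.mem_univ _) h
  rw [key, key] at he
  have h2 : (2 : ℝ) ^ Multiplicative.toAdd u i = 2 ^ Multiplicative.toAdd v i := by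
    have := congrArg (fun z : ℂˣ => ‖(z : ℂ)‖) he
    simpa [a] using this
  exact zpow_right_injective₀ two_pos (by norm_num) h2

/-- A linear combination of characters of the torus which vanishes identically is trivial. -/
theorem sum_fiber_eq_zero {ι : Type*} [DecidableEq (Multiplicative (Fin m → ℤ))] (s : Finset ι)
    (c : ι → ℂ) (g : ι → Multiplicative (Fin m → ℤ))
    (h : ∀ χ : Multiplicative (Fin m → ℤ) →* ℂˣ, ∑ a ∈ s, c a * χ (g a) = 0)
    (u : Multiplicative (Fin m → ℤ)) : ∑ a ∈ s with g a = u, c a = 0 := by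
  let Φ : Multiplicative (Fin m → ℤ) → ((Multiplicative (Fin m → ℤ) →* ℂˣ) →* ℂ) := fun u =>
    (Units.coeHom ℂ).comp (MonoidHom.eval u)
  have hΦ : Function.Injective Φ := by
    intro u v huv
    by_contra hne
    obtain ⟨χ, hχ⟩ := exists_char_ne hne
    exact hχ (Units.ext (DFunLike.congr_fun huv χ))
  -- Dedekind's independence of characters, for evaluations at distinct lattice points viewed as
  -- characters of the torus.
  have hli := (linearIndependent_monoidHom (Multiplicative (Fin m → ℤ) →* ℂˣ) ℂ).comp Φ hΦ
  have h1 : ∑ u ∈ s.image g, (∑ a ∈ s with g a = u, c a) •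
      ((fun f => f : ((Multiplicative (Fin m → ℤ) →* ℂˣ) →* ℂ) → _ → ℂ) ∘ Φ) u = 0 := by
    funext χ
    rw [Finset.sum_apply, Pi.zero_apply, ← h χ, ← Finset.sum_fiberwise_of_maps_to
      (s := s) (t := s.image g) (g := g) fun a ha => Finset.mem_image_of_mem g ha]
    refine Finset.sum_congr rfl fun u _ => ?_
    rw [Pi.smul_apply, smul_eq_mul, Finset.sum_mul]
    refine Finset.sum_congr rfl fun a ha => ?_
    rw [← (Finset.mem_filter.mp ha).2]
    rfl
  by_cases hu : u ∈ s.image g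
  · exact linearIndependent_iff'.mp hli _ _ h1 u hu
  · rw [Finset.sum_eq_zero]
    intro a ha
    exact absurd (Finset.mem_image.mpr ⟨a, (Finset.mem_filter.mp ha).1, (Finset.mem_filter.mp ha).2⟩) hu

/-- A character is determined by its values on the standard basis, and these are roots of unity. -/
theorem countable_torsion_chars :
    {χ : Multiplicative (Fin m → ℤ) →* ℂˣ | ∀ u, ∃ n : ℕ, 0 < n ∧ χ u ^ n = 1}.Countable := by
  have hroots : {z : ℂˣ | ∃ n : ℕ, 0 < n ∧ z ^ n = 1}.Countable := by
    have : {z : ℂˣ | ∃ n : ℕ, 0 < n ∧ z ^ n = 1} ⊆ ⋃ n : ℕ, {z : ℂˣ | 0 < n ∧ z ^ n = 1} := by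
      rintro z ⟨n, hn⟩
      exact Set.mem_iUnion.mpr ⟨n, hn⟩
    refine (Set.countable_iUnion fun n => ?_).mono this
    rcases Nat.eq_zero_or_pos n with rfl | hn
    · simp
    · have : NeZero n := ⟨hn.ne'⟩
      have hfin : Finite ((rootsOfUnity n ℂ : Subgroup ℂˣ) : Set ℂˣ) :=
        inferInstanceAs (Finite (rootsOfUnity n ℂ))
      refine Set.Finite.countable ((Set.toFinite (rootsOfUnity n ℂ : Set ℂˣ)).subset ?_)
      rintro z ⟨-, hz⟩
      exact (mem_rootsOfUnity n z).mpr hz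
  let F : (Multiplicative (Fin m → ℤ) →* ℂˣ) → (Fin m → ℂˣ) := fun χ i =>
    χ (Multiplicative.ofAdd (Pi.single i 1))
  have hF : Function.Injective F := by
    intro χ ψ h
    refine MonoidHom.ext fun u => ?_
    have hu : u = ∏ i, Multiplicative.ofAdd (Pi.single i (1 : ℤ)) ^ Multiplicative.toAdd u i := by
      refine Multiplicative.toAdd.injective (funext fun j => ?_)
      simp [toAdd_prod, Finset.sum_apply, Pi.single_apply]
    rw [hu, map_prod, map_prod]
    refine Finset.prod_congr rfl fun i _ => ?_
    rw [map_zpow, map_zpow]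
    exact congrArg (· ^ _) (congrFun h i)
  have hpre := (Set.countable_univ_pi fun _ : Fin m => hroots).preimage hF
  refine hpre.mono ?_
  intro χ hχ i _
  exact hχ _

/-- An element of infinite order of a finitely generated abelian group is detected by a complex
functional. -/
theorem exists_hom_ne_zero {M : Type*} [AddCommGroup M] [Module.Finite ℤ M] {q : M}
    (hq : ∀ n : ℕ, 0 < n → n • q ≠ 0) : ∃ a : M →+ ℂ, a q ≠ 0 := by
  let T := M ⧸ Submodule.torsion ℤ M
  have hne : (Submodule.torsion ℤ M).mkQ q ≠ 0 := by
    intro h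
    rw [Submodule.mkQ_apply, Submodule.Quotient.mk_eq_zero, Submodule.mem_torsion_iff] at h
    obtain ⟨⟨n, hn⟩, h⟩ := h
    have hn0 : n ≠ 0 := nonZeroDivisors.ne_zero hn
    have h' : n • q = 0 := h
    refine hq n.natAbs (Int.natAbs_pos.mpr hn0) ?_
    rw [← natCast_zsmul, Int.natCast_natAbs]
    rcases abs_choice n with e | e
    · rw [e, h']
    · rw [e, neg_smul, h', neg_zero]
  let b := Module.Free.chooseBasis ℤ (M ⧸ Submodule.torsion ℤ M)
  obtain ⟨i, hi⟩ : ∃ i, b.repr ((Submodule.torsion ℤ M).mkQ q) i ≠ 0 := by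
    by_contra! hc
    exact hne (b.repr.map_eq_zero_iff.mp (Finsupp.ext hc))
  refine ⟨(Int.castAddHom ℂ).comp ((b.coord i).toAddMonoidHom.comp
    (Submodule.torsion ℤ M).mkQ.toAddMonoidHom), ?_⟩
  exact Int.cast_ne_zero.mpr hi

end LatticeCharacters

/-! ### Singular homology and homology with local coefficients, on chains -/

section Quotients

variable {k M : Type*} [Field k] [AddCommGroup M] [Module k M] {Z B : Submodule k M}

theorem subsingleton_quotient_iff : Subsingleton (Z ⧸ B.submoduleOf Z) ↔ Z ≤ B := by
  rw [Submodule.Quotient.subsingleton_iff, Submodule.submoduleOf_eq_top]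

theorem finite_quotient_iff : Module.Finite k (Z ⧸ B.submoduleOf Z) ↔ FGMod False Z B := by
  constructor
  · intro h
    obtain ⟨N, -, hN, hle⟩ := exists_fg_lift ((B.submoduleOf Z).mkQ) (W := ⊤) (by
      rw [Submodule.map_top, Submodule.range_mkQ]
      exact Module.Finite.fg_top)
    refine ⟨N.map Z.subtype, hN.map _, False.elim, fun z hz => ?_⟩
    obtain ⟨n, hn, e⟩ : (B.submoduleOf Z).mkQ ⟨z, hz⟩ ∈ N.map (B.submoduleOf Z).mkQ := by
      rw [hle]
      exact ⟨_, trivial, rfl⟩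
    have h1 : (⟨z, hz⟩ : Z) - n ∈ B.submoduleOf Z := (Submodule.Quotient.eq _).mp e.symm
    have h2 : z - (n : M) ∈ B := h1
    rw [← add_sub_cancel (n : M) z]
    exact Submodule.add_mem_sup ⟨n, hn, rfl⟩ h2
  · intro h
    obtain ⟨N, hNZ, hN, -, hle⟩ := h.exists_le LinearMap.id (W := Z) (D := B) (fun x hx => hx)
      fun x _ hx => hx
    have : Module.Finite k N := Module.Finite.iff_fg.mpr hN
    refine Module.Finite.of_surjective ((B.submoduleOf Z).mkQ ∘ₗ Submodule.inclusion hNZ) ?_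
    intro q
    obtain ⟨⟨z, hz⟩, rfl⟩ := Submodule.mkQ_surjective _ q
    obtain ⟨n, hn, b, hb, rfl⟩ := Submodule.mem_sup.mp (hle hz)
    refine ⟨⟨n, hn⟩, (Submodule.Quotient.eq _).mpr ?_⟩
    change n - (n + b) ∈ B
    rw [sub_add_cancel_left]
    exact B.neg_mem hb

end Quotients

section ShortComplexes

variable (S : ShortComplex (ModuleCat.{u} ℂ)) {Z B : Submodule ℂ S.X₂}

/-- The homology of a short complex of vector spaces as a subquotient. -/
def homologyEquiv (hZ : LinearMap.ker S.g.hom = Z) (hB : LinearMap.range S.f.hom = B) :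
    S.homology ≃ₗ[ℂ] Z ⧸ B.submoduleOf Z :=
  S.moduleCatHomologyIso.toLinearEquiv.trans (Submodule.Quotient.equiv _ _
    (LinearEquiv.ofEq _ _ hZ) (by
      subst hZ hB
      ext ⟨x, hx⟩
      constructor
      · rintro ⟨_, ⟨y, rfl⟩, h⟩
        exact ⟨y, congrArg Subtype.val h⟩
      · rintro ⟨y, h⟩
        exact ⟨_, ⟨y, rfl⟩, Subtype.ext h⟩))

end ShortComplexes

/-! ### Degreewise singular complexes and their comparison with twisted homology. -/

section Complexes

variable {X : Type u} [TopologicalSpace X] {R : Type*} [CommRing R] (w : LocSys X R)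

/-- The boundary operator in a given degree. -/
def LocSys.dd (i : ℕ) : (Simp X (i + 1) →₀ R) →ₗ[R] (Simp X i →₀ R) :=
  Finsupp.linearCombination R fun σ => ∑ j : Fin (i + 2),
    Finsupp.single (pull j.succAbove σ) ((-1) ^ (j : ℕ) * (w.edge σ 0 (j.succAbove 0) : R))

theorem LocSys.dd_single (i : ℕ) (σ : Simp X (i + 1)) (r : R) :
    w.dd i (Finsupp.single σ r) = r • ∑ j : Fin (i + 2),
      Finsupp.single (pull j.succAbove σ) ((-1) ^ (j : ℕ) * (w.edge σ 0 (j.succAbove 0) : R)) := by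
  simp [LocSys.dd]

/-- Chains in a single degree. -/
def chInc (X : Type u) [TopologicalSpace X] (R : Type*) [CommRing R] (i : ℕ) :
    (Simp X i →₀ R) →ₗ[R] Ch X R :=
  Finsupp.lmapDomain R R (Sigma.mk i)

theorem chInc_single (i : ℕ) (σ : Simp X i) (r : R) :
    chInc X R i (Finsupp.single σ r) = Finsupp.single ⟨i, σ⟩ r := by
  simp [chInc]

theorem chInc_injective (i : ℕ) : Function.Injective (chInc X R i) :=
  Finsupp.mapDomain_injective sigma_mk_injective

theorem bd_chInc (i : ℕ) (x : Simp X (i + 1) →₀ R) :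
    w.bd (chInc X R (i + 1) x) = chInc X R i (w.dd i x) := by
  induction x using Finsupp.induction_linear with
  | zero => simp
  | add x y hx hy => simp only [map_add, hx, hy]
  | single σ r =>
    rw [chInc_single, w.bd_single, w.dd_single, map_smul, map_sum, LocSys.bdS]
    simp only [chInc_single]

theorem LocSys.dd_dd (i : ℕ) (x : Simp X (i + 1 + 1) →₀ R) : w.dd i (w.dd (i + 1) x) = 0 := by
  refine chInc_injective i ?_
  rw [← bd_chInc, ← bd_chInc, w.bd_bd, map_zero]

theorem chInc_mem (i : ℕ) (x : Simp X i →₀ R) : chInc X R i x ∈ chIn R i (Set.univ : Set X) := by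
  induction x using Finsupp.induction_linear with
  | zero => simp
  | add x y hx hy => rw [map_add]; exact add_mem hx hy
  | single σ r =>
    rw [chInc_single]
    exact single_mem_chIn (Set.subset_univ _) r

theorem exists_chInc_eq {i : ℕ} {x : Ch X R} (hx : x ∈ chIn R i (Set.univ : Set X)) :
    ∃ y, chInc X R i y = x := by
  refine map_mem_of_chIn (f := LinearMap.id) (S := LinearMap.range (chInc X R i))
    (fun σ _ => ⟨Finsupp.single σ 1, chInc_single i σ 1⟩) hx

theorem chInc_mem_relZ {i : ℕ} {x : Simp X i →₀ R} (hx : x ∈ cyc w.dd i) :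
    chInc X R i x ∈ relZ w i (Set.univ : Set X) ∅ := by
  refine ⟨chInc_mem i x, ?_⟩
  change w.bd (chInc X R i x) ∈ chA R ∅
  cases i with
  | zero => rw [bd_zero_degree w (chInc_mem 0 x)]; exact zero_mem _
  | succ i =>
    have : w.dd i x = 0 := hx
    rw [bd_chInc, this, map_zero]
    exact zero_mem _

theorem mem_bnd_of_chInc_mem {i : ℕ} {x : Simp X i →₀ R}
    (hx : chInc X R i x ∈ relD w i (Set.univ : Set X) ∅) : x ∈ bnd w.dd i := by
  rw [relD, chIn_empty, sup_bot_eq] at hx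
  obtain ⟨y, hy, e⟩ := hx
  obtain ⟨y, rfl⟩ := exists_chInc_eq hy
  rw [bd_chInc] at e
  exact ⟨y, chInc_injective i e⟩

theorem spec_dd {k : Type*} [Field k] (π : R →+* k) {w' : LocSys X k}
    (h : ∀ {x y : X} (γ : Path.Homotopic.Quotient x y), π (w.tr γ) = w'.tr γ) (i : ℕ) :
    spec π (w.dd i) = w'.dd i := by
  ext σ : 1
  refine LinearMap.ext_ring ?_
  have := spec_specMap π (w.dd i) (Finsupp.single σ 1)
  rw [specMap_single, map_one] at this
  simp only [LinearMap.comp_apply, Finsupp.lsingle_apply]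
  rw [this, w.dd_single, w'.dd_single, one_smul, one_smul, map_sum]
  refine Finset.sum_congr rfl fun j _ => ?_
  rw [specMap_single, map_mul, map_pow, map_neg, map_one]
  congr 2
  exact h _

theorem fgMod_cyc [T2Space X] [Topology.CWComplex (Set.univ : Set X)] [IsNoetherianRing R] {K : ℕ}
    (hfin : ∀ n ≤ K, Finite (Topology.RelCWComplex.cell (Set.univ : Set X) n)) {i : ℕ}
    (hi : i ≤ K) : FGMod False (cyc w.dd i) (bnd w.dd i) :=
  (fgMod_homology w hfin hi).pull (chInc X R i) (fun _ hx => chInc_mem_relZ w hx)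
    fun _ _ hx => mem_bnd_of_chInc_mem w hx

variable [PathConnectedSpace X] {x₀ : X}

/-- The local system associated with a character. -/
def LocSys.ofChar (φ : FundamentalGroup X x₀ →* Rˣ) : LocSys X R where
  tr γ := transport φ γ
  tr_trans γ δ := transport_trans φ γ δ

/-- The complex which defines the homology with coefficients in a local system. -/
abbrev twistedComplex (ρ : FundamentalGroup X x₀ →* ℂˣ) : ChainComplex (ModuleCat.{u} ℂ) ℕ :=
  (AlgebraicTopology.alternatingFaceMapComplex (ModuleCat.{u} ℂ)).obj (twistedSimplicial ρ)

theorem twistedComplex_d (ρ : FundamentalGroup X x₀ →* ℂˣ) (i : ℕ) :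
    ((twistedComplex ρ).d (i + 1) i).hom = (LocSys.ofChar ρ).dd i := by
  have h : ((twistedComplex ρ).d (i + 1) i).hom = (∑ j : Fin (i + 2), ((-1 : ℤ) ^ (j : ℕ)) •
      Finsupp.linearCombination ℂ fun σ : Simp X (i + 1) => Finsupp.single (pull j.succAbove σ)
        ((edgeWeight ρ σ 0 (j.succAbove 0) : ℂˣ) : ℂ) :
      (Simp X (i + 1) →₀ ℂ) →ₗ[ℂ] (Simp X i →₀ ℂ)) := by
    refine (congrArg ModuleCat.Hom.hom
      (AlgebraicTopology.AlternatingFaceMapComplex.obj_d_eq (twistedSimplicial ρ) i)).trans ?_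
    exact (ModuleCat.hom_sum _ _).trans (Finset.sum_congr rfl fun j _ => ModuleCat.hom_zsmul _ _)
  refine h.trans (Finsupp.lhom_ext fun σ r => ?_)
  rw [LocSys.dd_single, LinearMap.sum_apply, Finset.smul_sum]
  refine Finset.sum_congr rfl fun j _ => ?_
  rw [LinearMap.smul_apply, Finsupp.linearCombination_single, Finsupp.smul_single,
    Finsupp.smul_single, Finsupp.smul_single]
  congr 1
  simp only [zsmul_eq_mul, smul_eq_mul]
  push_cast
  change _ = r * ((-1) ^ (j : ℕ) * ((edgeWeight ρ σ 0 (j.succAbove 0) : ℂˣ) : ℂ))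
  ring

/-- Homology with coefficients in a local system as a subquotient of the chains. -/
def twistedHomologyEquiv (ρ : FundamentalGroup X x₀ →* ℂˣ) (i : ℕ) :
    twistedHomology ρ i ≃ₗ[ℂ] cyc (LocSys.ofChar ρ).dd i ⧸
      (bnd (LocSys.ofChar ρ).dd i).submoduleOf (cyc (LocSys.ofChar ρ).dd i) :=
  match i with
  | 0 => ((twistedComplex ρ).homologyIsoSc' 1 0 0 (by simp) (by simp)).toLinearEquiv.trans
      (homologyEquiv ((twistedComplex ρ).sc' 1 0 0)
        (Z := cyc (LocSys.ofChar ρ).dd 0) (B := bnd (LocSys.ofChar ρ).dd 0) (by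
          change LinearMap.ker ((twistedComplex ρ).d 0 0).hom = ⊤
          rw [(twistedComplex ρ).shape 0 0 (by simp)]
          exact LinearMap.ker_zero) (by
          change LinearMap.range ((twistedComplex ρ).d 1 0).hom = _
          exact congrArg LinearMap.range (twistedComplex_d ρ 0)))
  | i + 1 => ((twistedComplex ρ).homologyIsoSc' (i + 2) (i + 1) i (by simp) (by simp)).toLinearEquiv.trans
      (homologyEquiv ((twistedComplex ρ).sc' (i + 2) (i + 1) i)
        (Z := cyc (LocSys.ofChar ρ).dd (i + 1)) (B := bnd (LocSys.ofChar ρ).dd (i + 1)) 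
        (congrArg LinearMap.ker (twistedComplex_d ρ i))
        (congrArg LinearMap.range (twistedComplex_d ρ (i + 1))))

theorem mem_charVariety {ρ : FundamentalGroup X x₀ →* ℂˣ} {i : ℕ} :
    ρ ∈ charVariety x₀ i 1 ↔ ¬ cyc (LocSys.ofChar ρ).dd i ≤ bnd (LocSys.ofChar ρ).dd i := by
  rw [← subsingleton_quotient_iff, ← (twistedHomologyEquiv ρ i).toEquiv.subsingleton_congr,
    not_subsingleton_iff_nontrivial, ← rank_pos_iff_nontrivial (R := ℂ)]
  change ((1 : ℕ) : Cardinal) ≤ _ ↔ _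
  rw [Nat.cast_one, Cardinal.one_le_iff_pos]

theorem finite_twistedHomology {ρ : FundamentalGroup X x₀ →* ℂˣ} {i : ℕ} :
    Module.Finite ℂ (twistedHomology ρ i) ↔
      FGMod False (cyc (LocSys.ofChar ρ).dd i) (bnd (LocSys.ofChar ρ).dd i) := by
  rw [Module.Finite.equiv_iff (twistedHomologyEquiv ρ i),
    finite_quotient_iff]

end Complexes

/-! ### Coproducts of lines as free modules. -/

section Coproducts

open Limits

variable {T S T' S' : Type u}

/-- The inclusion of a basis element. -/
def basisMap (σ : S) : ModuleCat.of ℂ (ULift.{u} ℂ) ⟶ ModuleCat.of ℂ (S →₀ ℂ) :=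
  ModuleCat.ofHom ((Finsupp.lsingle σ).comp ULift.moduleEquiv.toLinearMap)

/-- The map from a free module to a coproduct. -/
def coproductInv (e : T ≃ S) :
    (S →₀ ℂ) →ₗ[ℂ] (∐ fun _ : T => ModuleCat.of ℂ (ULift.{u} ℂ) : ModuleCat.{u} ℂ) :=
  Finsupp.lsum ℂ fun σ : S =>
    (Sigma.ι (fun _ : T => ModuleCat.of ℂ (ULift.{u} ℂ)) (e.symm σ)).hom.comp
      ULift.moduleEquiv.symm.toLinearMap

theorem coproductInv_single (e : T ≃ S) (σ : S) (r : ℂ) :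
    coproductInv e (Finsupp.single σ r) =
      (Sigma.ι (fun _ : T => ModuleCat.of ℂ (ULift.{u} ℂ)) (e.symm σ)).hom (ULift.up r) := by
  rw [coproductInv, Finsupp.lsum_single]
  rfl

/-- Free modules as coproducts. -/
def coproductIso (e : T ≃ S) :
    (∐ fun _ : T => ModuleCat.of ℂ (ULift.{u} ℂ)) ≅ ModuleCat.of ℂ (S →₀ ℂ) where
  hom := Sigma.desc fun s => basisMap (e s)
  inv := ModuleCat.ofHom (coproductInv e)
  hom_inv_id := by
    refine Sigma.hom_ext _ _ fun s => ?_
    rw [Sigma.ι_desc_assoc]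
    refine ModuleCat.hom_ext (LinearMap.ext fun r => ?_)
    refine (coproductInv_single e (e s) r.down).trans ?_
    rw [Equiv.symm_apply_apply]
    rfl
  inv_hom_id := by
    refine ModuleCat.hom_ext (Finsupp.lhom_ext fun σ r => ?_)
    refine (congrArg (Sigma.desc fun s => basisMap (e s)).hom (coproductInv_single e σ r)).trans ?_
    have h := congrArg (fun f => f.hom (ULift.up r)) (Sigma.ι_desc
      (fun s => basisMap (e s)) (e.symm σ))
    refine h.trans ?_
    change Finsupp.single (e (e.symm σ)) r = Finsupp.single σ r
    rw [Equiv.apply_symm_apply]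

theorem map_coproductIso (e : T ≃ S) (e' : T' ≃ S') (g : T → T')
    (h : ModuleCat.of ℂ (S →₀ ℂ) ⟶ ModuleCat.of ℂ (S' →₀ ℂ))
    (hg : ∀ t r, h.hom (Finsupp.single (e t) r) = Finsupp.single (e' (g t)) r) :
    Sigma.map' (f := fun _ : T => ModuleCat.of ℂ (ULift.{u} ℂ)) (g := fun _ : T' => ModuleCat.of ℂ (ULift.{u} ℂ))
      g (fun _ => 𝟙 _) ≫ (coproductIso e').hom = (coproductIso e).hom ≫ h := by
  refine Sigma.hom_ext _ _ fun s => ?_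
  rw [coproductIso, coproductIso, Sigma.ι_comp_map'_assoc, Sigma.ι_desc, Sigma.ι_desc_assoc]
  refine ModuleCat.hom_ext (LinearMap.ext fun r => ?_)
  exact (hg s r.down).symm

end Coproducts

section Singular

open Limits

variable (E : Type u) [TopologicalSpace E]

/-- The simplicial vector space of singular chains. -/
abbrev singularSimplicial : SimplicialObject (ModuleCat.{u} ℂ) :=
  ((SimplicialObject.whiskering _ _).obj (sigmaConst.obj (ModuleCat.of ℂ (ULift.{u} ℂ)))).obj
    (TopCat.toSSet.obj (TopCat.of E))

variable [PathConnectedSpace E] (e₀ : E)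

theorem edgeWeight_one {A : Type*} [CommGroup A] {n : ℕ} (σ : Simp E n) (i j : Fin (n + 1)) :
    edgeWeight (1 : FundamentalGroup E e₀ →* A) σ i j = 1 := rfl

/-- Singular chains are chains with trivial coefficients. -/
def singularSimplicialIso :
    singularSimplicial E ≅ twistedSimplicial (1 : FundamentalGroup E e₀ →* ℂˣ) :=
  NatIso.ofComponents (fun n => coproductIso ((TopCat.of E).toSSetObjEquiv n)) fun {n m} f => by
    refine map_coproductIso _ _ _ _ fun t r => ?_
    refine (Finsupp.linearCombination_single ℂ r _).trans ?_
    refine (Finsupp.smul_single _ _ _).trans ?_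
    rw [edgeWeight_one, Units.val_one, smul_eq_mul, mul_one]
    rfl

theorem finite_singularHomology {i : ℕ} : Module.Finite ℂ (singularHomology E i) ↔
    FGMod False (cyc (LocSys.ofChar (1 : FundamentalGroup E e₀ →* ℂˣ)).dd i)
      (bnd (LocSys.ofChar (1 : FundamentalGroup E e₀ →* ℂˣ)).dd i) := by
  rw [← finite_twistedHomology]
  have e : singularHomology E i ≅ twistedHomology (1 : FundamentalGroup E e₀ →* ℂˣ) i :=
    (HomologicalComplex.homologyFunctor _ _ i).mapIso
      ((AlgebraicTopology.alternatingFaceMapComplex _).mapIso (singularSimplicialIso E e₀))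
  exact Module.Finite.equiv_iff e.toLinearEquiv

end Singular

/-! ### Chains on abelian covers -/

section Transport

variable {X : Type u} [TopologicalSpace X] [PathConnectedSpace X] {x₀ : X} {Q : Type*} [CommGroup Q]
  (ν : FundamentalGroup X x₀ →* Q)

/-- The chosen path from `x₀` to itself need not be constant, but it only conjugates the loop, and
the target is abelian. -/
theorem transport_loop (γ : Path.Homotopic.Quotient x₀ x₀) :
    transport ν γ = ν (FundamentalGroup.fromPath γ) := by
  let c : FundamentalGroup X x₀ := FundamentalGroup.fromPath (basePath x₀ x₀)
  have h1 : ν (FundamentalGroup.fromPath ((basePath x₀ x₀).trans γ)) =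
      ν c * ν (FundamentalGroup.fromPath γ) := by
    rw [mul_comm, ← map_mul, FundamentalGroup.mul_def]
  have h2 : ν (FundamentalGroup.fromPath (((basePath x₀ x₀).trans γ).trans (basePath x₀ x₀).symm)) =
      ν (FundamentalGroup.fromPath ((basePath x₀ x₀).trans γ)) * ν c⁻¹ := by
    rw [mul_comm, ← map_mul, FundamentalGroup.mul_def]
    rfl
  rw [transport, h2, h1, map_inv, mul_inv_cancel_comm]

theorem transport_refl (x : X) : transport ν (Path.Homotopic.Quotient.refl x) = 1 := by
  have h := transport_trans ν (Path.Homotopic.Quotient.refl x) (Path.Homotopic.Quotient.refl x)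
  rw [Path.Homotopic.Quotient.trans_refl] at h
  exact left_eq_mul.mp h

theorem exists_transport_eq (hν : Function.Surjective ν) (y : X) (q : Q) :
    ∃ γ : Path.Homotopic.Quotient x₀ y, transport ν γ = q := by
  obtain ⟨g, hg⟩ := hν (q * (transport ν (basePath x₀ y))⁻¹)
  refine ⟨(FundamentalGroup.toPath g).trans (basePath x₀ y), ?_⟩
  rw [transport_trans, transport_loop]
  change ν g * _ = q
  rw [hg, inv_mul_cancel_right]

end Transport

/-! ### Labelling the points of an abelian cover by the deck group. -/

section Label

variable {X E : Type u} [TopologicalSpace X] [PathConnectedSpace X] [TopologicalSpace E]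
  [PathConnectedSpace E] {p : C(E, X)} {e₀ : E} {Q : Type*} [CommGroup Q]
  (ν : FundamentalGroup X (p e₀) →* Q)

/-- The label of a point of a cover, in the group of deck transformations. -/
def label (e : E) : Q :=
  transport ν ((Path.Homotopic.Quotient.mk (PathConnectedSpace.somePath e₀ e)).map p)

variable {ν} (hker : (FundamentalGroup.map p e₀).range = ν.ker)

include hker

omit [PathConnectedSpace E] in
theorem transport_map_loop (γ : Path.Homotopic.Quotient e₀ e₀) : transport ν (γ.map p) = 1 := by
  rw [transport_loop, ← MonoidHom.mem_ker, ← hker]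
  exact ⟨FundamentalGroup.fromPath γ, rfl⟩

/-- Two paths from `e₀` to `e` differ by a loop of the cover, whose image lies in the kernel of `ν`;
the label does not depend on the chosen path. -/
theorem transport_map (e : E) (γ : Path.Homotopic.Quotient e₀ e) :
    transport ν (γ.map p) = label ν e := by
  let δ := Path.Homotopic.Quotient.mk (PathConnectedSpace.somePath e₀ e)
  have h1 := transport_map_loop hker (γ.trans δ.symm)
  have h2 := transport_map_loop hker (δ.trans δ.symm)
  have h3 : ∀ ε : Path.Homotopic.Quotient e₀ e, (ε.trans δ.symm).map p =
      (ε.map p).trans (δ.symm.map p) := fun ε => by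
    induction ε using Quotient.inductionOn with
    | h a =>
    exact congrArg Path.Homotopic.Quotient.mk
      (Path.map_trans a (PathConnectedSpace.somePath e₀ e).symm p.continuous)
  rw [h3, transport_trans] at h1 h2
  exact mul_right_cancel (h1.trans h2.symm)

theorem label_mul {e e' : E} (γ : Path.Homotopic.Quotient e e') :
    label ν e * transport ν (γ.map p) = label ν e' := by
  let δ := Path.Homotopic.Quotient.mk (PathConnectedSpace.somePath e₀ e)
  rw [← transport_map hker e' (δ.trans γ), label, ← transport_trans]
  congr 1
  induction γ using Quotient.inductionOn with
  | h a =>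
  exact (congrArg Path.Homotopic.Quotient.mk
    (Path.map_trans (PathConnectedSpace.somePath e₀ e) a p.continuous)).symm

variable (cov : IsCoveringMap p)

include cov

-- Paths with equal transport differ by an element of `ker ν`, that is by the image of a loop at
-- `e₀`, and such a loop acts trivially on `e₀`. This makes labels injective on fibres.
omit [PathConnectedSpace E] in
theorem monodromy_eq_of_transport_eq {y : X} {γ γ' : Path.Homotopic.Quotient (p e₀) y}
    (h : transport ν γ = transport ν γ') :
    cov.monodromy γ ⟨e₀, rfl⟩ = cov.monodromy γ' ⟨e₀, rfl⟩ := by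
  have h1 : transport ν (γ.trans γ'.symm) = 1 := by
    have h2 : transport ν (γ'.trans γ'.symm) = 1 := by
      rw [Path.Homotopic.Quotient.trans_symm, transport_refl]
    rw [transport_trans] at h2 ⊢
    rw [h, h2]
  rw [transport_loop, ← MonoidHom.mem_ker, ← hker] at h1
  obtain ⟨ε, hε⟩ := h1
  have h3 : (γ.trans γ'.symm) = (FundamentalGroup.toPath ε).map p := hε.symm
  have h4 : γ = ((FundamentalGroup.toPath ε).map p).trans γ' := by
    rw [← h3, Path.Homotopic.Quotient.trans_assoc, Path.Homotopic.Quotient.symm_trans,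
      Path.Homotopic.Quotient.trans_refl]
  rw [h4, cov.monodromy_trans_apply]
  congr 1
  exact cov.monodromy_map _

theorem label_injective {e e' : E} (h : p e = p e') (hl : label ν e = label ν e') : e = e' := by
  have key : ∀ (y : X) (e : E) (he : p e = y), ∃ γ : Path.Homotopic.Quotient (p e₀) y,
      transport ν γ = label ν e ∧ cov.monodromy γ ⟨e₀, rfl⟩ = ⟨e, he⟩ := by
    rintro y e rfl
    exact ⟨_, rfl, cov.monodromy_map _⟩
  obtain ⟨γ, h1, h2⟩ := key (p e') e h
  obtain ⟨γ', h1', h2'⟩ := key (p e') e' rfl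
  have h3 := monodromy_eq_of_transport_eq hker cov (h1.trans (hl.trans h1'.symm))
  rw [h2, h2'] at h3
  exact congrArg Subtype.val h3

theorem exists_label (hν : Function.Surjective ν) (y : X) (q : Q) :
    ∃ e : E, p e = y ∧ label ν e = q := by
  obtain ⟨γ, hγ⟩ := exists_transport_eq ν hν y q
  have h1 := cov.map_liftPathQuotient γ ⟨e₀, rfl⟩
  generalize cov.liftPathQuotient γ ⟨e₀, rfl⟩ = δ at h1
  generalize cov.monodromy γ ⟨e₀, rfl⟩ = e at δ h1
  obtain ⟨e, rfl⟩ := e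
  refine ⟨e, rfl, ?_⟩
  rw [← transport_map hker e δ, ← hγ]
  refine congrArg (transport ν) (h1.trans ?_)
  induction γ using Quotient.inductionOn with
  | h a => rfl

omit hker

-- The simplex is contracted linearly to its initial vertex, and the resulting homotopy, constant at
-- one end, is lifted.
omit [PathConnectedSpace X] [PathConnectedSpace E] in
theorem exists_simplex_lift {n : ℕ} (σ : Simp X n) {e : E} (he : p e = σ (stdSimplex.vertex 0)) :
    ∃ τ : Simp E n, p.comp τ = σ ∧ τ (stdSimplex.vertex 0) = e := by
  let v : stdSimplex ℝ (Fin (n + 1)) := stdSimplex.vertex 0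
  let C : C(unitInterval × stdSimplex ℝ (Fin (n + 1)), stdSimplex ℝ (Fin (n + 1))) :=
    ⟨fun q => ⟨(1 - (q.1 : ℝ)) • (v : Fin (n + 1) → ℝ) + (q.1 : ℝ) • (q.2 : Fin (n + 1) → ℝ),
      convex_stdSimplex ℝ _ v.2 q.2.2 (sub_nonneg.mpr q.1.2.2) q.1.2.1 (by ring)⟩, by fun_prop⟩
  have hC0 : ∀ x, C (0, x) = v := fun x => Subtype.ext (by simp [C]; rfl)
  have hC1 : ∀ x, C (1, x) = x := fun x => Subtype.ext (by simp [C]; rfl)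
  have hCv : ∀ t, C (t, v) = v := fun t => Subtype.ext (by
    change (1 - (t : ℝ)) • (v : Fin (n + 1) → ℝ) + (t : ℝ) • (v : Fin (n + 1) → ℝ) = v
    rw [← add_smul, sub_add_cancel, one_smul])
  have h0 : ∀ x, (σ.comp C) (0, x) = p (ContinuousMap.const _ e x) := fun x => by
    change σ (C (0, x)) = p e
    rw [hC0, he]
  let H := cov.liftHomotopy (σ.comp C) (ContinuousMap.const _ e) h0
  have hH : ∀ q, p (H q) = σ (C q) := fun q => congrFun (cov.liftHomotopy_lifts _ _ h0) q
  refine ⟨H.comp ⟨fun x => (1, x), by fun_prop⟩, ?_, ?_⟩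
  · ext x
    exact (hH (1, x)).trans (by rw [hC1])
  · have h1 : Continuous fun t : unitInterval => H (t, v) := by fun_prop
    have h2 := cov.const_of_comp h1 (fun t t' => by rw [hH, hH, hCv, hCv]) 1 0
    exact h2.trans (cov.liftHomotopy_zero _ _ h0 v)

end Label

/-! ### Chains of the cover as chains of the base over the group algebra. -/

section CoverChains

variable {X E : Type u} [TopologicalSpace X] [PathConnectedSpace X] [TopologicalSpace E]
  [PathConnectedSpace E] {p : C(E, X)} {e₀ : E} {Q : Type*} [CommGroup Q]
  {ν : FundamentalGroup X (p e₀) →* Q}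

/-- The local system with fibre the group algebra. -/
def groupSys {x₀ : X} (ν : FundamentalGroup X x₀ →* Q) : LocSys X (MonoidAlgebra ℂ Q) :=
  LocSys.ofChar ((MonoidHom.toHomUnits (MonoidAlgebra.of ℂ Q)).comp ν)

theorem groupSys_edge {x₀ : X} (ν : FundamentalGroup X x₀ →* Q) {n : ℕ} (σ : Simp X n)
    (i j : Fin (n + 1)) :
    ((groupSys ν).edge σ i j : MonoidAlgebra ℂ Q) = MonoidAlgebra.of ℂ Q (edgeWeight ν σ i j) :=
  rfl

variable (hker : (FundamentalGroup.map p e₀).range = ν.ker) (cov : IsCoveringMap p)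
  (hν : Function.Surjective ν)

/-- Simplices of a cover correspond to labelled simplices of the base. -/
def simplexEquiv (n : ℕ) : Simp E n ≃ Simp X n × Q :=
  Equiv.ofBijective (fun τ => (p.comp τ, label ν (τ (stdSimplex.vertex 0)))) (by
    constructor
    · intro τ τ' h
      obtain ⟨h1, h2⟩ := Prod.mk.inj h
      have h3 : ∀ x, p (τ x) = p (τ' x) := fun x => DFunLike.congr_fun h1 x
      refine DFunLike.coe_injective (cov.eq_of_comp_eq τ.continuous τ'.continuous (funext h3)
        (stdSimplex.vertex 0) ?_)
      exact label_injective hker cov (h3 _) h2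
    · rintro ⟨σ, q⟩
      obtain ⟨e, he, rfl⟩ := exists_label hker cov hν (σ (stdSimplex.vertex 0)) q
      obtain ⟨τ, rfl, rfl⟩ := exists_simplex_lift cov σ he
      exact ⟨τ, rfl⟩)

/-- Chains of a cover are chains of the base with coefficients in the group algebra. -/
def coverChainEquiv (n : ℕ) : (Simp E n →₀ ℂ) ≃ₗ[ℂ] (Simp X n →₀ MonoidAlgebra ℂ Q) :=
  (Finsupp.domLCongr (simplexEquiv hker cov hν n)).trans
    ((Finsupp.curryLinearEquiv ℂ).trans
      (Finsupp.mapRange.linearEquiv (MonoidAlgebra.coeffLinearEquiv ℂ).symm))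

theorem coverChainEquiv_single {n : ℕ} (τ : Simp E n) (c : ℂ) :
    coverChainEquiv hker cov hν n (Finsupp.single τ c) = Finsupp.single (p.comp τ)
      (MonoidAlgebra.single (label ν (τ (stdSimplex.vertex 0))) c) := by
  simp only [coverChainEquiv, LinearEquiv.trans_apply, Finsupp.domLCongr_single]
  have h1 : Finsupp.curryLinearEquiv ℂ (Finsupp.single (simplexEquiv hker cov hν n τ) c) =
      Finsupp.single (p.comp τ) (Finsupp.single (label ν (τ (stdSimplex.vertex 0))) c) :=
    Finsupp.curry_single _ _
  rw [h1]
  refine (Finsupp.mapRange.linearEquiv_apply _ _).trans ?_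
  refine (Finsupp.mapRange_single).trans ?_
  rfl

/-- Passing to a face multiplies the label of the initial vertex by the edge weight, which is
precisely the twist in the boundary of `groupSys`. -/
theorem coverChainEquiv_dd (n : ℕ) (x : Simp E (n + 1) →₀ ℂ) :
    (groupSys ν).dd n (coverChainEquiv hker cov hν (n + 1) x) =
      coverChainEquiv hker cov hν n
        ((LocSys.ofChar (1 : FundamentalGroup E e₀ →* ℂˣ)).dd n x) := by
  induction x using Finsupp.induction_linear with
  | zero => simp
  | add x y hx hy => simp only [map_add, hx, hy]
  | single τ c =>
    rw [coverChainEquiv_single, LocSys.dd_single, LocSys.dd_single, map_smul, map_sum,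
      Finset.smul_sum, Finset.smul_sum]
    refine Finset.sum_congr rfl fun j _ => ?_
    have h1 : ((LocSys.ofChar (1 : FundamentalGroup E e₀ →* ℂˣ)).edge τ 0 (j.succAbove 0) : ℂ) = 1 :=
      rfl
    have h2 : (label ν (τ (stdSimplex.vertex 0))) * edgeWeight ν (p.comp τ) 0 (j.succAbove 0) =
        label ν (pull j.succAbove τ (stdSimplex.vertex 0)) := by
      have h3 := label_mul hker ((Path.Homotopic.Quotient.mk (PathConnectedSpace.somePath
        (stdSimplex.vertex 0) (stdSimplex.vertex (j.succAbove 0)))).map τ)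
      have h4 : pull j.succAbove τ (stdSimplex.vertex 0) = τ (stdSimplex.vertex (j.succAbove 0)) := by
        change τ (stdSimplex.map _ _) = _
        rw [stdSimplex.map_vertex]
      rw [h4]
      exact h3
    rw [h1, mul_one, coverChainEquiv_single, groupSys_edge, Finsupp.smul_single,
      Finsupp.smul_single]
    congr 1
    rw [← h2, smul_eq_mul, MonoidAlgebra.of_apply, mul_left_comm, MonoidAlgebra.single_mul_single,
      mul_one, MonoidAlgebra.smul_single]
    rcases Nat.even_or_odd (j : ℕ) with h | h <;> simp [h.neg_one_pow]

include hker cov hν in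
/-- The homology of a cover is the homology of the base with coefficients in the group algebra. -/
theorem finite_singularHomology_cover {i : ℕ} : Module.Finite ℂ (singularHomology E i) ↔
    FGMod False ((cyc (groupSys ν).dd i).restrictScalars ℂ)
      ((bnd (groupSys ν).dd i).restrictScalars ℂ) := by
  rw [finite_singularHomology E e₀]
  let F := coverChainEquiv hker cov hν
  have hd : ∀ n x, (groupSys ν).dd n (F (n + 1) x) = F n
      ((LocSys.ofChar (1 : FundamentalGroup E e₀ →* ℂˣ)).dd n x) := coverChainEquiv_dd hker cov hν
  have hZ : (cyc (LocSys.ofChar (1 : FundamentalGroup E e₀ →* ℂˣ)).dd i).map (F i).toLinearMap =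
      (cyc (groupSys ν).dd i).restrictScalars ℂ := by
    ext y
    obtain ⟨x, rfl⟩ := (F i).surjective y
    have h1 : F i x ∈ (cyc (LocSys.ofChar (1 : FundamentalGroup E e₀ →* ℂˣ)).dd i).map
        (F i).toLinearMap ↔ x ∈ cyc (LocSys.ofChar (1 : FundamentalGroup E e₀ →* ℂˣ)).dd i :=
      ⟨fun ⟨x', hx', h⟩ => (F i).injective h ▸ hx', fun h => ⟨x, h, rfl⟩⟩
    rw [h1, Submodule.restrictScalars_mem]
    cases i with
    | zero => exact Iff.rfl
    | succ i =>
      change _ = 0 ↔ (groupSys ν).dd i (F (i + 1) x) = 0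
      rw [hd, LinearEquiv.map_eq_zero_iff]
  have hB : (bnd (LocSys.ofChar (1 : FundamentalGroup E e₀ →* ℂˣ)).dd i).map (F i).toLinearMap =
      (bnd (groupSys ν).dd i).restrictScalars ℂ := by
    ext y
    constructor
    · rintro ⟨_, ⟨x, rfl⟩, rfl⟩
      exact ⟨F (i + 1) x, hd i x⟩
    · rintro ⟨x, rfl⟩
      obtain ⟨x, rfl⟩ := (F (i + 1)).surjective x
      exact ⟨_, ⟨x, rfl⟩, (hd i x).symm⟩
  rw [← hZ, ← hB]
  refine ⟨fun h => h.map _, fun h => ?_⟩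
  have h1 := h.map (F i).symm.toLinearMap
  rwa [← Submodule.map_comp, ← Submodule.map_comp, LinearEquiv.symm_comp, Submodule.map_id,
    Submodule.map_id] at h1

end CoverChains

/-! ### Annihilators of the homology with coefficients in a group algebra -/

section Annihilator

variable {X : Type u} [TopologicalSpace X] [PathConnectedSpace X] {x₀ : X} {Q : Type*} [CommGroup Q]
  (ν : FundamentalGroup X x₀ →* Q)

theorem spec_groupSys_dd (χ : Q →* ℂˣ) (i : ℕ) :
    spec (ev χ : MonoidAlgebra ℂ Q →+* ℂ) ((groupSys ν).dd i) =
      (LocSys.ofChar (χ.comp ν)).dd i :=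
  spec_dd _ _ (fun _ => ev_of χ _) i

/-- The ideal annihilating the homology groups of degree at most `k`. -/
def annIdeal (k : ℕ) : Ideal (MonoidAlgebra ℂ Q) where
  carrier := {f | ∀ i ≤ k, Kills (groupSys ν).dd f i}
  add_mem' hf hg i hi := Kills.add _ (hf i hi) (hg i hi)
  zero_mem' i _ z _ := by
    rw [zero_smul]
    exact zero_mem _
  smul_mem' c f hf i hi := Kills.mul_left _ (hf i hi) c

variable {ν} {k : ℕ}

theorem notMem_charVariety {f : MonoidAlgebra ℂ Q} (hf : f ∈ annIdeal ν k) {χ : Q →* ℂˣ}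
    (hχ : ev χ f ≠ 0) {j : ℕ} (hj : j ≤ k) : χ.comp ν ∉ charVariety x₀ j 1 := by
  rw [mem_charVariety, not_not]
  have h := exact_of_kills (ev χ : MonoidAlgebra ℂ Q →+* ℂ) (groupSys ν).dd_dd (ev_surjective χ) hχ
    (j := j) fun i hi => hf i (hi.trans hj)
  simpa only [spec_groupSys_dd] using h

variable [T2Space X] [Topology.CWComplex (Set.univ : Set X)] {K : ℕ}

/-- Only the union over degrees up to `k` is identified with a zero set: both implications use
annihilation or exactness in all lower degrees. -/
theorem exists_charVariety_iff [Group.FG Q]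
    (hfin : ∀ n ≤ K, Finite (Topology.RelCWComplex.cell (Set.univ : Set X) n)) (hk : k ≤ K)
    (χ : Q →* ℂˣ) :
    (∃ i ≤ k, χ.comp ν ∈ charVariety x₀ i 1) ↔ ∀ f ∈ annIdeal ν k, ev χ f = 0 := by
  constructor
  · rintro ⟨i, hi, h⟩ f hf
    by_contra hχ
    exact notMem_charVariety hf hχ hi h
  · intro h
    by_contra! hχ
    obtain ⟨f, hf, hf'⟩ := exists_kills (ev χ : MonoidAlgebra ℂ Q →+* ℂ) (groupSys ν).dd_dd
      (ev_surjective χ) (j := k) (fun i hi => fgMod_cyc _ hfin (hi.trans hk)) (fun i hi => by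
        have h1 := hχ i hi
        rw [mem_charVariety, not_not] at h1
        simpa only [spec_groupSys_dd] using h1)
    exact hf (h f hf')

/-- The characters may differ from degree to degree: each degree has its own nonzero annihilator,
and their product is nonzero in a domain. -/
theorem exists_mem_annIdeal_ne_zero {ν : FundamentalGroup X x₀ →* Multiplicative ℤ}
    (hfin : ∀ n ≤ K, Finite (Topology.RelCWComplex.cell (Set.univ : Set X) n)) (hk : k ≤ K)
    (h : ∀ i ≤ k, ∃ χ : Multiplicative ℤ →* ℂˣ, χ.comp ν ∉ charVariety x₀ i 1) :
    ∃ f ∈ annIdeal ν k, f ≠ 0 := by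
  have h1 : ∀ i ≤ k, ∃ f : MonoidAlgebra ℂ (Multiplicative ℤ), f ≠ 0 ∧
      Kills (groupSys ν).dd f i := fun i hi => by
    obtain ⟨χ, hχ⟩ := h i hi
    obtain ⟨a, ha0, ha1, ha⟩ := exists_principal χ
    rw [mem_charVariety, not_not] at hχ
    exact exists_kills_of_principal (ev χ : _ →+* ℂ) (groupSys ν).dd_dd (ev_surjective χ) ha0 ha
      (fgMod_cyc _ hfin (hi.trans hk)) (by simpa only [spec_groupSys_dd] using hχ) ha1
  choose! f hf0 hf using h1
  refine ⟨∏ i ∈ Finset.range (k + 1), f i, fun i hi => ?_,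
    Finset.prod_ne_zero_iff.mpr fun i hi => hf0 i (Finset.mem_range_succ_iff.mp hi)⟩
  rw [← Finset.prod_erase_mul _ _ (Finset.mem_range_succ_iff.mpr hi)]
  exact Kills.mul_left _ (hf i hi) _

-- For `q` with `a q ≠ 0`, a nonzero polynomial in `q` annihilates the homology in all degrees up to
-- `k`. Along the line through `a` the value at `q` runs through all nonzero complex numbers, so it
-- can avoid the roots.
omit [T2Space X] [Topology.CWComplex (Set.univ : Set X)] in
theorem exists_expChar_notMem
    (h : ∀ i ≤ k, FGMod False ((cyc (groupSys ν).dd i).restrictScalars ℂ)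
      ((bnd (groupSys ν).dd i).restrictScalars ℂ)) {a : Additive Q →+ ℂ} (ha : a ≠ 0) :
    ∃ t : ℂ, ∀ i ≤ k, (expChar (t • a)).comp ν ∉ charVariety x₀ i 1 := by
  obtain ⟨q, hq⟩ := DFunLike.ne_iff.mp ha
  have h1 : ∀ i ≤ k, ∃ p : Polynomial ℂ, p ≠ 0 ∧
      Kills (groupSys ν).dd (Polynomial.aeval (MonoidAlgebra.of ℂ Q q.toMul) p) i :=
    fun i hi => exists_aeval_smul_mem (h i hi) _
  choose! p hp0 hp using h1
  let P := ∏ i ∈ Finset.range (k + 1), p i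
  have hP0 : P ≠ 0 :=
    Finset.prod_ne_zero_iff.mpr fun i hi => hp0 i (Finset.mem_range_succ_iff.mp hi)
  have hP : Polynomial.aeval (MonoidAlgebra.of ℂ Q q.toMul) P ∈ annIdeal ν k := fun i hi => by
    change Kills _ (Polynomial.aeval _ (∏ i ∈ Finset.range (k + 1), p i)) i
    rw [← Finset.prod_erase_mul _ _ (Finset.mem_range_succ_iff.mpr hi), map_mul]
    exact Kills.mul_left _ (hp i hi) _
  -- Zero is excluded as well, so that `c` has a logarithm.
  obtain ⟨c, hc⟩ := (P.roots.toFinset ∪ {0}).exists_notMem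
  have hc0 : c ≠ 0 := fun h => hc (by simp [h])
  have hcP : P.eval c ≠ 0 := fun h => hc (by simp [h, hP0])
  refine ⟨Complex.log c / a q, fun i hi => notMem_charVariety hP (fun h0 => hcP ?_) hi⟩
  rw [← Polynomial.aeval_algHom_apply, ev_of] at h0
  have h2 : ((expChar ((Complex.log c / a q) • a) q.toMul : ℂˣ) : ℂ) = c := by
    change Complex.exp ((Complex.log c / a q) * a q) = c
    rw [div_mul_cancel₀ _ hq, Complex.exp_log hc0]
  rwa [h2, Polynomial.coe_aeval_eq_eval] at h0

theorem fgMod_of_finite_quotient [Group.FG Q]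
    (hfin : ∀ n ≤ K, Finite (Topology.RelCWComplex.cell (Set.univ : Set X) n)) (hk : k ≤ K)
    [Module.Finite ℂ (MonoidAlgebra ℂ Q ⧸ annIdeal ν k)] {i : ℕ} (hi : i ≤ k) :
    FGMod False ((cyc (groupSys ν).dd i).restrictScalars ℂ)
      ((bnd (groupSys ν).dd i).restrictScalars ℂ) :=
  fgMod_restrictScalars (I := annIdeal ν k) (fgMod_cyc _ hfin (hi.trans hk)) fun _ hf => hf i hi

end Annihilator

/-! ### From the homology of the cover to finiteness over the group algebra. -/

section Cover

theorem finite_directSum_iff {R ι : Type*} [CommRing R] [Fintype ι] (M : ι → Type*)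
    [∀ i, AddCommGroup (M i)] [∀ i, Module R (M i)] :
    Module.Finite R (DirectSum ι M) ↔ ∀ i, Module.Finite R (M i) := by
  classical
  exact ⟨fun _ i => Module.Finite.of_surjective (DirectSum.component R ι M i)
    fun x => ⟨DirectSum.lof R ι M i x, DirectSum.component.lof_self ..⟩,
    fun _ => inferInstanceAs (Module.Finite R (Π₀ i, M i))⟩

variable {X E : Type u} [TopologicalSpace X] [PathConnectedSpace X] {x₀ : X} [TopologicalSpace E]
  {Q : Type*} [CommGroup Q] {ν : FundamentalGroup X x₀ →* Q}

theorem IsCoverOf.finite_singularHomology {p : C(E, X)} (h : IsCoverOf ν p)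
    (hν : Function.Surjective ν) (k : ℕ) :
    FiniteDimensional ℂ (DirectSum (Fin (k + 1)) fun i => singularHomology E (i : ℕ)) ↔
      ∀ i ≤ k, FGMod False ((cyc (groupSys ν).dd i).restrictScalars ℂ)
        ((bnd (groupSys ν).dd i).restrictScalars ℂ) := by
  obtain ⟨hE, hcov, e₀, he, hr⟩ := h
  subst he
  have hker : (FundamentalGroup.map p e₀).range = ν.ker := by
    rw [← hr]
    congr 1
    ext γ
    rw [FundamentalGroup.mapOfEq_apply]
    exact (Path.Homotopic.Quotient.cast_rfl_rfl _).symm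
  have h1 : ∀ i : ℕ, Module.Finite ℂ (singularHomology E i) ↔ _ :=
    fun i => finite_singularHomology_cover hker hcov hν
  refine (finite_directSum_iff fun i : Fin (k + 1) => singularHomology E (i : ℕ)).trans ?_
  exact ⟨fun h i hi => (h1 i).mp (h ⟨i, Nat.lt_succ_of_le hi⟩),
    fun h i => (h1 i).mpr (h i (Nat.le_of_lt_succ i.2))⟩

end Cover

/-! ### Infinite cyclic covers. -/

section Infinite

variable {X : Type u} [TopologicalSpace X] [T2Space X] [Topology.CWComplex (Set.univ : Set X)]
  [ConnectedSpace X] {x₀ : X} {k K : ℕ}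

/-- Finiteness of the homology of infinite cyclic covers. -/
theorem fgMod_infiniteCyclic_iff
    (hfin : ∀ n ≤ K, Finite (Topology.RelCWComplex.cell (Set.univ : Set X) n)) (hk : k ≤ K)
    {ν : FundamentalGroup X x₀ →* Multiplicative ℤ} :
    (∀ i ≤ k, FGMod False ((cyc (groupSys ν).dd i).restrictScalars ℂ)
      ((bnd (groupSys ν).dd i).restrictScalars ℂ)) ↔
    pullbackHom ν (Int.castAddHom ℂ) ∉ ⋃ i ≤ k, expTangentCone (charVariety x₀ i 1) := by
  let a : Additive (Multiplicative ℤ) →+ ℂ := Int.castAddHom ℂ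
  have ha : a ≠ 0 := fun h => one_ne_zero (α := ℂ)
    (Int.cast_one.symm.trans (DFunLike.congr_fun h (Additive.ofMul (Multiplicative.ofAdd 1))))
  have h0 : ∀ t : ℂ, expChar (t • pullbackHom ν (Int.castAddHom ℂ)) = (expChar (t • a)).comp ν :=
    fun t => rfl
  constructor
  · intro h hmem
    obtain ⟨i, hi, hmem⟩ := Set.mem_iUnion₂.mp hmem
    obtain ⟨t, ht⟩ := exists_expChar_notMem h ha
    exact ht i hi (h0 t ▸ hmem t)
  · intro h i hi
    have h1 : ∀ i ≤ k, ∃ χ : Multiplicative ℤ →* ℂˣ, χ.comp ν ∉ charVariety x₀ i 1 := by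
      intro i hi
      by_contra! h2
      exact h (Set.mem_iUnion₂.mpr ⟨i, hi, fun t => (h0 t).symm ▸ h2 _⟩)
    obtain ⟨f, hf, hf0⟩ := exists_mem_annIdeal_ne_zero hfin hk h1
    have := finite_quotient_of_ne_zero hf0 hf
    exact fgMod_of_finite_quotient hfin hk hi

end Infinite

/-! ### Loops as singular simplices -/

section Loops

variable {X : Type u} [TopologicalSpace X] [PathConnectedSpace X] {x₀ : X} {A : Type*} [CommGroup A]

theorem transport_cast (φ : FundamentalGroup X x₀ →* A) {x y x' y' : X}
    (γ : Path.Homotopic.Quotient x y) (hx : x' = x) (hy : y' = y) :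
    transport φ (γ.cast hx hy) = transport φ γ := by
  subst hx hy
  rw [Path.Homotopic.Quotient.cast_rfl_rfl]

/-- A path as a singular simplex. -/
def pathSimp {x y : X} (γ : Path x y) : Simp X 1 :=
  γ.toContinuousMap.comp ⟨stdSimplexHomeomorphUnitInterval, by fun_prop⟩

theorem stdSimplexHomeomorph_vertex :
    stdSimplexHomeomorphUnitInterval (stdSimplex.vertex 0) = 0 ∧
      stdSimplexHomeomorphUnitInterval (stdSimplex.vertex 1) = 1 :=
  ⟨stdSimplexHomeomorphUnitInterval_zero, stdSimplexHomeomorphUnitInterval_one⟩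

omit [PathConnectedSpace X] in
theorem pathSimp_vertex {x y : X} (γ : Path x y) :
    pathSimp γ (stdSimplex.vertex 0) = x ∧ pathSimp γ (stdSimplex.vertex 1) = y :=
  ⟨(congrArg γ stdSimplexHomeomorph_vertex.1).trans γ.source,
    (congrArg γ stdSimplexHomeomorph_vertex.2).trans γ.target⟩

theorem edgeWeight_pathSimp (φ : FundamentalGroup X x₀ →* A) {x y : X} (γ : Path x y) :
    edgeWeight φ (pathSimp γ) 0 1 = transport φ (Path.Homotopic.Quotient.mk γ) := by
  let δ : Path (stdSimplex.vertex (S := ℝ) (0 : Fin 2)) (stdSimplex.vertex 1) :=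
    { toFun := stdSimplexHomeomorphUnitInterval.symm
      source' := by rw [← stdSimplexHomeomorph_vertex.1, Homeomorph.symm_apply_apply]
      target' := by rw [← stdSimplexHomeomorph_vertex.2, Homeomorph.symm_apply_apply] }
  rw [edgeWeight, weight_eq φ _ (Path.Homotopic.Quotient.mk δ),
    ← transport_cast φ (Path.Homotopic.Quotient.mk γ) (pathSimp_vertex γ).1 (pathSimp_vertex γ).2]
  congr 1

/-- Every element of the fundamental group is represented by a singular simplex. -/
theorem exists_loop_simplex (g : FundamentalGroup X x₀) : ∃ σ : Simp X 1,
    σ (stdSimplex.vertex 0) = x₀ ∧ σ (stdSimplex.vertex 1) = x₀ ∧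
      (∀ ν : FundamentalGroup X x₀ →* A, edgeWeight ν σ 0 1 = ν g) := by
  obtain ⟨γ, hγ⟩ : ∃ γ : Path x₀ x₀, Path.Homotopic.Quotient.mk γ = FundamentalGroup.toPath g :=
    Quotient.exists_rep _
  refine ⟨pathSimp γ, (pathSimp_vertex γ).1, (pathSimp_vertex γ).2, fun ν => ?_⟩
  rw [edgeWeight_pathSimp, transport_loop, hγ]

omit [PathConnectedSpace X] in
theorem pull_succAbove_eq {σ : Simp X 1}
    (h : σ (stdSimplex.vertex 0) = σ (stdSimplex.vertex 1)) :
    pull (Fin.succAbove 0) σ = pull (Fin.succAbove 1) σ := by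
  ext x
  have hx : x = stdSimplex.vertex 0 := Subsingleton.elim _ _
  rw [hx]
  change σ (stdSimplex.map _ _) = σ (stdSimplex.map _ _)
  rw [stdSimplex.map_vertex, stdSimplex.map_vertex]
  exact h.symm

theorem charCochain_loop {z : Additive (FundamentalGroup X x₀) →+ ℂ} (g : FundamentalGroup X x₀) :
    ∃ σ : Simp X 1, σ (stdSimplex.vertex 0) = σ (stdSimplex.vertex 1) ∧
      charCochain z σ = z (Additive.ofMul g) := by
  obtain ⟨σ, h0, h1, h⟩ := exists_loop_simplex (A := Multiplicative ℂ) g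
  exact ⟨σ, h0.trans h1.symm, congrArg Multiplicative.toAdd (h _)⟩

theorem homToH1_zero : homToH1 (0 : Additive (FundamentalGroup X x₀) →+ ℂ) = 0 := by
  refine (Submodule.Quotient.mk_eq_zero _).mpr ?_
  exact zero_mem (coboundaries X 1)

/-- A coboundary vanishes on a simplex whose two ends coincide, and the character cochain takes the
value `z g` on a loop representing `g`. -/
theorem homToH1_injective :
    Function.Injective (homToH1 : (Additive (FundamentalGroup X x₀) →+ ℂ) → Cohomology X 1) := by
  intro z z' h
  have h1 := (Submodule.Quotient.eq _).mp h
  obtain ⟨f, hf⟩ : charCochain z - charCochain z' ∈ coboundaries X 1 := h1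
  refine DFunLike.ext _ _ fun g => ?_
  obtain ⟨σ, hσ, h2⟩ : ∃ σ : Simp X 1, σ (stdSimplex.vertex 0) = σ (stdSimplex.vertex 1) ∧
      charCochain (z - z') σ = (z - z') g := charCochain_loop g
  have h3 : charCochain (z - z') σ = charCochain z σ - charCochain z' σ := rfl
  have h4 : charCochain z σ - charCochain z' σ = 0 := by
    refine (congrFun hf σ).symm.trans ?_
    change ∑ i : Fin 2, (-1 : ℂ) ^ (i : ℕ) * f (pull i.succAbove σ) = 0
    rw [Fin.sum_univ_two, pull_succAbove_eq hσ]
    simp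
  rw [← sub_eq_zero]
  exact h2.symm.trans (h3.trans h4)

/-- The constant function `1` is a nonzero class in degree `0`. Hence the intersection in the second
part always contains `0`. -/
theorem zero_mem_resonanceVariety : (0 : Cohomology X 1) ∈ resonanceVariety X 0 1 := by
  let one : cocycles X 0 := ⟨fun _ => 1, by
    rw [LinearMap.mem_ker]
    funext σ
    change ∑ i : Fin 2, (-1 : ℂ) ^ (i : ℕ) * 1 = 0
    rw [Fin.sum_univ_two]
    simp⟩
  let c : LinearMap.ker (cupRight (X := X) 0 0) :=
    ⟨Submodule.Quotient.mk one, by simp⟩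
  let e : AomotoCohomology (0 : Cohomology X 1) 0 := Submodule.Quotient.mk c
  have he : e ≠ 0 := fun h => by
    have h1 : (Submodule.Quotient.mk one : Cohomology X 0) = 0 :=
      (Submodule.Quotient.mk_eq_zero _).mp h
    have h2 : (one : Cochain X 0) = 0 := (Submodule.Quotient.mk_eq_zero _).mp h1
    exact one_ne_zero (congrFun h2 (ContinuousMap.const _ (Classical.arbitrary X)))
  change ((1 : ℕ) : Cardinal) ≤ _
  have : Nontrivial (AomotoCohomology (0 : Cohomology X 1) 0) := ⟨e, 0, he⟩
  rw [Nat.cast_one, Cardinal.one_le_iff_ne_zero]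
  exact rank_pos.ne'

end Loops

/-! ### Finite generation of the abelianized fundamental group. -/

section Abelianization

variable {X : Type u} [TopologicalSpace X] [PathConnectedSpace X] {x₀ : X} [T2Space X]
  [Topology.CWComplex (Set.univ : Set X)]

/-- Edge weights with values in the abelianization define a map on integral `1`-chains that kills
boundaries and is onto already on loops. Its source modulo boundaries is controlled by `H_1(X, ℤ)`,
which is finitely generated. -/
theorem abelianization_fg
    (hfin : ∀ n ≤ 1, Finite (Topology.RelCWComplex.cell (Set.univ : Set X) n)) :
    Group.FG (Abelianization (FundamentalGroup X x₀)) := by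
  let w : LocSys X ℤ := LocSys.ofChar (1 : FundamentalGroup X x₀ →* ℤˣ)
  obtain ⟨N, hN, -, hle⟩ := fgMod_cyc w hfin le_rfl
  let ψ : (Simp X 1 →₀ ℤ) →ₗ[ℤ] Additive (Abelianization (FundamentalGroup X x₀)) :=
    Finsupp.linearCombination ℤ fun σ =>
      Additive.ofMul (edgeWeight (Abelianization.of (G := FundamentalGroup X x₀)) σ 0 1)
  have hB : ∀ x ∈ bnd w.dd 1, ψ x = 0 := by
    rintro _ ⟨x, rfl⟩
    induction x using Finsupp.induction_linear with
    | zero => simp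
    | add x y hx hy => rw [map_add, map_add, hx, hy, add_zero]
    | single σ c =>
      have h1 : ∀ i j, (w.edge σ i j : ℤ) = 1 := fun i j => rfl
      have h2 := congrArg Additive.ofMul
        (edgeWeight_mul (Abelianization.of (G := FundamentalGroup X x₀)) σ 0 1 2)
      rw [w.dd_single, map_smul, map_sum]
      simp only [h1, mul_one, ψ, Finsupp.linearCombination_single, edgeWeight_pull]
      refine (congrArg (c • ·) (Fin.sum_univ_three _)).trans ?_
      change c • ((-1 : ℤ) ^ 0 • Additive.ofMul (edgeWeight _ σ 1 2) +
        (-1 : ℤ) ^ 1 • Additive.ofMul (edgeWeight _ σ 0 2) +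
        (-1 : ℤ) ^ 2 • Additive.ofMul (edgeWeight _ σ 0 1)) = 0
      rw [← h2, ofMul_mul]
      simp
  have hsurj : (N.map ψ) = ⊤ := by
    refine eq_top_iff.mpr fun a _ => ?_
    obtain ⟨g, hg⟩ := QuotientGroup.mk_surjective a.toMul
    obtain ⟨σ, h0, h1, h⟩ :=
      exists_loop_simplex (A := Abelianization (FundamentalGroup X x₀)) g
    have hc : Finsupp.single σ (1 : ℤ) ∈ cyc w.dd 1 := by
      change w.dd 0 _ = 0
      have h1' : ∀ i j, (w.edge σ i j : ℤ) = 1 := fun i j => rfl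
      rw [w.dd_single]
      simp only [h1', mul_one]
      refine (congrArg ((1 : ℤ) • ·) (Fin.sum_univ_two _)).trans ?_
      rw [pull_succAbove_eq (h0.trans h1.symm), ← Finsupp.single_add]
      simp
    obtain ⟨n, hn, b, hb, hnb⟩ := Submodule.mem_sup.mp (hle hc)
    refine ⟨n, hn, ?_⟩
    have h2 : ψ n = ψ (Finsupp.single σ 1) := by rw [← hnb, map_add, hB b hb, add_zero]
    rw [h2, Finsupp.linearCombination_single, one_smul, h]
    exact congrArg Additive.ofMul hg
  have : Module.Finite ℤ (Additive (Abelianization (FundamentalGroup X x₀))) :=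
    ⟨hsurj ▸ hN.map ψ⟩
  have h3 : AddGroup.FG (Additive (Abelianization (FundamentalGroup X x₀))) :=
    Module.Finite.iff_addGroup_fg.mp this
  exact GroupFG.iff_add_fg.mpr h3

end Abelianization

/-! ### Tangent cones -/

section TangentCone

variable {G : Type*} [Group G]

theorem finite_hom [Group.FG (Abelianization G)] : Module.Finite ℂ (Additive G →+ ℂ) := by
  obtain ⟨S, hS⟩ := Group.fg_def.mp ‹Group.FG (Abelianization G)›
  let s : Abelianization G → G := Function.surjInv QuotientGroup.mk_surjective
  have hs : ∀ a, Abelianization.of (s a) = a := Function.surjInv_eq QuotientGroup.mk_surjective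
  let F : (Additive G →+ ℂ) →ₗ[ℂ] (S → ℂ) :=
    { toFun := fun z a => z (Additive.ofMul (s a))
      map_add' := fun _ _ => rfl
      map_smul' := fun _ _ => rfl }
  refine Module.Finite.of_injective F ((injective_iff_map_eq_zero F).mpr fun z hz => ?_)
  let Z : Abelianization G →* Multiplicative ℂ :=
    Abelianization.lift (AddMonoidHom.toMultiplicativeRight z)
  have h1 : Z.ker = ⊤ := by
    rw [← top_le_iff, ← hS, Subgroup.closure_le]
    intro a ha
    have h2 : Z (Abelianization.of (s a)) = Multiplicative.ofAdd (z (Additive.ofMul (s a))) := rfl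
    have h3 : z (Additive.ofMul (s a)) = 0 := congrFun hz ⟨a, ha⟩
    rw [hs, h3] at h2
    exact h2
  refine DFunLike.ext _ _ fun g => ?_
  have h4 : Abelianization.of (G := G) g.toMul ∈ Z.ker := h1 ▸ Subgroup.mem_top _
  exact h4

/-- A germ vanishing on `W` vanishes along the line `ℂ z`, so every homogeneous term of its
expansion, and not only the initial one, vanishes at `z`. -/
theorem expTangentCone_subset_tangentCone [Group.FG (Abelianization G)] (W : Set (G →* ℂˣ)) :
    expTangentCone W ⊆ tangentCone W := by
  intro z hz
  have := finite_hom (G := G)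
  let e : (Fin (Module.finrank ℂ (Additive G →+ ℂ)) → ℂ) ≃ₗ[ℂ] (Additive G →+ ℂ) :=
    (Module.finBasis ℂ (Additive G →+ ℂ)).equivFun.symm
  refine ⟨_, e, fun f P hP hf m _ => ?_⟩
  let u : ℂ →L[ℂ] (Fin (Module.finrank ℂ (Additive G →+ ℂ)) → ℂ) :=
    ContinuousLinearMap.toSpanSingleton ℂ (e.symm z)
  have h1 : HasFPowerSeriesAt (f ∘ u) (P.compContinuousLinearMap u) 0 :=
    HasFPowerSeriesAt.compContinuousLinearMap (by rwa [map_zero])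
  have h2 : ∀ᶠ t in nhds (0 : ℂ), (f ∘ u) t = 0 := by
    have h3 := (u.continuous.tendsto 0).eventually (by rwa [map_zero])
    refine h3.mono fun t ht => ht ?_
    have h4 : e (u t) = t • z := by
      rw [ContinuousLinearMap.toSpanSingleton_apply, map_smul, LinearEquiv.apply_symm_apply]
    rw [h4]
    exact hz t
  have h5 := h1.eq_zero_of_eventually h2
  have h6 := congrArg (fun p : FormalMultilinearSeries ℂ ℂ ℂ => p m fun _ => 1) h5
  simpa [FormalMultilinearSeries.compContinuousLinearMap, u, Function.comp_def] using h6

/-- A product of linear forms is its own only homogeneous term; such products are the germs used to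
bound tangent cones from above. -/
theorem hasFPowerSeriesAt_prod {E : Type*} [NormedAddCommGroup E] [NormedSpace ℂ E] {m : ℕ}
    (φ : Fin m → E →L[ℂ] ℂ) : ∃ P : FormalMultilinearSeries ℂ E ℂ,
      HasFPowerSeriesAt (fun x => ∏ i, φ i x) P 0 ∧ (∀ j < m, P j = 0) ∧
        ∀ x, P m (fun _ => x) = ∏ i, φ i x := by
  let φ' : ℕ → E →L[ℂ] ℂ := fun i => if h : i < m then φ ⟨i, h⟩ else 0
  let P : FormalMultilinearSeries ℂ E ℂ := fun n => if n = m then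
    (ContinuousMultilinearMap.mkPiAlgebraFin ℂ n ℂ).compContinuousLinearMap fun i => φ' i else 0
  have hP : ∀ n ≠ m, P n = 0 := fun n hn => if_neg hn
  have hPm : ∀ x, P m (fun _ => x) = ∏ i, φ i x := fun x => by
    simp [P, φ', List.prod_ofFn]
  refine ⟨P, ⟨⊤, ?_, by simp, ?_⟩, fun j hj => hP j hj.ne, hPm⟩
  · rw [FormalMultilinearSeries.radius_eq_top_of_eventually_eq_zero]
    exact (Filter.eventually_gt_atTop m).mono fun n hn => hP n hn.ne'
  · intro y _
    rw [zero_add, ← hPm]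
    exact hasSum_single m fun n hn => by rw [hP n hn]; rfl

/-- A tangent cone lies in every finite union of subspaces which contains the logarithms of the
characters near `1`. -/
theorem exists_mem_of_mem_tangentCone {W : Set (G →* ℂˣ)} {ι : Type*} [Finite ι]
    (L : ι → Submodule ℂ (Additive G →+ ℂ)) (F : Finset (Additive G))
    (h : ∀ z : Additive G →+ ℂ, (∀ g ∈ F, ‖z g‖ < 1) → expChar z ∈ W → ∃ i, z ∈ L i)
    {z : Additive G →+ ℂ} (hz : z ∈ tangentCone W) : ∃ i, z ∈ L i := by
  by_contra! hn
  obtain ⟨n, e, he⟩ := hz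
  -- One linear form for each subspace, vanishing on it but not at `z`. Their product vanishes on
  -- `W` near `1`, while its initial form does not vanish at `z`.
  choose φ hφz hφ using fun i => Submodule.exists_le_ker_of_notMem (hn i)
  obtain ⟨m, ⟨r⟩⟩ := Finite.exists_equiv_fin ι
  let ψ : Fin m → (Fin n → ℂ) →L[ℂ] ℂ := fun i =>
    LinearMap.toContinuousLinearMap (φ (r.symm i) ∘ₗ e.toLinearMap)
  obtain ⟨P, hP, hP0, hPm⟩ := hasFPowerSeriesAt_prod ψ
  have h1 : ∀ g : Additive G, ∀ᶠ x in nhds (0 : Fin n → ℂ), ‖e x g‖ < 1 := fun g => by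
    let δ : (Fin n → ℂ) →ₗ[ℂ] ℂ :=
      { toFun := fun x => e x g
        map_add' := fun x y => by rw [map_add]; rfl
        map_smul' := fun c x => by rw [map_smul]; rfl }
    have h2 : Continuous fun x => ‖δ x‖ := (LinearMap.continuous_of_finiteDimensional δ).norm
    exact h2.continuousAt.eventually_lt continuousAt_const (by simp)
  have h3 := he _ P hP (((Finset.eventually_all F).mpr fun g _ => h1 g).mono fun x hx hxW => by
    obtain ⟨i, hi⟩ := h (e x) hx hxW
    refine Finset.prod_eq_zero (Finset.mem_univ (r i)) ?_
    change φ (r.symm (r i)) (e x) = 0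
    rw [Equiv.symm_apply_apply]
    exact hφ i hi) m fun j hj x => by rw [hP0 j hj]; rfl
  rw [hPm, Finset.prod_eq_zero_iff] at h3
  obtain ⟨i, -, hi⟩ := h3
  refine hφz (r.symm i) ?_
  have h4 : φ (r.symm i) (e (e.symm z)) = 0 := hi
  rwa [LinearEquiv.apply_symm_apply] at h4

theorem expChar_mem_identityComponent (z : Additive G →+ ℂ) :
    expChar z ∈ identityComponent G := by
  intro g hg
  obtain ⟨n, hn, h⟩ := hg.exists_pow_eq_one
  let Z : Abelianization G →* Multiplicative ℂ :=
    Abelianization.lift (AddMonoidHom.toMultiplicativeRight z)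
  have h1 : (n : ℂ) * z (Additive.ofMul g) = 0 := by
    have h2 := congrArg Z h
    rw [map_pow, map_one] at h2
    have h3 : n • z (Additive.ofMul g) = 0 := h2
    rwa [nsmul_eq_mul] at h3
  have h4 : z (Additive.ofMul g) = 0 :=
    (mul_eq_zero.mp h1).resolve_left (Nat.cast_ne_zero.mpr hn.ne')
  ext
  change Complex.exp (z (Additive.ofMul g)) = 1
  rw [h4, Complex.exp_zero]

theorem eq_of_exp_eq_exp {a b : ℂ} (h : Complex.exp a = Complex.exp b) (ha : ‖a‖ < 1)
    (hb : ‖b‖ < 1) : a = b := by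
  obtain ⟨n, hn⟩ := Complex.exp_eq_exp_iff_exists_int.mp h
  rcases eq_or_ne n 0 with rfl | hn0
  · simpa using hn
  · exfalso
    have h1 : ‖a - b‖ < 2 := (norm_sub_le a b).trans_lt (by linarith)
    have h2 : ‖a - b‖ = |(n : ℝ)| * (2 * Real.pi) := by
      rw [hn, add_sub_cancel_left]
      simp [abs_of_pos Real.pi_pos]
    have h3 : (1 : ℝ) ≤ |(n : ℝ)| := by exact_mod_cast Int.one_le_abs hn0
    nlinarith [Real.pi_gt_three]

/-- The tangent cone of a set of characters which is a union of subtori near `1` and lies in the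
zero set `V` of an ideal of the group algebra is contained in the exponential tangent cone of
`V`. -/
theorem tangentCone_subset_expTangentCone [Group.FG (Abelianization G)] {V W : Set (G →* ℂˣ)}
    {I : Ideal (MonoidAlgebra ℂ (Abelianization G))}
    (hV : ∀ χ : Abelianization G →* ℂˣ,
      χ.comp Abelianization.of ∈ V ↔ ∀ f ∈ I, ev χ f = 0)
    (hWV : W ⊆ V) {S : Set (Set (G →* ℂˣ))} (hS : ∀ T ∈ S, IsSubtorus T)
    (hWS : W ∩ identityComponent G = ⋃₀ S) : tangentCone W ⊆ expTangentCone V := by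
  classical
  intro z hz
  let s : Abelianization G → G := Function.surjInv QuotientGroup.mk_surjective
  have hs : ∀ a, Abelianization.of (s a) = a := Function.surjInv_eq QuotientGroup.mk_surjective
  obtain ⟨J, hJ⟩ := (isNoetherianRing_iff_ideal_fg _).mp inferInstance I
  have hev : ∀ (χ : Abelianization G →* ℂˣ) (f : MonoidAlgebra ℂ (Abelianization G)),
      ev χ f = ∑ a ∈ f.coeff.support, f.coeff a * (χ.comp Abelianization.of (s a) : ℂˣ) := by
    intro χ f
    rw [ev_apply]
    refine Finset.sum_congr rfl fun a _ => ?_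
    rw [MonoidHom.comp_apply, hs]
  have hVJ : ∀ ρ : G →* ℂˣ, ρ ∈ V ↔
      ∀ f ∈ J, ∑ a ∈ f.coeff.support, f.coeff a * (ρ (s a) : ℂ) = 0 := by
    intro ρ
    obtain ⟨χ, rfl⟩ : ∃ χ : Abelianization G →* ℂˣ, χ.comp Abelianization.of = ρ :=
      ⟨Abelianization.lift ρ, Abelianization.lift.symm_apply_apply ρ⟩
    rw [hV]
    simp only [← hev]
    refine ⟨fun h f hf => h f (hJ ▸ Ideal.subset_span hf), fun h f hf => ?_⟩
    have h1 : I ≤ RingHom.ker (ev χ) := hJ ▸ Ideal.span_le.mpr h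
    exact h1 hf
  -- The exponents occurring in the finitely many generators of `I`.
  let F : Finset (Abelianization G) := J.biUnion fun f => f.coeff.support
  let L : Set (Abelianization G × Abelianization G) → Submodule ℂ (Additive G →+ ℂ) := fun P =>
    { carrier := {x | ∀ p ∈ P, x (Additive.ofMul (s p.1)) = x (Additive.ofMul (s p.2))}
      add_mem' := fun hx hy p hp => congrArg₂ (· + ·) (hx p hp) (hy p hp)
      zero_mem' := fun p _ => rfl
      smul_mem' := fun c x hx p hp => congrArg (c * ·) (hx p hp) }
  -- Sets of coincidences among exponents that force the exponential into `V`. There are finitely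
  -- many, although the family `S` of subtori may be infinite.
  let good : Set (Finset (Abelianization G × Abelianization G)) :=
    {P | P ⊆ F ×ˢ F ∧ ∀ x ∈ L P, expChar x ∈ V}
  have hgood : good.Finite := ((F ×ˢ F).powerset.finite_toSet).subset fun P hP =>
    Finset.mem_coe.mpr (Finset.mem_powerset.mpr hP.1)
  have := hgood.to_subtype
  obtain ⟨⟨P, hP⟩, hPz⟩ := exists_mem_of_mem_tangentCone (ι := good) (fun P => L P.1)
    (F.image fun a => Additive.ofMul (s a)) (W := W) (fun x hx hxW => by
      obtain ⟨T, hT, hxT⟩ : expChar x ∈ ⋃₀ S := hWS ▸ ⟨hxW, expChar_mem_identityComponent x⟩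
      have hTV : T ⊆ V := fun ρ hρ =>
        hWV (hWS.symm ▸ Set.mem_sUnion_of_mem hρ hT : ρ ∈ W ∩ identityComponent G).1
      obtain ⟨m, μ, -, rfl⟩ := hS T hT
      obtain ⟨χ, hχ⟩ := hxT
      have hx' : ∀ a ∈ F, ‖x (Additive.ofMul (s a))‖ < 1 := fun a ha =>
        hx _ (Finset.mem_image_of_mem _ ha)
      have hexp : ∀ g, Complex.exp (x (Additive.ofMul g)) = (χ (μ g) : ℂ) := fun g =>
        congrArg Units.val (DFunLike.congr_fun hχ g).symm
      refine ⟨⟨(F ×ˢ F).filter fun p => μ (s p.1) = μ (s p.2), Finset.filter_subset _ _,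
        fun y hy => (hVJ _).mpr fun f hf => ?_⟩, fun p hp => ?_⟩
      -- Each generator vanishes on the whole subtorus, so its coefficients sum to zero over
      -- exponents with the same image under `μ`. It then vanishes at any character that is constant
      -- on these classes.
      · have h1 : ∀ u, ∑ a ∈ f.coeff.support with μ (s a) = u, f.coeff a = 0 :=
          sum_fiber_eq_zero _ _ (fun a => μ (s a)) fun χ => (hVJ _).mp (hTV ⟨χ, rfl⟩) f hf
        rw [← Finset.sum_fiberwise_of_maps_to (t := f.coeff.support.image fun a => μ (s a))
          (g := fun a => μ (s a)) (fun a ha => Finset.mem_image_of_mem _ ha)]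
        refine Finset.sum_eq_zero fun u hu => ?_
        obtain ⟨b, hb, rfl⟩ := Finset.mem_image.mp hu
        have h2 : ∀ a ∈ f.coeff.support.filter (fun a => μ (s a) = μ (s b)),
            f.coeff a * ((expChar y (s a) : ℂˣ) : ℂ) =
              f.coeff a * ((expChar y (s b) : ℂˣ) : ℂ) := by
          intro a ha
          obtain ⟨ha, hab⟩ := Finset.mem_filter.mp ha
          have h3 := hy (a, b) (Finset.mem_coe.mpr (Finset.mem_filter.mpr ⟨Finset.mem_product.mpr
            ⟨Finset.mem_biUnion.mpr ⟨f, hf, ha⟩, Finset.mem_biUnion.mpr ⟨f, hf, hb⟩⟩, hab⟩))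
          change _ * Complex.exp _ = _ * Complex.exp _
          rw [h3]
        rw [Finset.sum_congr rfl h2, ← Finset.sum_mul, h1, zero_mul]
      -- Exponents with the same image under `μ` have the same exponential, and the bound `1` on the
      -- logarithms excludes a difference by a multiple of `2πi`.
      · obtain ⟨hp, hμ⟩ := Finset.mem_filter.mp (Finset.mem_coe.mp hp)
        obtain ⟨h1, h2⟩ := Finset.mem_product.mp hp
        exact eq_of_exp_eq_exp (by rw [hexp, hexp, hμ]) (hx' _ h1) (hx' _ h2)) hz
  exact fun t => hP.2 _ ((L P).smul_mem t hPz)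

end TangentCone

/-! ### Free abelian covers -/

section FreeAbelian

variable {X : Type u} [TopologicalSpace X] [T2Space X] [Topology.CWComplex (Set.univ : Set X)]
  [ConnectedSpace X] {x₀ : X} {k K r : ℕ} {ν : FundamentalGroup X x₀ →* Multiplicative (Fin r → ℤ)}

/-- A resonant class lies in `TC₁(V^i)`, hence in `τ₁` of the union of the `V^j`. The degree `j` may
vary along the line, so the contradiction comes from a parameter `t` that avoids all degrees
simultaneously. -/
theorem pullbackHom_eq_zero {h : (Fin r → ℤ) →+ ℂ} (hfin : ∀ n ≤ K,
      Finite (Topology.RelCWComplex.cell (Set.univ : Set X) n)) (hk : k ≤ K) (hK : 1 ≤ K)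
    (star : ConditionStar x₀ k)
    (hF : ∀ i ≤ k, FGMod False ((cyc (groupSys ν).dd i).restrictScalars ℂ)
      ((bnd (groupSys ν).dd i).restrictScalars ℂ)) {i : ℕ} (hi : i ≤ k)
    (hR : homToH1 (pullbackHom ν h) ∈ resonanceVariety X i 1) : pullbackHom ν h = 0 := by
  have := abelianization_fg (X := X) (x₀ := x₀) fun n hn => hfin n (hn.trans hK)
  by_contra h0
  let a : Additive (Multiplicative (Fin r → ℤ)) →+ ℂ := h
  have ha : a ≠ 0 := by
    rintro ha
    refine h0 (DFunLike.ext _ _ fun g => ?_)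
    exact DFunLike.congr_fun ha (ν g.toMul)
  obtain ⟨t, ht⟩ := exists_expChar_notMem hF ha
  obtain ⟨S, hS, hWS⟩ := star.subtori i hi
  rw [← star.tangentConeFormula i hi] at hR
  obtain ⟨z, hz, hzh⟩ := hR
  rw [homToH1_injective hzh] at hz
  obtain ⟨j, hj, hmem⟩ := tangentCone_subset_expTangentCone
    (V := {ρ | ∃ i ≤ k, ρ ∈ charVariety x₀ i 1}) (I := annIdeal Abelianization.of k)
    (exists_charVariety_iff hfin hk) (fun ρ hρ => ⟨i, hi, hρ⟩) hS hWS hz t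
  exact ht j hj hmem

/-- The point `χ∘ν` lies in a subtorus defined by some `μ`, contained in `V^i`. A functional `h`
that vanishes on `ν(ker μ)` pulls back to a tangent direction of this subtorus, hence to a resonant
class. -/
theorem exists_pullbackHom_mem_resonanceVariety (hfin : ∀ n ≤ K,
      Finite (Topology.RelCWComplex.cell (Set.univ : Set X) n)) (hK : 1 ≤ K)
    (star : ConditionStar x₀ k) (hν : Function.Surjective ν)
    {χ : Multiplicative (Fin r → ℤ) →* ℂˣ} {i : ℕ} (hi : i ≤ k)
    (hχ : χ.comp ν ∈ charVariety x₀ i 1) {q : Multiplicative (Fin r → ℤ)}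
    (hq : ∀ n, 0 < n → χ q ^ n ≠ 1) : ∃ h : (Fin r → ℤ) →+ ℂ, pullbackHom ν h ≠ 0 ∧
      homToH1 (pullbackHom ν h) ∈ resonanceVariety X i 1 := by
  have := abelianization_fg (X := X) (x₀ := x₀) fun n hn => hfin n (hn.trans hK)
  obtain ⟨S, hS, hWS⟩ := star.subtori i hi
  have hid : χ.comp ν ∈ identityComponent (FundamentalGroup X x₀) := fun g hg => by
    have h1 : IsOfFinOrder (ν g) := (Abelianization.lift ν).isOfFinOrder hg
    rw [MonoidHom.comp_apply, h1.eq_one', map_one]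
  obtain ⟨T, hT, hχT⟩ : χ.comp ν ∈ ⋃₀ S := hWS ▸ ⟨hχ, hid⟩
  have hTV : T ⊆ charVariety x₀ i 1 := fun ρ hρ =>
    (hWS.symm ▸ Set.mem_sUnion_of_mem hρ hT : ρ ∈ charVariety x₀ i 1 ∩ identityComponent _).1
  obtain ⟨m, μ, hμ, rfl⟩ := hS T hT
  obtain ⟨ψ, hψ⟩ := hχT
  -- The character `χ` is trivial on `ν(ker μ)`, so an element `q` on which `χ` has infinite order
  -- still has infinite order modulo `N` and is detected by a functional.
  let N : AddSubgroup (Fin r → ℤ) := Subgroup.toAddSubgroup' (μ.ker.map ν)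
  have hN : ∀ v ∈ μ.ker.map ν, χ v = 1 := by
    rintro _ ⟨g, hg, rfl⟩
    have h1 : ψ (μ g) = χ (ν g) := DFunLike.congr_fun hψ g
    rw [← h1, MonoidHom.mem_ker.mp hg, map_one]
  obtain ⟨b, hb⟩ := exists_hom_ne_zero (M := (Fin r → ℤ) ⧸ N)
    (q := QuotientAddGroup.mk' N q.toAdd) (fun n hn h0 => hq n hn (by
      rw [← map_nsmul] at h0
      have h1 := (QuotientAddGroup.eq_zero_iff _).mp h0
      rw [← map_pow]
      exact hN (q ^ n) h1))
  let h : (Fin r → ℤ) →+ ℂ := b.comp (QuotientAddGroup.mk' N)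
  have hh : ∀ g ∈ μ.ker, pullbackHom ν h (Additive.ofMul g) = 0 := fun g hg => by
    have h1 : QuotientAddGroup.mk' N (ν g).toAdd = 0 :=
      (QuotientAddGroup.eq_zero_iff _).mpr ⟨g, hg, rfl⟩
    change b (QuotientAddGroup.mk' N (ν g).toAdd) = 0
    rw [h1, map_zero]
  refine ⟨h, fun h0 => ?_, ?_⟩
  · obtain ⟨g, rfl⟩ := hν q
    exact hb (DFunLike.congr_fun h0 (Additive.ofMul g))
  · rw [← star.tangentConeFormula i hi]
    refine ⟨_, expTangentCone_subset_tangentCone _ fun t => hTV ?_, rfl⟩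
    -- The exponentials of the line through `ν^*h` are trivial on `ker μ`, so they factor through
    -- `μ` and stay in the subtorus.
    refine ⟨μ.liftOfSurjective hμ ⟨expChar (t • pullbackHom ν h), fun g hg => ?_⟩,
      MonoidHom.liftOfRightInverse_comp _ _ _ _⟩
    rw [MonoidHom.mem_ker]
    ext
    change Complex.exp (t * pullbackHom ν h (Additive.ofMul g)) = 1
    rw [hh g hg, mul_zero, Complex.exp_zero]

/-- Finiteness of the homology of free abelian covers. -/
theorem fgMod_freeAbelian_iff (hfin : ∀ n ≤ K,
      Finite (Topology.RelCWComplex.cell (Set.univ : Set X) n)) (hk : k ≤ K) (hK : 1 ≤ K)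
    (star : ConditionStar x₀ k) (hν : Function.Surjective ν) :
    (∀ i ≤ k, FGMod False ((cyc (groupSys ν).dd i).restrictScalars ℂ)
      ((bnd (groupSys ν).dd i).restrictScalars ℂ)) ↔
    (homToH1 '' Set.range (pullbackHom ν)) ∩ (⋃ i ≤ k, resonanceVariety X i 1) = {0} := by
  constructor
  · intro hF
    ext c
    constructor
    · rintro ⟨⟨_, ⟨h, rfl⟩, rfl⟩, hR⟩
      obtain ⟨i, hi, hR⟩ := Set.mem_iUnion₂.mp hR
      rw [pullbackHom_eq_zero hfin hk hK star hF hi hR, homToH1_zero]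
      rfl
    · rintro rfl
      exact ⟨⟨0, ⟨0, rfl⟩, homToH1_zero⟩,
        Set.mem_iUnion₂.mpr ⟨0, Nat.zero_le k, zero_mem_resonanceVariety⟩⟩
  · intro h0 i hi
    have hcount : {χ : Multiplicative (Fin r → ℤ) →* ℂˣ |
        ∀ f ∈ annIdeal ν k, ev χ f = 0}.Countable := by
      refine countable_torsion_chars.mono fun χ hχ => ?_
      -- A zero of the annihilator ideal that is not a torsion character would give a nonzero
      -- resonant class in the image of `ν^*`.
      by_contra hq
      simp only [Set.mem_ofPred_eq, not_forall, not_exists, not_and] at hq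
      obtain ⟨q, hq⟩ := hq
      obtain ⟨j, hj, hmem⟩ := (exists_charVariety_iff hfin hk χ).mpr hχ
      obtain ⟨h, hne, hR⟩ :=
        exists_pullbackHom_mem_resonanceVariety hfin hK star hν hj hmem hq
      have h1 : homToH1 (pullbackHom ν h) = 0 :=
        h0.subset ⟨⟨_, ⟨h, rfl⟩, rfl⟩, Set.mem_iUnion₂.mpr ⟨j, hj, hR⟩⟩
      exact hne (homToH1_injective (h1.trans homToH1_zero.symm))
    have := finite_quotient_of_countable _ hcount
    exact fgMod_of_finite_quotient hfin hk hi

end FreeAbelian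

end AbelCovers

end

theorem theorem1p3 {X : Type u} [TopologicalSpace X] [T2Space X]
    [Topology.CWComplex (Set.univ : Set X)] [ConnectedSpace X] (x₀ : X) (k : ℕ)
    (hfin : ∀ n ≤ max k 1, Finite (Topology.RelCWComplex.cell (Set.univ : Set X) n)) :
    (∀ ν : FundamentalGroup X x₀ →* Multiplicative ℤ, Function.Surjective ν →
      ∀ (E : Type u) [TopologicalSpace E] (p : C(E, X)), AbelCovers.IsCoverOf ν p →
        (FiniteDimensional ℂ
            (DirectSum (Fin (k + 1)) fun i => AbelCovers.singularHomology E (i : ℕ)) ↔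
          AbelCovers.pullbackHom ν (Int.castAddHom ℂ) ∉
            ⋃ i ≤ k, AbelCovers.expTangentCone (AbelCovers.charVariety x₀ i 1))) ∧
    (AbelCovers.ConditionStar x₀ k →
      ∀ (r : ℕ) (ν : FundamentalGroup X x₀ →* Multiplicative (Fin r → ℤ)), Function.Surjective ν →
      ∀ (E : Type u) [TopologicalSpace E] (p : C(E, X)), AbelCovers.IsCoverOf ν p →
        (FiniteDimensional ℂ
            (DirectSum (Fin (k + 1)) fun i => AbelCovers.singularHomology E (i : ℕ)) ↔
          (AbelCovers.homToH1 '' Set.range (AbelCovers.pullbackHom ν)) ∩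
            (⋃ i ≤ k, AbelCovers.resonanceVariety X i 1) = {0})) := by
  exact ⟨fun ν hν E _ p hp => (hp.finite_singularHomology hν k).trans
      (AbelCovers.fgMod_infiniteCyclic_iff hfin (le_max_left k 1)),
    fun star r ν hν E _ p hp => (hp.finite_singularHomology hν k).trans
      (AbelCovers.fgMod_freeAbelian_iff hfin (le_max_left k 1) (le_max_right k 1) star hν)⟩
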